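/- **Setting.** Let $d\ge1$, $0<\gamma,\beta\le 2$, $L_1,L_2>0$, $p>0$. For $\alpha>0$ let $\lfloor\alpha\rfloor$ be the largest integer strictly less than $\alpha$. The Hölder class $\mathbb H_d(\alpha,L)$ is the set of $G:\mathbb R^d\to\mathbb R$ that have all partial derivatives up to order $\lfloor\alpha\rfloor$, with $$\sum_{|k|\le\lfloor\alpha\rfloor}\sup_x|\partial^kG(x)|\le L,\qquad \Big|G(y)-\sum_{|k|\le\lfloor\alpha\rfloor}\partial^kG(x)\prod_j\tfrac{(y_j-x_j)^{k_j}}{k_j!}\Big|\le L\|y-x\|^\alpha\quad\forall x,y .$$ Let $\mathbb H(\mathcal A,\mathcal L)=\{f\circ G: f\in\mathbb H_1(\gamma,L_1),\ G\in\mathbb H_d(\beta,L_2)\}$, where $\mathcal A=(\gamma,\beta)$, $\mathcal L=(L_1,L_2)$. For $0<\varepsilon<1$ one observes $X_\varepsilon(dt)=g(t)\,dt+\varepsilon W(dt)$, $t\in\mathcal D$, where $\mathcal D=\prod_k(a_k,b_k)\supset[-1,1]^d$ is a bounded open box and $W(dt)$ is Gaussian white noise (the standard Brownian sheet). Put $\|h\|_\infty=\sup_{[-1,1]^d}|h|$,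 $\kappa_\varepsilon=\varepsilon\sqrt{\ln(1/\varepsilon)}$ and $$\phi_\varepsilon(\gamma,\beta)=\begin{cases}\kappa_\varepsilon^{2\gamma/(2\gamma+1+(d-1)/\beta)},&\beta>1,\ \beta\ge d(\gamma-1)+1,\\ \kappa_\varepsilon^{2/(2+d/\beta)},&\gamma>1,\ \beta<d(\gamma-1)+1,\\ \kappa_\varepsilon^{2/(2+d/(\gamma\beta))},&(\gamma,\beta)\in(0,1]^2,\end{cases}\qquad \mathcal P_2=\{1<\gamma\le\beta\le2,\ \beta\ge d(\gamma-1)+1\}.$$ **Weights.** For $\lambda>0$ define $K_\lambda=K_{(\mathcal A,\lambda)}:\mathbb R^d\to\mathbb R$ as follows. * If $\gamma,\beta\le1$: the normalized indicator of $[-h,h]^d$, $h=\lambda^{1/(\gamma\beta)}$. * If $\gamma\le1<\beta$: the normalized indicator of $[-\lambda^{1/\gamma},\lambda^{1/\gamma}]\times[-\lambda^{1/(\gamma\beta)},\lambda^{1/(\gamma\beta)}]^{d-1}$. * If $\gamma>1$, $\beta\le\gamma$: the normalized indicator of $[-h,h]^d$, $h=\lambda^{1/\beta}$. * If $1<\gamma<\beta$: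 for an integer $r\ge2$ and sequences $(u_i)_{i\le r}$, $(v_i)_{i\le r+1}$ with $v_r=\frac12\lambda^{1/\beta}$, $v_{r+1}=0$, put $$K_\lambda(y)=2^{-d}\Big\{m_{1,1}(|y|)+\sum_{i=2}^r\big[m_{i,i}(|y|)-m_{i,i-1}(|y|)\big]\Big\},\qquad |y|=(|y_1|,\dots,|y_d|),$$ where $m_{i,j}$ is the indicator, divided by the volume, of $[u_{i-1},u_i]\times[v_{j+1},v_j]^{d-1}$ (with $u_0=0$). Let $\rho=(d-1)(\gamma-1)/\beta$. - *Two-step weight:* $r=2$, $u_1=\lambda^{1/\gamma}$, $u_2=\lambda^{1/\beta}$, $v_1=\lambda^{(\beta-\gamma+1)/\beta^2}$. - *Power weight:* the two-step weight if $\rho\ge(\beta-\gamma)/\gamma$; otherwise, with $\alpha_k=\beta^{-1}\sum_{i=0}^k\rho^i$, let $r\ge2$ be such that $\alpha_{r-1}\ge1/\gamma>\alpha_{r-2}$, and take $u_1=\lambda^{1/\gamma}$, $u_i=\lambda^{\alpha_{r-i}}$ ($2\le i\le r$), $v_i=\lambda^{1/\beta}u_{i+1}^{-(\gamma-1)/\beta}$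 ($i<r$). - If $\beta<d(\gamma-1)+1$, or if $(\beta-\gamma)/\gamma\le(1+\rho)\rho$, $K_\lambda$ is the power weight. - Otherwise let $V(\lambda)=\ln\{\frac{(\gamma-1)(\beta-\gamma)}{\gamma\beta^2}\ln(1/\lambda)\}$. If $V(\lambda)\le0$, $K_\lambda$ is the two-step weight. If $V(\lambda)>0$, let $r=\min\{s>1:\frac{V(\lambda)}{s-1}<\frac12\ln\frac{\sqrt5+1}2\}$, $\alpha=\frac{V(\lambda)}{r-1}$, $\nu=(\frac{\sqrt5+1}2)^{1/2}$, $u_i=\lambda^{1/\gamma}\exp\{\frac{\beta}{\gamma-1}e^{\alpha(i-1)}\}$ ($i\le r$), $v_i=\lambda^{1/(\gamma\beta)}\exp\{-\nu e^{\alpha i}\}$ ($i<r$). **Estimator.** For each unit vector $\vartheta$ fix an orthogonal matrix $M_\vartheta$ with first column $\vartheta$. For small $\varepsilon$ let $\mathbb S_\varepsilon$ be an $\varepsilon$-net of the unit sphere that contains $(1,0,\dots,0)$ and has at most $c\,\varepsilon^{-(d-1)}$ points, $c$ a constant. Given constants $C_1\le C_2$, let $\lambda_\varepsilon>0$ be such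 that $\lambda_\varepsilon\to0$ as $\varepsilon\to0$ and, for small $\varepsilon$, $$C_1\lambda_\varepsilon\le\kappa_\varepsilon\|K_{\lambda_\varepsilon}\|_2\le C_2\lambda_\varepsilon$$ (for $C_2=C_1$: $\lambda_\varepsilon$ solves $C_1\lambda=\kappa_\varepsilon\|K_\lambda\|_2$). Put $K_\vartheta(t)=K_{\lambda_\varepsilon}(M_\vartheta^Tt)$, $\hat g_\vartheta(x)=\int_{\mathcal D}K_\vartheta(t-x)X_\varepsilon(dt)$, $\hat g_{\vartheta'*\vartheta}(x)=\int_{\mathcal D}(K_{\vartheta'}*K_\vartheta)(t-x)X_\varepsilon(dt)$. Call $\vartheta\in\mathbb S_\varepsilon$ acceptable at $x$ if for all $\vartheta'\in\mathbb S_\varepsilon$ $$|\hat g_{\vartheta'*\vartheta}(x)-\hat g_{\vartheta'}(x)|\le(2+\sqrt{4p+8d})\,(\|K_{\vartheta'}\|_1+\|K_\vartheta\|_1)\,\|K_{\vartheta'}\|_2\,\kappa_\varepsilon .$$ Let $g^{**}(x)=\hat g_{\hat\vartheta_x}(x)$, where $\hat\vartheta_x$ is any acceptable orientation chosen measurably in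 the observation, and $g^{**}(x)=0$ if there is none. For $x\in[-1,1]^d$ let $z(x)\in\mathbb Z^d$ be such that $x\in\prod_k(\varepsilon^2(z_k-1),\varepsilon^2z_k]$, and let $g^*_{\mathcal A,\varepsilon}(x)$ be $g^{**}(\varepsilon^2z(x))$ truncated to $[-\ln\ln(1/\varepsilon),\ln\ln(1/\varepsilon)]$. **Theorem.** For all $(\gamma,\beta)\in(0,2]^2$ there is $C_0>0$, depending only on $\gamma,\beta,L_1,L_2,d$, such that for every $C_1\ge C_0$ sizes $\lambda_\varepsilon$ as above exist for some $C_2$, and for every $p>0$, every $C_2$ and every choice of $\lambda_\varepsilon$, $M_\vartheta$, $\mathbb S_\varepsilon$, $\hat\vartheta_x$ as above, the estimator $g^*_{\mathcal A,\varepsilon}$ satisfies the following. If $(\gamma,\beta)\notin\mathcal P_2$, then $$\limsup_{\varepsilon\to0}\ \sup_{g\in\mathbb H(\mathcal A,\mathcal L)}\mathbb E_g\Big[\big(\phi_\varepsilon^{-1}(\gamma,\beta)\,\|g^*_{\mathcal A,\varepsilon}-g\|_\infty\big)^p\Big]<\infty .$$ If $(\gamma,\beta)\in\mathcal P_2$,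 then $$\limsup_{\varepsilon\to0}\ \sup_{g\in\mathbb H(\mathcal A,\mathcal L)}\mathbb E_g\Big[\big(\lceil\ln\ln(1/\varepsilon)\rceil^{-1}\phi_\varepsilon^{-1}(\gamma,\beta)\,\|g^*_{\mathcal A,\varepsilon}-g\|_\infty\big)^p\Big]<\infty .$$ -/

import Mathlib

open MeasureTheory ProbabilityTheory Filter Topology
open scoped ENNReal

noncomputable section

namespace Composite

/-- Euclidean space of dimension `d`; coordinates are numbered from `0`. -/
abbrev Space (d : ℕ) := EuclideanSpace ℝ (Fin d)

/-! ### Hölder classes and the class of composite functions -/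

/-- The largest integer that is strictly less than `α` (for `α > 0`). -/
def orderBelow (α : ℝ) : ℕ := ⌈α⌉₊ - 1

/-- The first-order partial derivative in the direction of the `i`-th coordinate. -/
def partialD {d : ℕ} (i : Fin d) (G : Space d → ℝ) : Space d → ℝ :=
  fun x => lineDeriv ℝ G x (EuclideanSpace.single i 1)

/-- The mixed partial derivative `∂^|k| G / ∂x₁^k₁ ⋯ ∂x_d^k_d`. -/
def iterPartial {d : ℕ} (k : Fin d → ℕ) (G : Space d → ℝ) : Space d → ℝ :=
  (List.finRange d).foldr (fun i F => (partialD i)^[k i] F) G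

/-- The finite set of multi-indices `k` with `|k| ≤ m`. -/
def multiIndices (d m : ℕ) : Finset (Fin d → ℕ) :=
  (Finset.range (m + 1)).biUnion fun n => Finset.piAntidiag Finset.univ n

/-- The isotropic Hölder class `ℍ_d(α, L)`: all partial derivatives up to the order `⌊α⌋` (the
largest integer below `α`) exist, the sum of their sup-norms is at most `L`, and the Taylor
remainder of that order is at most `L ‖y - x‖ ^ α`. -/
def holderClass (d : ℕ) (α L : ℝ) : Set (Space d → ℝ) :=
  {G | (∀ k : Fin d → ℕ, ∑ i, k i < orderBelow α → ∀ (i : Fin d) (x : Space d),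
          LineDifferentiableAt ℝ (iterPartial k G) x (EuclideanSpace.single i 1)) ∧
        ∑ k ∈ multiIndices d (orderBelow α), ⨆ x : Space d, ‖iterPartial k G x‖ₑ
          ≤ ENNReal.ofReal L ∧
        ∀ x y : Space d,
          |G y - ∑ k ∈ multiIndices d (orderBelow α),
              iterPartial k G x * ∏ j, (y j - x j) ^ (k j) / ((k j).factorial : ℝ)|
            ≤ L * ‖y - x‖ ^ α}

/-- The Hölder class `ℍ_1(α, L)` of functions on the real line. -/
def holderClassReal (α L : ℝ) : Set (ℝ → ℝ) :=
  {f | (∀ k < orderBelow α, Differentiable ℝ (iteratedDeriv k f)) ∧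
        ∑ k ∈ Finset.range (orderBelow α + 1), ⨆ x : ℝ, ‖iteratedDeriv k f x‖ₑ
          ≤ ENNReal.ofReal L ∧
        ∀ x y : ℝ,
          |f y - ∑ k ∈ Finset.range (orderBelow α + 1),
              iteratedDeriv k f x * ((y - x) ^ k / (k.factorial : ℝ))|
            ≤ L * |y - x| ^ α}

/-- The class `ℍ(𝒜, ℒ)` of compositions `f ∘ G`, `f ∈ ℍ_1(γ, L₁)`, `G ∈ ℍ_d(β, L₂)`. -/
def compositeClass (d : ℕ) (γ β L₁ L₂ : ℝ) : Set (Space d → ℝ) :=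
  {g | ∃ f ∈ holderClassReal γ L₁, ∃ G ∈ holderClass d β L₂, g = f ∘ G}

/-! ### Rate and the exceptional zone -/

/-- The rate `φ_ε(γ, β)`. -/
def rate (d : ℕ) (γ β ε : ℝ) : ℝ :=
  if 1 < β ∧ (d : ℝ) * (γ - 1) + 1 ≤ β then
    (ε * √(Real.log (1 / ε))) ^ (2 * γ / (2 * γ + 1 + ((d : ℝ) - 1) / β))
  else if 1 < γ ∧ β < (d : ℝ) * (γ - 1) + 1 then
    (ε * √(Real.log (1 / ε))) ^ (2 / (2 + (d : ℝ) / β))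
  else
    (ε * √(Real.log (1 / ε))) ^ (2 / (2 + (d : ℝ) / (γ * β)))

/-- The zone `𝒫₂` of pairs `(γ, β)`. -/
def zoneTwo (d : ℕ) : Set (ℝ × ℝ) :=
  {A | 1 < A.1 ∧ A.1 ≤ A.2 ∧ A.2 ≤ 2 ∧ (d : ℝ) * (A.1 - 1) + 1 ≤ A.2}

/-! ### The Gaussian white noise model -/

/-- The open box `∏ (a k, b k)`. -/
def openBox {d : ℕ} (a b : Fin d → ℝ) : Set (Space d) := {t | ∀ k, a k < t k ∧ t k < b k}

/-- The cube `[-1, 1]^d`. -/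
def unitCube (d : ℕ) : Set (Space d) := {t | ∀ k, -1 ≤ t k ∧ t k ≤ 1}

/-- The Hilbert space `L²(D)`. -/
abbrev L2 {d : ℕ} (D : Set (Space d)) := Lp ℝ 2 (volume.restrict D)

/-- Gaussian white noise on `D`: `W h` is the integral of `h ∈ L²(D)` with respect to the standard
Brownian sheet, that is, `W` is the centred Gaussian process on `L²(D)` whose covariance is the
inner product of `L²(D)`. -/
structure IsWhiteNoise {d : ℕ} {Ω : Type*} [MeasurableSpace Ω] (P : Measure Ω)
    (D : Set (Space d)) (W : L2 D → Ω → ℝ) : Prop where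
  measurable : ∀ h, Measurable (W h)
  gaussian : IsGaussianProcess W P
  mean : ∀ h, ∫ ω, W h ω ∂P = 0
  covariance : ∀ h k, ∫ ω, W h ω * W k ω ∂P = inner ℝ h k

/-- An observation is the family of the integrals `∫_D h(t) X_ε(dt)`, `h ∈ L²(D)`; it carries the
product σ-algebra. -/
abbrev Observation {d : ℕ} (D : Set (Space d)) := L2 D → ℝ

/-- The observation `X_ε(dt) = g(t) dt + ε W(dt)`, `t ∈ D`. -/
def observe {d : ℕ} {Ω : Type*} {D : Set (Space d)} (W : L2 D → Ω → ℝ) (g : Space d → ℝ)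
    (ε : ℝ) (ω : Ω) : Observation D :=
  fun h => (∫ t in D, h t * g t) + ε * W h ω

open Classical in
/-- The integral `∫_D h(t) X_ε(dt)` for a function `h` that is square integrable on `D`. -/
def integralAgainst {d : ℕ} {D : Set (Space d)} (X : Observation D) (h : Space d → ℝ) : ℝ :=
  if hh : MemLp h 2 (volume.restrict D) then X (hh.toLp h) else 0

/-! ### The weights -/

section Weights

variable {d : ℕ} [NeZero d]

open Classical in
/-- The indicator of `{y : a ≤ |y₁| ≤ b, c ≤ |y_k| ≤ e for k ≥ 2}`. -/
def boxIndicator (a b c e : ℝ) (y : Space d) : ℝ :=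
  if (a ≤ |y 0| ∧ |y 0| ≤ b) ∧ ∀ k : Fin d, k ≠ 0 → c ≤ |y k| ∧ |y k| ≤ e then 1 else 0

/-- The indicator above, divided by the volume of `[a, b] × [c, e]^(d-1)`. -/
def boxMean (a b c e : ℝ) (y : Space d) : ℝ :=
  ((b - a) * (e - c) ^ (d - 1))⁻¹ * boxIndicator a b c e y

/-- The normalized indicator of the centred box `[-h₁, h₁] × [-h₂, h₂]^(d-1)`. -/
def boxcar (h₁ h₂ : ℝ) (y : Space d) : ℝ :=
  (2 * h₁ * (2 * h₂) ^ (d - 1))⁻¹ * boxIndicator 0 h₁ 0 h₂ y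

/-- The piecewise constant weight with `r` steps built from the sequences `u` and `v`. -/
def stepWeight (r : ℕ) (u v : ℕ → ℝ) (y : Space d) : ℝ :=
  (2 ^ d)⁻¹ * (boxMean 0 (u 1) (v 2) (v 1) y +
    ∑ i ∈ Finset.Icc 2 r, (boxMean (u (i - 1)) (u i) (v (i + 1)) (v i) y
      - boxMean (u (i - 1)) (u i) (v i) (v (i - 1)) y))

/-- The two-step weight. -/
def twoStepWeight (γ β lam : ℝ) : Space d → ℝ :=
  stepWeight 2
    (fun i => if i = 1 then lam ^ (1 / γ) else lam ^ (1 / β))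
    (fun i => if i = 1 then lam ^ ((β - γ + 1) / β ^ 2)
      else if i = 2 then lam ^ (1 / β) / 2 else 0)

/-- The number `ρ = (d - 1)(γ - 1) / β`. -/
def rho (d : ℕ) (γ β : ℝ) : ℝ := ((d : ℝ) - 1) * (γ - 1) / β

/-- The sequence `α_k = β⁻¹ (1 + ρ + ⋯ + ρ^k)`. -/
def alphaSeq (d : ℕ) (γ β : ℝ) (k : ℕ) : ℝ := β⁻¹ * ∑ i ∈ Finset.range (k + 1), rho d γ β ^ i

/-- The integer `r ≥ 2` such that `α_{r-1} ≥ 1 / γ > α_{r-2}`. -/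
def powerSteps (d : ℕ) (γ β : ℝ) : ℕ := sInf {r : ℕ | 2 ≤ r ∧ 1 / γ ≤ alphaSeq d γ β (r - 1)}

/-- The sequence `u` with `u_1 = λ^(1/γ)` and `u_i = λ^(α_{r-i})` for `2 ≤ i ≤ r`. -/
def powerU (d : ℕ) (γ β lam : ℝ) (i : ℕ) : ℝ :=
  if i = 1 then lam ^ (1 / γ) else lam ^ alphaSeq d γ β (powerSteps d γ β - i)

/-- The sequence `v` with `v_i = λ^(1/β) u_{i+1}^(-(γ-1)/β)` for `1 ≤ i ≤ r - 1`,
`v_r = λ^(1/β) / 2` and `v_{r+1} = 0`. -/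
def powerV (d : ℕ) (γ β lam : ℝ) (i : ℕ) : ℝ :=
  if i < powerSteps d γ β then lam ^ (1 / β) * powerU d γ β lam (i + 1) ^ (-(γ - 1) / β)
  else if i = powerSteps d γ β then lam ^ (1 / β) / 2 else 0

/-- The weight with a number of steps that does not depend on `λ`. -/
def powerWeight (γ β lam : ℝ) : Space d → ℝ :=
  if (β - γ) / γ ≤ rho d γ β then twoStepWeight γ β lam
  else stepWeight (powerSteps d γ β) (powerU d γ β lam) (powerV d γ β lam)

/-- The quantity `V(λ)`. -/
def logLog (γ β lam : ℝ) : ℝ :=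
  Real.log ((γ - 1) * (β - γ) / (γ * β ^ 2) * Real.log (1 / lam))

/-- The number of steps `r(λ) = min {s > 1 : V(λ) / (s - 1) < ln ((√5 + 1) / 2) / 2}`. -/
def expSteps (γ β lam : ℝ) : ℕ :=
  sInf {s : ℕ | 1 < s ∧ logLog γ β lam / ((s : ℝ) - 1) < Real.log ((√5 + 1) / 2) / 2}

/-- The exponent `α = V(λ) / (r - 1)`. -/
def expAlpha (γ β lam : ℝ) : ℝ := logLog γ β lam / ((expSteps γ β lam : ℝ) - 1)

/-- The sequence `u_i = λ^(1/γ) exp ((β / (γ - 1)) exp (α (i - 1)))`. -/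
def expU (γ β lam : ℝ) (i : ℕ) : ℝ :=
  lam ^ (1 / γ) * Real.exp (β / (γ - 1) * Real.exp (expAlpha γ β lam * ((i : ℝ) - 1)))

/-- The sequence `v_i = λ^(1/(γβ)) exp (-ν exp (α i))` for `1 ≤ i ≤ r - 1`, with
`ν = √((√5 + 1) / 2)`, `v_r = λ^(1/β) / 2` and `v_{r+1} = 0`. -/
def expV (γ β lam : ℝ) (i : ℕ) : ℝ :=
  if i < expSteps γ β lam then
    lam ^ (1 / (γ * β)) * Real.exp (-√((√5 + 1) / 2) * Real.exp (expAlpha γ β lam * (i : ℝ)))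
  else if i = expSteps γ β lam then lam ^ (1 / β) / 2 else 0

/-- The weight with a number of steps of order `ln ln (1/λ)`. -/
def expWeight (γ β lam : ℝ) : Space d → ℝ :=
  if (β - γ) / γ ≤ (1 + rho d γ β) * rho d γ β then powerWeight γ β lam
  else if logLog γ β lam ≤ 0 then twoStepWeight γ β lam
  else stepWeight (expSteps γ β lam) (expU γ β lam) (expV γ β lam)

/-- The weight `K_(𝒜, λ)` for `𝒜 = (γ, β) ∈ (0, 2]²`. The five cases are: the zone of slow rate,
the zone of the local single-index model, the zone of inactive structure (`γ > 1`, `γ ≥ β`), and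
the two zones of local models with roughness isolated to a single dimension. -/
def baseWeight (γ β lam : ℝ) : Space d → ℝ :=
  if γ ≤ 1 ∧ β ≤ 1 then boxcar (lam ^ (1 / (γ * β))) (lam ^ (1 / (γ * β)))
  else if γ ≤ 1 then boxcar (lam ^ (1 / γ)) (lam ^ (1 / (γ * β)))
  else if β ≤ γ then boxcar (lam ^ (1 / β)) (lam ^ (1 / β))
  else if β < (d : ℝ) * (γ - 1) + 1 then powerWeight γ β lam
  else expWeight γ β lam

end Weights

section Procedure

variable {d : ℕ}

/-- The `L₁`-norm of a weight. -/
def normOne (K : Space d → ℝ) : ℝ := ∫ t, |K t|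

/-- The `L₂`-norm of a weight. -/
def normTwo (K : Space d → ℝ) : ℝ := √(∫ t, K t ^ 2)

/-- The convolution of two weights. -/
def convolve (K' K : Space d → ℝ) (t : Space d) : ℝ := ∫ y, K' (t - y) * K y

/-- `M` assigns to every unit vector `θ` an orthogonal matrix (a linear isometry of the space)
whose first column (the image of the first basis vector) is `θ`. -/
def IsFrame [NeZero d] (M : Space d → (Space d ≃ₗᵢ[ℝ] Space d)) : Prop :=
  ∀ θ, ‖θ‖ = 1 → M θ (EuclideanSpace.single 0 1) = θ

/-- The weight `K_𝒥(x) = K_(𝒜, λ)(M_θᵀ x)`, where `K = K_(𝒜, λ)`. -/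
def oriented (M : Space d → (Space d ≃ₗᵢ[ℝ] Space d)) (K : Space d → ℝ) (θ : Space d) :
    Space d → ℝ :=
  fun x => K ((M θ).symm x)

/-- `S ε` is, for small `ε`, an `ε`-net of the unit sphere that contains the first basis vector
and has at most `c ε^(-(d-1))` elements, for a constant `c`. -/
def IsSphereNet [NeZero d] (S : ℝ → Finset (Space d)) : Prop :=
  ∃ c : ℝ, ∀ᶠ ε in 𝓝[>] (0 : ℝ),
    (∀ θ ∈ S ε, ‖θ‖ = 1) ∧ (∀ θ : Space d, ‖θ‖ = 1 → ∃ θ' ∈ S ε, ‖θ - θ'‖ ≤ ε) ∧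
    EuclideanSpace.single 0 1 ∈ S ε ∧ ((S ε).card : ℝ) ≤ c * (1 / ε) ^ (d - 1)

/-- `lam ε` is a size parameter that balances bias and variance: it is positive for small `ε`,
tends to zero with `ε`, and satisfies
`C₁ λ ≤ ε √(ln (1/ε)) ‖K_(𝒜, λ)‖₂ ≤ C₂ λ` for small `ε`. -/
def IsBalanced (d : ℕ) [NeZero d] (γ β C₁ C₂ : ℝ) (lam : ℝ → ℝ) : Prop :=
  Tendsto lam (𝓝[>] 0) (𝓝 0) ∧
  ∀ᶠ ε in 𝓝[>] (0 : ℝ), 0 < lam ε ∧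
    C₁ * lam ε ≤ ε * √(Real.log (1 / ε)) * normTwo (baseWeight (d := d) γ β (lam ε)) ∧
    ε * √(Real.log (1 / ε)) * normTwo (baseWeight (d := d) γ β (lam ε)) ≤ C₂ * lam ε

variable {D : Set (Space d)}

/-- The linear estimator `∫_D K(t - x) X_ε(dt)` at the point `x`. -/
def linearEstimator (X : Observation D) (K : Space d → ℝ) (x : Space d) : ℝ :=
  integralAgainst X fun t => K (t - x)

/-- The threshold `(2 + √(4p + 8d)) (‖K'‖₁ + ‖K‖₁) ‖K'‖₂ ε √(ln (1/ε))`. -/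
def threshold (p ε : ℝ) (K' K : Space d → ℝ) : ℝ :=
  (2 + √(4 * p + 8 * (d : ℝ))) * (normOne K' + normOne K) * normTwo K' *
    (ε * √(Real.log (1 / ε)))

/-- The set of acceptable orientations at the point `x`, for the net `S` and the weight `K`. -/
def acceptable (p ε : ℝ) (M : Space d → (Space d ≃ₗᵢ[ℝ] Space d)) (S : Finset (Space d))
    (K : Space d → ℝ) (X : Observation D) (x : Space d) : Set (Space d) :=
  {θ | θ ∈ S ∧ ∀ θ' ∈ S,
    |linearEstimator X (convolve (oriented M K θ') (oriented M K θ)) x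
        - linearEstimator X (oriented M K θ') x|
      ≤ threshold p ε (oriented M K θ') (oriented M K θ)}

/-- `sel x X` is a selection, measurable in the observation `X`, of an orientation that is
acceptable at `x` whenever there is one. -/
def IsSelection (p ε : ℝ) (M : Space d → (Space d ≃ₗᵢ[ℝ] Space d)) (S : Finset (Space d))
    (K : Space d → ℝ) (sel : Space d → Observation D → Space d) : Prop :=
  ∀ x, Measurable (sel x) ∧
    ∀ X, (acceptable p ε M S K X x).Nonempty → sel x X ∈ acceptable p ε M S K X x

open Classical in
/-- The estimator `g**` at the point `x`. -/
def pointEstimator (p ε : ℝ) (M : Space d → (Space d ≃ₗᵢ[ℝ] Space d)) (S : Finset (Space d))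
    (K : Space d → ℝ) (sel : Space d → Observation D → Space d) (X : Observation D)
    (x : Space d) : ℝ :=
  if (acceptable p ε M S K X x).Nonempty then linearEstimator X (oriented M K (sel x X)) x else 0

/-- The corner `ε² z(x)` of the cube `∏ (ε² (z_k - 1), ε² z_k]`, `z = z(x) ∈ ℤ^d`, that
contains `x`. -/
def gridPoint (ε : ℝ) (x : Space d) : Space d :=
  WithLp.toLp 2 fun k => ε ^ 2 * (⌈x k / ε ^ 2⌉ : ℝ)

/-- Truncation of `s` at the level `T`. -/
def truncate (T s : ℝ) : ℝ := if |s| ≤ T then s else T * Real.sign s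

/-- The piecewise constant and truncated estimator `g*`. -/
def globalEstimator (p ε : ℝ) (M : Space d → (Space d ≃ₗᵢ[ℝ] Space d)) (S : Finset (Space d))
    (K : Space d → ℝ) (sel : Space d → Observation D → Space d) (X : Observation D)
    (x : Space d) : ℝ :=
  truncate (Real.log (Real.log (1 / ε))) (pointEstimator p ε M S K sel X (gridPoint ε x))

/-- The sup-norm distance on `[-1, 1]^d`. -/
def supDist (g₁ g₂ : Space d → ℝ) : ℝ≥0∞ := ⨆ x ∈ unitCube d, ‖g₁ x - g₂ x‖ₑ

/-- The maximal normalized risk `sup_{g ∈ 𝒢} 𝔼_g (‖ĝ - g‖_∞ / ψ)^p` at noise level `ε` of an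
estimator `est`, which is a function of the observation. -/
def maxRisk {Ω : Type*} [MeasurableSpace Ω] (P : Measure Ω) (W : L2 D → Ω → ℝ)
    (𝒢 : Set (Space d → ℝ)) (p ε ψ : ℝ) (est : Observation D → Space d → ℝ) : ℝ≥0∞ :=
  ⨆ g ∈ 𝒢, ∫⁻ ω, (supDist (est (observe W g ε ω)) g / ENNReal.ofReal ψ) ^ p ∂P

end Procedure

end Composite

end

open Composite

open MeasureTheory ProbabilityTheory Filter Topology
open scoped ENNReal

noncomputable section

namespace Composite

/-! ### Hölder functions on normed spaces -/

/-! Write `κ = ε √(ln (1/ε))`. The argument has an analytic half about the weights and a statistical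
half about the choice of the orientation.

Analytic half. For each `(γ, β)` the weight of size `λ` has bias of order `λ` over the class,
provided its first axis points, up to a small error, along the gradient of the inner function `G`
(where the shape of the weight makes this matter). Its `L₂`-norm has exact order `λ^(-e/2)` for some
`e`. This is the content of `IsWeightFamily`. Balancing bias and noise means `λ^(1+e/2) ≍ κ`, so `λ
≍ κ^(2/(2+e))`, and the rate is never smaller in order than this (`rate_eq_rpow`,
`exists_isWeightFamily_baseWeight`). Boxes are enough when `γ ≤ 1` or `β ≤ γ`.

The hard case is `1 < γ < β`. A step weight is a signed sum of averages over blocks. Block `(i, j)`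
has first coordinate of size `u i` and other coordinates of size `v j`. The sum is arranged so that
a function of the first coordinate alone is averaged only over the narrow band up to `u 1`, while a
function of the other coordinates alone is averaged only up to `v r`. With `H` the inner function in
rotated coordinates, write `A`, `C` for its restrictions to the first axis and to the orthogonal
complement. Then `f(H) = f(A) + f'(H 0) (H - A) + (f'(A) - f'(H 0)) (H - A) + remainder`. The first
term costs `u₁^γ + u₁^β`. In the second, `H - A = (H - C) + C - A` costs `∑ uᵢ^β + v_r^β + u₁^β` by
symmetry. The third costs `uᵢ^(γ-1) vⱼ^β` per block. The remainder costs `(K vⱼ)^γ` with `K` of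
order `R^(β-1)`, because along the gradient orientation `H` barely varies across the axis; here `R`
is the radius of the region (`StepOrder.abs_stepInt_sub_le`). The sizes must keep all of this below
`λ` while no block is so small that it spoils the `L₂`-norm. Powers of `λ` achieve this with
boundedly many steps if `β < d(γ-1)+1`. Otherwise the sizes follow a double exponential with about
`ln ln (1/λ)` steps. The sums then converge uniformly in the number of steps, and only the `L₁`-norm
grows; this is the extra factor in `𝒫₂`.

Statistical half. Let `θ₀` be a point of the net near the good orientation. Its bias is small at
every point within the radius of the support, so convolving any weight with the one oriented by `θ₀`
hardly changes the mean. Hence `θ₀` is acceptable when the noise is small. Convolution is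
commutative, so the estimators of `θ₀` and of the selected `θ` are both close to the same estimator
built from the convolved weight, hence close to each other (`abs_pointEstimator_sub_le`). Gaussian
tails and a union bound over the grid and over pairs of orientations make the noise small outside an
event of probability `O(ε^(2p+2))`. On that event the truncation gives a normalized loss of at most
`2/ε²`, whose `p`-th power is absorbed (`maxRisk_le`). Between grid points the modulus of continuity
of `f ∘ G` suffices. -/

/-- `G` is bounded by `L`, with a derivative `D` bounded by `L` and first-order Taylor remainder
at most `L ‖y - x‖ ^ α`. -/
structure TaylorBound {E : Type*} [NormedAddCommGroup E] [NormedSpace ℝ E] (G : E → ℝ)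
    (D : E → E →L[ℝ] ℝ) (α L : ℝ) : Prop where
  bound : ∀ x, |G x| ≤ L
  deriv_bound : ∀ x, ‖D x‖ ≤ L
  taylor : ∀ x y, |G y - G x - D x (y - x)| ≤ L * ‖y - x‖ ^ α

section Taylor

variable {E : Type*} [NormedAddCommGroup E] [NormedSpace ℝ E] {G : E → ℝ} {D : E → E →L[ℝ] ℝ}
  {α L : ℝ}

lemma TaylorBound.nonneg (h : TaylorBound G D α L) : 0 ≤ L := (abs_nonneg _).trans (h.bound 0)

/-- Short increments use the derivative and the Taylor remainder, increments longer than `1` use the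
bound on `G` itself. -/
lemma TaylorBound.lipschitz (h : TaylorBound G D α L) (hα : 1 ≤ α) (x y : E) :
    |G y - G x| ≤ 2 * L * ‖y - x‖ := by
  have hL := h.nonneg
  rcases le_total ‖y - x‖ 1 with h1 | h1
  · have h2 := h.taylor x y
    have h3 : |D x (y - x)| ≤ L * ‖y - x‖ :=
      ((D x).le_opNorm _).trans (by gcongr; exact h.deriv_bound x)
    have h4 : ‖y - x‖ ^ α ≤ ‖y - x‖ := by
      rcases (norm_nonneg (y - x)).eq_or_lt with h0 | h0
      · rw [← h0, Real.zero_rpow (by linarith)]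
      · simpa using Real.rpow_le_rpow_of_exponent_ge h0 h1 hα
    have h5 : L * ‖y - x‖ ^ α ≤ L * ‖y - x‖ := by gcongr
    rw [abs_le] at *
    constructor <;> linarith [h2.1, h2.2, h3.1, h3.2]
  · have h2 := h.bound x
    have h3 := h.bound y
    have h5 : L * 1 ≤ L * ‖y - x‖ := by gcongr
    rw [abs_le] at *
    constructor <;> linarith [h2.1, h2.2, h3.1, h3.2]

lemma TaylorBound.continuous (h : TaylorBound G D α L) (hα : 1 ≤ α) : Continuous G := by
  refine (LipschitzWith.of_dist_le_mul (K := ⟨2 * L, by linarith [h.nonneg]⟩) fun x y => ?_).continuous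
  rw [dist_eq_norm, dist_eq_norm]
  exact h.lipschitz hα y x

/-- Test `D y - D x` on a vector of length `τ = ‖y - x‖`. Expanding `G (y + τ w)` around `y` and
around `x`, and `G y` around `x`, leaves remainders `τ^α`, `(2τ)^α ≤ 4 τ^α` and `τ^α`, which add up
to the constant `6`. -/
lemma TaylorBound.deriv_holder (h : TaylorBound G D α L) (hα : 1 < α) (hα2 : α ≤ 2) (x y : E) :
    ‖D y - D x‖ ≤ 6 * L * ‖y - x‖ ^ (α - 1) := by
  have hL := h.nonneg
  rcases (norm_nonneg (y - x)).eq_or_lt with h0 | h0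
  · have : y = x := by simpa [sub_eq_zero] using h0.symm
    subst this
    simp only [sub_self, norm_zero]
    positivity
  refine ContinuousLinearMap.opNorm_le_of_unit_norm (by positivity) fun w hw => ?_
  set τ := ‖y - x‖ with hτ
  have e1 := h.taylor y (y + τ • w)
  have e2 := h.taylor x (y + τ • w)
  have e3 := h.taylor x y
  have hn : ‖τ • w‖ = τ := by rw [norm_smul, hw, Real.norm_of_nonneg h0.le, mul_one]
  rw [add_sub_cancel_left, hn] at e1
  have e4 : y + τ • w - x = (y - x) + τ • w := by abel
  have hn2 : ‖y + τ • w - x‖ ^ α ≤ 4 * τ ^ α := by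
    have : ‖y + τ • w - x‖ ≤ 2 * τ := by
      rw [e4]; exact (norm_add_le _ _).trans (by rw [hn, ← hτ]; linarith)
    calc ‖y + τ • w - x‖ ^ α ≤ (2 * τ) ^ α := by gcongr
      _ = 2 ^ α * τ ^ α := Real.mul_rpow (by norm_num) h0.le
      _ ≤ 2 ^ (2 : ℝ) * τ ^ α := by gcongr; norm_num
      _ = 4 * τ ^ α := by norm_num
  have e5 : |G (y + τ • w) - G x - D x (y + τ • w - x)| ≤ L * (4 * τ ^ α) := e2.trans (by gcongr)
  rw [e4, map_add] at e5
  rw [map_smul] at e1 e5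
  simp only [smul_eq_mul] at e1 e5
  have key : τ * |(D y - D x) w| ≤ 6 * L * τ ^ α := by
    rw [← abs_of_pos h0, ← abs_mul, abs_of_pos h0, sub_apply]
    rw [abs_le] at *
    constructor <;> linarith [e1.1, e1.2, e3.1, e3.2, e5.1, e5.2]
  have : τ ^ α = τ * τ ^ (α - 1) := by
    rw [← Real.rpow_one_add' h0.le (by linarith)]; congr 1; ring
  rw [this] at key
  rw [Real.norm_eq_abs]
  have := le_of_mul_le_mul_left (by linarith : τ * |(D y - D x) w| ≤ τ * (6 * L * τ ^ (α - 1))) h0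
  exact this

end Taylor

/-! ### Unfolding the Hölder classes: order zero for `α ≤ 1`, order one for `1 < α ≤ 2` -/

lemma orderBelow_of_le_one {α : ℝ} (h : α ≤ 1) : orderBelow α = 0 := by
  have : ⌈α⌉₊ ≤ 1 := by simpa using h
  unfold orderBelow; omega

lemma orderBelow_of_one_lt {α : ℝ} (h1 : 1 < α) (h : α ≤ 2) : orderBelow α = 1 := by
  have a : ⌈α⌉₊ ≤ 2 := by simpa using h
  have b : 1 < ⌈α⌉₊ := by simpa [Nat.lt_ceil] using h1
  unfold orderBelow; omega

lemma le_of_iSup_enorm_le {X : Type*} {F : X → ℝ} {L : ℝ} (hL : 0 ≤ L)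
    (h : ⨆ x, ‖F x‖ₑ ≤ ENNReal.ofReal L) (x : X) : |F x| ≤ L := by
  have := (le_iSup (fun x => ‖F x‖ₑ) x).trans h
  rw [Real.enorm_eq_ofReal_abs] at this
  exact (ENNReal.ofReal_le_ofReal_iff hL).1 this

lemma holderClassReal_of_le_one {α L : ℝ} (h1 : α ≤ 1) (hL : 0 ≤ L) {f : ℝ → ℝ}
    (hf : f ∈ holderClassReal α L) :
    (∀ x, |f x| ≤ L) ∧ ∀ x y, |f y - f x| ≤ L * |y - x| ^ α := by
  obtain ⟨-, hb, ht⟩ := hf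
  rw [orderBelow_of_le_one h1] at hb ht
  simp at hb ht
  exact ⟨le_of_iSup_enorm_le hL (by simpa using hb), ht⟩

lemma holderClassReal_of_one_lt {α L : ℝ} (h1 : 1 < α) (h2 : α ≤ 2) (hL : 0 ≤ L) {f : ℝ → ℝ}
    (hf : f ∈ holderClassReal α L) :
    TaylorBound f (fun x => ContinuousLinearMap.toSpanSingleton ℝ (deriv f x)) α L := by
  obtain ⟨-, hb, ht⟩ := hf
  rw [orderBelow_of_one_lt h1 h2] at hb ht
  rw [Finset.sum_range_succ, Finset.sum_range_one] at hb
  refine ⟨fun x => ?_, fun x => ?_, fun x y => ?_⟩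
  · refine le_of_iSup_enorm_le hL ((le_add_of_nonneg_right zero_le).trans hb) x |>.trans' ?_
    simp
  · refine le_of_iSup_enorm_le hL ((le_add_of_nonneg_left zero_le).trans hb) x |>.trans' ?_
    simp
  · have := ht x y
    simp [Finset.sum_range_succ] at this
    simp only [Real.norm_eq_abs]
    convert this using 2
    simp
    ring

lemma multiIndices_zero (d : ℕ) : multiIndices d 0 = {0} := by
  ext k
  simp [multiIndices]

lemma multiIndices_one (d : ℕ) :
    multiIndices d 1 = insert 0 (Finset.univ.image fun i : Fin d => Pi.single i 1) := by
  ext k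
  simp only [multiIndices, Finset.mem_biUnion, Finset.mem_range, Finset.mem_piAntidiag,
    Finset.mem_insert, Finset.mem_image, Finset.mem_univ, true_and]
  constructor
  · rintro ⟨n, hn, hs, -⟩
    have : n = 0 ∨ n = 1 := by omega
    rcases this with rfl | rfl
    · left
      ext i
      simpa using (Finset.sum_eq_zero_iff.1 hs) i (Finset.mem_univ i)
    · right
      obtain ⟨i, hi⟩ : ∃ i, k i ≠ 0 := by
        by_contra! h
        simp [h] at hs
      refine ⟨i, ?_⟩
      rw [← Finset.add_sum_erase _ _ (Finset.mem_univ i)] at hs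
      have h0 : ∑ x ∈ Finset.univ.erase i, k x = 0 := by omega
      ext j
      by_cases hj : j = i
      · subst hj; simp; omega
      · rw [Pi.single_eq_of_ne hj]
        exact ((Finset.sum_eq_zero_iff.1 h0) j (by simp [hj])).symm
  · rintro (rfl | ⟨i, rfl⟩)
    · exact ⟨0, by simp⟩
    · exact ⟨1, by simp⟩

lemma iterPartial_zero {d : ℕ} (G : Space d → ℝ) : iterPartial 0 G = G := by
  unfold iterPartial
  induction List.finRange d with
  | nil => rfl
  | cons a l ih => exact ih

lemma iterPartial_single {d : ℕ} (i : Fin d) (G : Space d → ℝ) :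
    iterPartial (Pi.single i 1) G = partialD i G := by
  have aux : ∀ l : List (Fin d), i ∉ l →
      l.foldr (fun j F => (partialD j)^[(Pi.single i 1 : Fin d → ℕ) j] F) G = G := by
    intro l hl
    induction l with
    | nil => rfl
    | cons a l ih =>
      simp only [List.mem_cons, not_or] at hl
      simp only [List.foldr_cons]
      rw [ih hl.2, Pi.single_eq_of_ne (Ne.symm hl.1)]
      rfl
  have main : ∀ l : List (Fin d), l.Nodup → i ∈ l →
      l.foldr (fun j F => (partialD j)^[(Pi.single i 1 : Fin d → ℕ) j] F) G = partialD i G := by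
    intro l hn hl
    induction l with
    | nil => simp at hl
    | cons a l ih =>
      rw [List.nodup_cons] at hn
      simp only [List.foldr_cons]
      by_cases ha : a = i
      · subst ha
        rw [aux l hn.1]
        simp
      · rw [ih hn.2 (by simpa [Ne.symm ha] using hl), Pi.single_eq_of_ne ha]
        rfl
  exact main _ (List.nodup_finRange d) (List.mem_finRange i)

lemma holderClass_of_le_one {d : ℕ} {α L : ℝ} (h1 : α ≤ 1) (hL : 0 ≤ L)
    {G : Space d → ℝ} (hG : G ∈ holderClass d α L) :
    (∀ x, |G x| ≤ L) ∧ ∀ x y, |G y - G x| ≤ L * ‖y - x‖ ^ α := by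
  obtain ⟨-, hb, ht⟩ := hG
  rw [orderBelow_of_le_one h1, multiIndices_zero] at hb ht
  simp [iterPartial_zero] at hb ht
  exact ⟨le_of_iSup_enorm_le hL (by simpa using hb), ht⟩

/-- The differential assembled from the partial derivatives. -/
def partialDifferential {d : ℕ} (G : Space d → ℝ) (x : Space d) : Space d →L[ℝ] ℝ :=
  ∑ i, partialD i G x • (EuclideanSpace.proj i : Space d →L[ℝ] ℝ)

lemma holderClass_of_one_lt {d : ℕ} {α L : ℝ} (h1 : 1 < α) (h2 : α ≤ 2) (hL : 0 ≤ L)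
    {G : Space d → ℝ} (hG : G ∈ holderClass d α L) :
    TaylorBound G (partialDifferential G) α L := by
  obtain ⟨-, hb, ht⟩ := hG
  rw [orderBelow_of_one_lt h1 h2, multiIndices_one] at hb ht
  have hni : (0 : Fin d → ℕ) ∉ Finset.univ.image fun i : Fin d => (Pi.single i 1 : Fin d → ℕ) := by
    simp only [Finset.mem_image, Finset.mem_univ, true_and, not_exists]
    intro i h
    have := congrFun h i
    simp at this
  have hinj : Set.InjOn (fun i : Fin d => (Pi.single i 1 : Fin d → ℕ)) (Finset.univ : Finset (Fin d)) := by
    intro i _ j _ hij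
    by_contra hne
    have := congrFun hij i
    simp [Pi.single_eq_of_ne hne] at this
  rw [Finset.sum_insert hni, Finset.sum_image hinj] at hb
  simp only [iterPartial_zero, iterPartial_single] at hb
  refine ⟨le_of_iSup_enorm_le hL ((le_add_of_nonneg_right zero_le).trans hb), fun x => ?_,
    fun x y => ?_⟩
  -- The class controls the `ℓ¹`-norm of the gradient, which dominates the Euclidean operator norm.
  -- Hence the constant stays `L`, without a dimensional factor.
  · have h3 : ∑ i, |partialD i G x| ≤ L := by
      have : ∑ i, ‖partialD i G x‖ₑ ≤ ENNReal.ofReal L := by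
        refine le_trans ?_ ((le_add_of_nonneg_left zero_le).trans hb)
        gcongr with i
        exact le_iSup (fun x => ‖partialD i G x‖ₑ) x
      simp only [Real.enorm_eq_ofReal_abs] at this
      rw [← ENNReal.ofReal_sum_of_nonneg (by intros; positivity)] at this
      exact (ENNReal.ofReal_le_ofReal_iff hL).1 this
    refine le_trans ?_ h3
    refine ContinuousLinearMap.opNorm_le_bound _ (by positivity) fun w => ?_
    unfold partialDifferential
    rw [sum_apply, Finset.sum_mul]
    refine (norm_sum_le _ _).trans (Finset.sum_le_sum fun i _ => ?_)
    simp only [smul_apply, smul_eq_mul, norm_mul, Real.norm_eq_abs]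
    gcongr
    exact PiLp.norm_apply_le w i
  · have := ht x y
    rw [Finset.sum_insert hni, Finset.sum_image hinj] at this
    simp only [iterPartial_zero, iterPartial_single] at this
    convert this using 2
    rw [sub_sub]
    congr 2
    · simp
    · unfold partialDifferential
      rw [sum_apply]
      refine Finset.sum_congr rfl fun i _ => ?_
      rw [Finset.prod_eq_single i]
      · simp
      · intro j _ hj
        simp [Pi.single_eq_of_ne hj]
      · simp

/-! ### Uniform distributions on symmetric bands and their products -/

/-- The set `{t : a ≤ |t| ≤ b}`. -/
def bandSet (a b : ℝ) : Set ℝ := {t | a ≤ |t| ∧ |t| ≤ b}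

lemma measurableSet_bandSet (a b : ℝ) : MeasurableSet (bandSet a b) :=
  (measurableSet_le measurable_const measurable_norm).inter
    (measurableSet_le measurable_norm measurable_const)

lemma volume_bandSet {a b : ℝ} (ha : 0 ≤ a) (hab : a ≤ b) :
    volume (bandSet a b) = ENNReal.ofReal (2 * (b - a)) := by
  have h1 : bandSet a b = Set.Icc a b ∪ Set.Icc (-b) (-a) := by
    ext t
    simp only [bandSet, Set.mem_ofPred_eq, Set.mem_union, Set.mem_Icc]
    rcases le_total 0 t with h | h
    · rw [abs_of_nonneg h]
      constructor
      · exact Or.inl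
      · rintro (h' | h')
        · exact h'
        · constructor <;> linarith
    · rw [abs_of_nonpos h]
      constructor
      · intro h'; right; constructor <;> linarith
      · rintro (h' | h') <;> constructor <;> linarith
  -- For `a = 0` the two intervals share the point `0`, so they are disjoint only almost everywhere.
  have h2 : AEDisjoint volume (Set.Icc a b) (Set.Icc (-b) (-a)) := by
    refine measure_mono_null (t := {0}) ?_ (by simp)
    rintro t ⟨h, h'⟩
    simp only [Set.mem_Icc, Set.mem_singleton_iff] at *
    linarith
  rw [h1, measure_union₀ measurableSet_Icc.nullMeasurableSet h2, Real.volume_Icc, Real.volume_Icc,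
    ← ENNReal.ofReal_add (by linarith) (by linarith)]
  congr 1; ring

/-- The uniform distribution on `{t : a ≤ |t| ≤ b}`. -/
def band (a b : ℝ) : Measure ℝ := ProbabilityTheory.cond volume (bandSet a b)

lemma isProbabilityMeasure_band {a b : ℝ} (ha : 0 ≤ a) (hab : a < b) :
    IsProbabilityMeasure (band a b) := by
  refine cond_isProbabilityMeasure_of_finite ?_ ?_ <;> rw [volume_bandSet ha hab.le]
  · simpa using hab
  · exact ENNReal.ofReal_ne_top

lemma band_map_neg {a b : ℝ} : (band a b).map (fun t => -t) = band a b := by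
  have : MeasurePreserving (fun t : ℝ => -t) (volume.restrict (bandSet a b))
      (volume.restrict (bandSet a b)) := by
    have h := (Measure.measurePreserving_neg (volume : Measure ℝ)).restrict_preimage
      (measurableSet_bandSet a b)
    have e : (Neg.neg : ℝ → ℝ) ⁻¹' bandSet a b = bandSet a b := by
      ext t; simp [bandSet]
    rwa [e] at h
  unfold band ProbabilityTheory.cond
  rw [Measure.map_smul, this.map_eq]

lemma ae_band (a b : ℝ) : ∀ᵐ t ∂band a b, a ≤ |t| ∧ |t| ≤ b :=
  ae_cond_mem (measurableSet_bandSet a b)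

lemma measurable_toLp {d : ℕ} : Measurable (WithLp.toLp 2 : (Fin d → ℝ) → Space d) :=
  (PiLp.volume_preserving_toLp (Fin d)).measurable

variable {d : ℕ} [NeZero d]

/-- The product of `μ` in the first coordinate and of `ν` in the others. -/
def prodMeasure (d : ℕ) [NeZero d] (μ ν : Measure ℝ) : Measure (Space d) :=
  (Measure.pi fun k : Fin d => if k = 0 then μ else ν).map (WithLp.toLp 2)

/-- The map that acts by `f` on the first coordinate and by `g` on the others. -/
def coordMap (f g : ℝ → ℝ) (s : Space d) : Space d :=
  WithLp.toLp 2 fun k => if k = 0 then f (s k) else g (s k)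

section prodMeasure

variable {μ ν μ' ν' : Measure ℝ} [IsProbabilityMeasure μ] [IsProbabilityMeasure ν]

instance (k : Fin d) : IsProbabilityMeasure (if k = 0 then μ else ν) := by
  split_ifs <;> infer_instance

instance : IsProbabilityMeasure (prodMeasure d μ ν) :=
  Measure.isProbabilityMeasure_map measurable_toLp.aemeasurable

lemma measurable_coordMap {f g : ℝ → ℝ} (hf : Measurable f) (hg : Measurable g) :
    Measurable (coordMap f g : Space d → Space d) := by
  refine measurable_toLp.comp (measurable_pi_lambda _ fun k => ?_)
  split_ifs
  · exact hf.comp (by fun_prop)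
  · exact hg.comp (by fun_prop)

lemma prodMeasure_map {f g : ℝ → ℝ} (hf : Measurable f) (hg : Measurable g) :
    (prodMeasure d μ ν).map (coordMap f g) = prodMeasure d (μ.map f) (ν.map g) := by
  have := Measure.isProbabilityMeasure_map (μ := μ) hf.aemeasurable
  have := Measure.isProbabilityMeasure_map (μ := ν) hg.aemeasurable
  unfold prodMeasure
  rw [Measure.map_map (measurable_coordMap hf hg) measurable_toLp]
  have h := Measure.pi_map_pi (μ := fun k : Fin d => if k = 0 then μ else ν)
    (f := fun k => if k = 0 then f else g) (by
      intro k; split_ifs; exacts [hf.aemeasurable, hg.aemeasurable])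
  have e : (fun k : Fin d => (if k = 0 then μ else ν).map (if k = 0 then f else g)) =
      fun k => if k = 0 then μ.map f else ν.map g := by
    ext1 k; split_ifs <;> rfl
  rw [← e, ← h, Measure.map_map measurable_toLp]
  · congr 1
    ext x k
    simp only [coordMap, Function.comp]
    split_ifs <;> rfl
  · refine measurable_pi_lambda _ fun k => ?_
    split_ifs
    · exact hf.comp (by fun_prop)
    · exact hg.comp (by fun_prop)

lemma integral_prodMeasure_coordMap {f g : ℝ → ℝ} (hf : Measurable f) (hg : Measurable g)
    {F : Space d → ℝ} (hF : Continuous F) :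
    ∫ s, F (coordMap f g s) ∂prodMeasure d μ ν = ∫ s, F s ∂prodMeasure d (μ.map f) (ν.map g) := by
  rw [← prodMeasure_map hf hg,
    integral_map (measurable_coordMap hf hg).aemeasurable hF.aestronglyMeasurable]

lemma ae_prodMeasure {p q : ℝ → Prop} (hp : ∀ᵐ t ∂μ, p t) (hq : ∀ᵐ t ∂ν, q t) :
    ∀ᵐ s ∂prodMeasure d μ ν, p (s 0) ∧ ∀ k, k ≠ 0 → q (s k) := by
  have h : ∀ᵐ x ∂Measure.pi fun k : Fin d => if k = 0 then μ else ν,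
      ∀ k, if k = 0 then p (x k) else q (x k) := by
    rw [ae_all_iff]
    intro k
    refine (Measure.tendsto_eval_ae_ae (i := k)).eventually
      (p := fun t : ℝ => if k = 0 then p t else q t) ?_
    split_ifs
    · exact hp
    · exact hq
  -- Null sets pull back along a measurable equivalence whatever the predicates, so `p` and `q` need
  -- not be measurable.
  have e : (WithLp.toLp 2 : (Fin d → ℝ) → Space d) = MeasurableEquiv.toLp 2 (Fin d → ℝ) := rfl
  unfold prodMeasure
  rw [e, (MeasurableEquiv.toLp 2 (Fin d → ℝ)).measurableEmbedding.ae_map_iff]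
  filter_upwards [h] with x hx
  refine ⟨by simpa using hx 0, fun k hk => by simpa [hk] using hx k⟩

end prodMeasure

/-! ### Blocks and normalized box indicators -/

/-- The block `{y : a ≤ |y₁| ≤ b, c ≤ |y_k| ≤ e for k ≥ 2}`. -/
def blockSet (d : ℕ) [NeZero d] (a b c e : ℝ) : Set (Fin d → ℝ) :=
  Set.univ.pi fun k : Fin d => if k = 0 then bandSet a b else bandSet c e

lemma measurableSet_blockSet (a b c e : ℝ) : MeasurableSet (blockSet d a b c e) := by
  refine MeasurableSet.univ_pi fun k => ?_
  split_ifs <;> exact measurableSet_bandSet _ _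

lemma boxIndicator_eq (a b c e : ℝ) (x : Fin d → ℝ) :
    boxIndicator a b c e (WithLp.toLp 2 x) = (blockSet d a b c e).indicator 1 x := by
  unfold boxIndicator
  by_cases h : x ∈ blockSet d a b c e
  · rw [Set.indicator_of_mem h, if_pos]
    · rfl
    · simp only [blockSet, Set.mem_pi, Set.mem_univ, true_implies] at h
      refine ⟨by simpa [bandSet] using h 0, fun k hk => by simpa [hk, bandSet] using h k⟩
  · rw [Set.indicator_of_notMem h, if_neg]
    rintro ⟨h1, h2⟩
    apply h
    simp only [blockSet, Set.mem_pi, Set.mem_univ, true_implies]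
    intro k
    split_ifs with hk
    · subst hk; exact h1
    · exact h2 k hk

lemma prod_ite_zero (x y : ℝ) : ∏ k : Fin d, (if k = 0 then x else y) = x * y ^ (d - 1) := by
  rw [← Finset.mul_prod_erase _ _ (Finset.mem_univ (0 : Fin d)), if_pos rfl]
  congr 1
  rw [Finset.prod_congr rfl (g := fun _ => y) (fun k hk => if_neg (Finset.ne_of_mem_erase hk))]
  simp

lemma volume_blockSet {a b c e : ℝ} (ha : 0 ≤ a) (hab : a ≤ b) (hc : 0 ≤ c) (hce : c ≤ e) :
    volume (blockSet d a b c e) = ENNReal.ofReal (2 ^ d * ((b - a) * (e - c) ^ (d - 1))) := by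
  unfold blockSet
  rw [volume_pi_pi]
  have : ∀ k : Fin d, volume (if k = 0 then bandSet a b else bandSet c e) =
      ENNReal.ofReal (if k = 0 then 2 * (b - a) else 2 * (e - c)) := by
    intro k
    split_ifs
    · exact volume_bandSet ha hab
    · exact volume_bandSet hc hce
  rw [Finset.prod_congr rfl fun k _ => this k, ← ENNReal.ofReal_prod_of_nonneg, prod_ite_zero]
  · congr 1
    have : (2 : ℝ) ^ d = 2 * 2 ^ (d - 1) := by
      rw [← pow_succ', Nat.sub_add_cancel (NeZero.one_le)]
    rw [this, mul_pow]; ring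
  · intro k _
    split_ifs <;> linarith

lemma pi_band_eq {a b c e : ℝ} (ha : 0 ≤ a) (hab : a < b) (hc : 0 ≤ c) (hce : c < e) :
    (Measure.pi fun k : Fin d => if k = 0 then band a b else band c e) =
      ProbabilityTheory.cond volume (blockSet d a b c e) := by
  have := isProbabilityMeasure_band ha hab
  have := isProbabilityMeasure_band hc hce
  refine Measure.pi_eq fun T hT => ?_
  rw [cond_apply (measurableSet_blockSet a b c e)]
  unfold blockSet
  rw [← Set.pi_inter_distrib, volume_pi_pi, volume_pi_pi, ENNReal.prod_inv_distrib,
    ← Finset.prod_mul_distrib]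
  · refine Finset.prod_congr rfl fun k _ => ?_
    split_ifs
    · exact (cond_apply (measurableSet_bandSet a b) _ _).symm
    · exact (cond_apply (measurableSet_bandSet c e) _ _).symm
  · intro i _ j _ _
    left
    split_ifs
    · rw [volume_bandSet ha hab.le]; simpa using hab
    · rw [volume_bandSet hc hce.le]; simpa using hce

/-- The uniform distribution on the block `{y : a ≤ |y₁| ≤ b, c ≤ |y_k| ≤ e for k ≥ 2}`. -/
def blockMeasure (d : ℕ) [NeZero d] (a b c e : ℝ) : Measure (Space d) :=
  prodMeasure d (band a b) (band c e)

lemma measurable_boxMean (a b c e : ℝ) : Measurable (boxMean a b c e : Space d → ℝ) := by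
  have h : (boxMean a b c e : Space d → ℝ) = fun y =>
      ((b - a) * (e - c) ^ (d - 1))⁻¹ * (blockSet d a b c e).indicator 1 (WithLp.ofLp y) := by
    ext y
    rw [boxMean, ← boxIndicator_eq]
  rw [h]
  refine Measurable.const_mul ?_ _
  exact (measurable_one.indicator (measurableSet_blockSet a b c e)).comp
    (PiLp.volume_preserving_ofLp (Fin d)).measurable

/-- `boxMean` is normalized by the volume of one orthant of the block, and the block consists of `2
^ d` reflected copies of it. -/
lemma integral_boxMean_mul {a b c e : ℝ} (ha : 0 ≤ a) (hab : a < b) (hc : 0 ≤ c) (hce : c < e)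
    {F : Space d → ℝ} (hF : Measurable F) :
    ∫ y, boxMean a b c e y * F y = 2 ^ d * ∫ y, F y ∂blockMeasure d a b c e := by
  have hpos : 0 < (b - a) * (e - c) ^ (d - 1) :=
    mul_pos (sub_pos.2 hab) (pow_pos (sub_pos.2 hce) _)
  unfold blockMeasure prodMeasure
  rw [integral_map measurable_toLp.aemeasurable hF.aestronglyMeasurable, pi_band_eq ha hab hc hce,
    ← (PiLp.volume_preserving_toLp (Fin d)).map_eq,
    integral_map measurable_toLp.aemeasurable (f := fun y => boxMean a b c e y * F y)
      ((measurable_boxMean a b c e).mul hF).aestronglyMeasurable]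
  unfold ProbabilityTheory.cond
  rw [integral_smul_measure, volume_blockSet ha hab.le hc hce.le, ENNReal.toReal_inv,
    ENNReal.toReal_ofReal (by positivity), ← integral_indicator (measurableSet_blockSet a b c e),
    smul_eq_mul, ← mul_assoc, ← integral_const_mul]
  refine integral_congr_ae (Eventually.of_forall fun x => ?_)
  simp only [boxMean, boxIndicator_eq]
  by_cases h : x ∈ blockSet d a b c e
  · simp only [Set.indicator_of_mem h, Pi.one_apply]
    field_simp
  · simp [Set.indicator_of_notMem h]

variable {d : ℕ} [NeZero d]

/-! ### The first coordinate and the others -/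

/-- The projection to the first coordinate axis. -/
def axisPart : Space d → Space d := coordMap id fun _ => 0

/-- The projection to the orthogonal complement of the first coordinate axis. -/
def restPart : Space d → Space d := coordMap (fun _ => 0) id

/-- The reflection of the first coordinate. -/
def axisFlip : Space d → Space d := coordMap (fun t => -t) id

/-- The reflection of all coordinates but the first. -/
def restFlip : Space d → Space d := coordMap id fun t => -t

lemma axisPart_add_restPart (s : Space d) : axisPart s + restPart s = s := by
  ext k; simp only [axisPart, restPart, coordMap, PiLp.add_apply]; split_ifs <;> simp

lemma axisFlip_eq (s : Space d) : axisFlip s = restPart s - axisPart s := by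
  ext k; simp only [axisPart, restPart, axisFlip, coordMap, PiLp.sub_apply]; split_ifs <;> simp

lemma restFlip_eq (s : Space d) : restFlip s = axisPart s - restPart s := by
  ext k; simp only [axisPart, restPart, restFlip, coordMap, PiLp.sub_apply]; split_ifs <;> simp

lemma axisPart_axisFlip (s : Space d) : axisPart (axisFlip s) = -axisPart s := by
  ext k; simp only [axisPart, axisFlip, coordMap, PiLp.neg_apply]; split_ifs <;> simp

lemma restPart_axisFlip (s : Space d) : restPart (axisFlip s) = restPart s := by
  ext k; simp only [restPart, axisFlip, coordMap]; split_ifs <;> simp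

lemma axisPart_restFlip (s : Space d) : axisPart (restFlip s) = axisPart s := by
  ext k; simp only [axisPart, restFlip, coordMap]; split_ifs <;> simp

lemma restPart_restFlip (s : Space d) : restPart (restFlip s) = -restPart s := by
  ext k; simp only [restPart, restFlip, coordMap, PiLp.neg_apply]; split_ifs <;> simp

lemma axisPart_eq_single (s : Space d) : axisPart s = EuclideanSpace.single 0 (s 0) := by
  ext k
  simp only [axisPart, coordMap, PiLp.single_apply, id]
  split_ifs with h <;> simp [h]

lemma norm_axisPart (s : Space d) : ‖axisPart s‖ = |s 0| := by
  rw [axisPart_eq_single, PiLp.norm_single, Real.norm_eq_abs]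

lemma inner_single_restPart (s : Space d) :
    inner ℝ (EuclideanSpace.single 0 1 : Space d) (restPart s) = 0 := by
  rw [EuclideanSpace.inner_single_left]; simp [restPart, coordMap]

omit [NeZero d] in
lemma norm_le_sqrt_mul {s : Space d} {B : ℝ} (hB : 0 ≤ B) (h : ∀ k, |s k| ≤ B) :
    ‖s‖ ≤ √d * B := by
  rw [EuclideanSpace.norm_eq, ← Real.sqrt_sq hB, ← Real.sqrt_mul (by positivity)]
  refine Real.sqrt_le_sqrt ?_
  calc ∑ k, ‖s k‖ ^ 2 ≤ ∑ _k : Fin d, B ^ 2 := by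
        gcongr with k; exact h k
    _ = d * B ^ 2 := by simp

lemma norm_restPart_le {s : Space d} {B : ℝ} (hB : 0 ≤ B) (h : ∀ k, k ≠ 0 → |s k| ≤ B) :
    ‖restPart s‖ ≤ √d * B := by
  refine norm_le_sqrt_mul hB fun k => ?_
  simp only [restPart, coordMap]
  split_ifs with hk
  · simpa using hB
  · exact h k hk

lemma continuous_coordMap {f g : ℝ → ℝ} (hf : Continuous f) (hg : Continuous g) :
    Continuous (coordMap f g : Space d → Space d) := by
  refine (PiLp.continuous_toLp 2 _).comp (continuous_pi fun k => ?_)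
  split_ifs
  · exact hf.comp (by fun_prop)
  · exact hg.comp (by fun_prop)

lemma continuous_axisPart : Continuous (axisPart : Space d → Space d) :=
  continuous_coordMap continuous_id continuous_const

lemma continuous_restPart : Continuous (restPart : Space d → Space d) :=
  continuous_coordMap continuous_const continuous_id

/-! ### Integrals of symmetrized functions -/

section Symmetrization

variable {μ ν : Measure ℝ} [IsProbabilityMeasure μ] [IsProbabilityMeasure ν]

lemma integral_axisFlip (hμ : μ.map (fun t => -t) = μ) {F : Space d → ℝ} (hF : Continuous F) :
    ∫ s, F (axisFlip s) ∂prodMeasure d μ ν = ∫ s, F s ∂prodMeasure d μ ν := by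
  have := integral_prodMeasure_coordMap (d := d) (μ := μ) (ν := ν) measurable_neg measurable_id hF
  rw [Measure.map_id] at this
  exact this.trans (by rw [show μ.map Neg.neg = μ from hμ])

lemma integral_restFlip (hν : ν.map (fun t => -t) = ν) {F : Space d → ℝ} (hF : Continuous F) :
    ∫ s, F (restFlip s) ∂prodMeasure d μ ν = ∫ s, F s ∂prodMeasure d μ ν := by
  have := integral_prodMeasure_coordMap (d := d) (μ := μ) (ν := ν) measurable_id measurable_neg hF
  rw [Measure.map_id] at this
  exact this.trans (by rw [show ν.map Neg.neg = ν from hν])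

omit [NeZero d] in
lemma integrable_of_bound {m : Measure (Space d)} [IsFiniteMeasure m] {F : Space d → ℝ}
    (hF : Continuous F) {C : ℝ} (hb : ∀ s, |F s| ≤ C) : Integrable F m :=
  Integrable.of_bound hF.aestronglyMeasurable C (Eventually.of_forall hb)

omit [NeZero d] in
-- If `σ` preserves the mean of `F`, that mean is also the mean of `(F + F ∘ σ) / 2`, in which terms
-- odd under `σ` cancel. All gains beyond first order in the bias come from this, with `σ` a
-- reflection.
lemma abs_integral_sub_le_of_flip {m : Measure (Space d)} [IsProbabilityMeasure m]
    {σ : Space d → Space d} {F : Space d → ℝ} (hF : Continuous F) (hσ : Continuous σ)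
    {C : ℝ} (hb : ∀ s, |F s| ≤ C) (hinv : ∫ s, F (σ s) ∂m = ∫ s, F s ∂m) {c B : ℝ}
    (h : ∀ᵐ s ∂m, |F s + F (σ s) - 2 * c| ≤ 2 * B) : |∫ s, F s ∂m - c| ≤ B := by
  have i1 : Integrable F m := integrable_of_bound hF hb
  have i2 : Integrable (fun s => F (σ s)) m := integrable_of_bound (hF.comp hσ) fun s => hb _
  have e : ∫ s, (F s + F (σ s) - 2 * c) ∂m = 2 * (∫ s, F s ∂m - c) := by
    have i3 : Integrable (fun s => F s + F (σ s)) m := i1.add i2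
    rw [integral_sub i3 (integrable_const _), integral_add i1 i2, hinv]
    simp; ring
  have h2 : ‖∫ s, (F s + F (σ s) - 2 * c) ∂m‖ ≤ 2 * B := by
    refine (norm_integral_le_of_norm_le_const h).trans (by simp)
  rw [e, norm_mul, Real.norm_eq_abs, Real.norm_eq_abs, abs_two] at h2
  linarith

omit [NeZero d] in
lemma abs_integral_le_of_ae {m : Measure (Space d)} [IsProbabilityMeasure m] {F : Space d → ℝ}
    {B : ℝ} (h : ∀ᵐ s ∂m, |F s| ≤ B) : |∫ s, F s ∂m| ≤ B := by
  have := norm_integral_le_of_norm_le_const (f := F) (C := B) h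
  simpa using this

/-- Only the law of the first coordinate enters. This makes the paired blocks of a step weight
cancel. -/
lemma integral_axisPart {ν' : Measure ℝ} [IsProbabilityMeasure ν'] {F : Space d → ℝ}
    (hF : Continuous F) :
    ∫ s, F (axisPart s) ∂prodMeasure d μ ν = ∫ s, F (axisPart s) ∂prodMeasure d μ ν' := by
  unfold axisPart
  rw [integral_prodMeasure_coordMap measurable_id measurable_const hF,
    integral_prodMeasure_coordMap measurable_id measurable_const hF]
  simp [Measure.map_const]

lemma integral_restPart {μ' : Measure ℝ} [IsProbabilityMeasure μ'] {F : Space d → ℝ}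
    (hF : Continuous F) :
    ∫ s, F (restPart s) ∂prodMeasure d μ ν = ∫ s, F (restPart s) ∂prodMeasure d μ' ν := by
  unfold restPart
  rw [integral_prodMeasure_coordMap measurable_const measurable_id hF,
    integral_prodMeasure_coordMap measurable_const measurable_id hF]
  simp [Measure.map_const]

end Symmetrization

/-! ### Pointwise estimates -/

section Pointwise

variable {H : Space d → ℝ} {D : Space d → Space d →L[ℝ] ℝ} {β L : ℝ}

lemma TaylorBound.abs_symm_sub_le {E : Type*} [NormedAddCommGroup E] [NormedSpace ℝ E]
    {H : E → ℝ} {D : E → E →L[ℝ] ℝ} (h : TaylorBound H D β L) (x w : E) :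
    |H (x + w) + H (x - w) - 2 * H x| ≤ 2 * (L * ‖w‖ ^ β) := by
  have h1 := h.taylor x (x + w)
  have h2 := h.taylor x (x - w)
  have e : x - w - x = -w := by abel
  rw [add_sub_cancel_left] at h1
  rw [e, norm_neg, map_neg] at h2
  rw [abs_le] at *
  constructor <;> linarith [h1.1, h1.2, h2.1, h2.2]

/-- Taylor expansion at the axis point: the derivative at the origin is `η`-small across the axis,
moving it to the axis point costs `6 L R^(β-1)`, and the remainder costs `L R^(β-1)`, each times the
transversal length. -/
lemma TaylorBound.abs_sub_axisPart_le (h : TaylorBound H D β L) (hβ : 1 < β) (hβ2 : β ≤ 2)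
    {R η : ℝ} (hη : ∀ w : Space d, |D 0 (restPart w)| ≤ η * ‖restPart w‖) {s : Space d}
    (hs1 : ‖axisPart s‖ ≤ R) (hs2 : ‖restPart s‖ ≤ R) :
    |H s - H (axisPart s)| ≤ (η + 7 * L * R ^ (β - 1)) * ‖restPart s‖ := by
  have hL := h.nonneg
  have hR : 0 ≤ R := (norm_nonneg _).trans hs1
  have h1 := h.taylor (axisPart s) s
  have e : s - axisPart s = restPart s := by
    nth_rewrite 1 [← axisPart_add_restPart s]; abel
  rw [e] at h1
  have h2 : |(D (axisPart s) - D 0) (restPart s)| ≤ 6 * L * R ^ (β - 1) * ‖restPart s‖ := by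
    refine ((D (axisPart s) - D 0).le_opNorm _).trans ?_
    gcongr
    refine (h.deriv_holder hβ hβ2 0 (axisPart s)).trans ?_
    rw [sub_zero]
    gcongr
  have h3 := hη s
  have h4 : L * ‖restPart s‖ ^ β ≤ L * R ^ (β - 1) * ‖restPart s‖ := by
    rw [mul_assoc]
    gcongr
    rw [show β = (β - 1) + 1 by ring, Real.rpow_add_one' (norm_nonneg _) (by linarith)]
    simp only [add_sub_cancel_right]
    gcongr
  rw [sub_apply] at h2
  rw [abs_le] at *
  constructor <;> linarith [h1.1, h1.2, h2.1, h2.2, h3.1, h3.2]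

end Pointwise

variable {d : ℕ} [NeZero d]

/-! ### Step weights as signed sums of block averages -/

/-- The sequences `u` and `v` define a step weight with `r` steps. -/
structure StepOrder (r : ℕ) (u v : ℕ → ℝ) : Prop where
  two_le : 2 ≤ r
  u_pos : ∀ i ∈ Finset.Icc 1 r, 0 < u i
  u_lt : ∀ i ∈ Finset.Icc 2 r, u (i - 1) < u i
  v_nonneg : ∀ i ∈ Finset.Icc 1 (r + 1), 0 ≤ v i
  v_lt : ∀ i ∈ Finset.Icc 1 r, v (i + 1) < v i
  v_last : v (r + 1) = 0

/-- The block distribution with first coordinate in the `i`-th band and the others in the `j`-th. -/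
def stepBlock (d : ℕ) [NeZero d] (u v : ℕ → ℝ) (i j : ℕ) : Measure (Space d) :=
  blockMeasure d (if i = 1 then 0 else u (i - 1)) (u i) (v (j + 1)) (v j)

/-- The signed sum of block averages that corresponds to a step weight. -/
def stepInt (r : ℕ) (u v : ℕ → ℝ) (F : Space d → ℝ) : ℝ :=
  ∫ s, F s ∂stepBlock d u v 1 1 +
    ∑ i ∈ Finset.Icc 2 r, (∫ s, F s ∂stepBlock d u v i i - ∫ s, F s ∂stepBlock d u v i (i - 1))

/-- The lower end of the `i`-th band of first coordinates. -/
lemma StepOrder.low {r : ℕ} {u v : ℕ → ℝ} (h : StepOrder r u v) {i : ℕ} (hi : i ∈ Finset.Icc 1 r) :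
    0 ≤ (if i = 1 then 0 else u (i - 1)) ∧ (if i = 1 then 0 else u (i - 1)) < u i := by
  simp only [Finset.mem_Icc] at hi
  split_ifs with h1
  · exact ⟨le_rfl, h.u_pos i (by simpa using hi)⟩
  · exact ⟨(h.u_pos (i - 1) (by simp; omega)).le, h.u_lt i (by simp; omega)⟩

lemma StepOrder.band_axis {r : ℕ} {u v : ℕ → ℝ} (h : StepOrder r u v) {i : ℕ}
    (hi : i ∈ Finset.Icc 1 r) :
    IsProbabilityMeasure (band (if i = 1 then 0 else u (i - 1)) (u i)) :=
  isProbabilityMeasure_band (h.low hi).1 (h.low hi).2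

lemma StepOrder.band_rest {r : ℕ} {u v : ℕ → ℝ} (h : StepOrder r u v) {j : ℕ}
    (hj : j ∈ Finset.Icc 1 r) : IsProbabilityMeasure (band (v (j + 1)) (v j)) := by
  simp only [Finset.mem_Icc] at hj
  exact isProbabilityMeasure_band (h.v_nonneg (j + 1) (by simp; omega)) (h.v_lt j (by simpa using hj))

lemma StepOrder.isProbabilityMeasure {r : ℕ} {u v : ℕ → ℝ} (h : StepOrder r u v) {i j : ℕ}
    (hi : i ∈ Finset.Icc 1 r) (hj : j ∈ Finset.Icc 1 r) :
    IsProbabilityMeasure (stepBlock d u v i j) := by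
  have := h.band_axis hi
  have := h.band_rest hj
  unfold stepBlock blockMeasure
  infer_instance

lemma ae_blockMeasure {a b c e : ℝ} (ha : 0 ≤ a) (hab : a < b) (hc : 0 ≤ c) (hce : c < e) :
    ∀ᵐ s ∂blockMeasure d a b c e, (a ≤ |s 0| ∧ |s 0| ≤ b) ∧
      ∀ k, k ≠ 0 → c ≤ |s k| ∧ |s k| ≤ e := by
  have := isProbabilityMeasure_band ha hab
  have := isProbabilityMeasure_band hc hce
  exact ae_prodMeasure (ae_band a b) (ae_band c e)

lemma StepOrder.ae_mem {r : ℕ} {u v : ℕ → ℝ} (h : StepOrder r u v) {i j : ℕ}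
    (hi : i ∈ Finset.Icc 1 r) (hj : j ∈ Finset.Icc 1 r) :
    ∀ᵐ s ∂stepBlock d u v i j, ((if i = 1 then 0 else u (i - 1)) ≤ |s 0| ∧ |s 0| ≤ u i) ∧
      ∀ k, k ≠ 0 → v (j + 1) ≤ |s k| ∧ |s k| ≤ v j := by
  simp only [Finset.mem_Icc] at hj
  exact ae_blockMeasure (h.low hi).1 (h.low hi).2 (h.v_nonneg (j + 1) (by simp; omega))
    (h.v_lt j (by simpa using hj))

lemma StepOrder.ae_norm {r : ℕ} {u v : ℕ → ℝ} (h : StepOrder r u v) {i j : ℕ}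
    (hi : i ∈ Finset.Icc 1 r) (hj : j ∈ Finset.Icc 1 r) :
    ∀ᵐ s ∂stepBlock d u v i j, ‖axisPart s‖ ≤ u i ∧ ‖restPart s‖ ≤ √d * v j := by
  filter_upwards [h.ae_mem hi hj] with s hs
  refine ⟨by rw [norm_axisPart]; exact hs.1.2, norm_restPart_le ?_ fun k hk => (hs.2 k hk).2⟩
  simp only [Finset.mem_Icc] at hj
  exact h.v_nonneg j (by simp; omega)

/-! ### Algebra of the signed block sum and its identification with the weight -/

section Functional

variable {r : ℕ} {u v : ℕ → ℝ}

/-- The index pairs that occur in a step weight. -/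
lemma StepOrder.mem (_ : StepOrder r u v) {i : ℕ} (hi : i ∈ Finset.Icc 2 r) :
    i ∈ Finset.Icc 1 r ∧ i - 1 ∈ Finset.Icc 1 r := by
  simp only [Finset.mem_Icc] at *
  omega

lemma StepOrder.one_mem (h : StepOrder r u v) : 1 ∈ Finset.Icc 1 r := by
  have := h.two_le
  simp; omega

lemma StepOrder.last_mem (h : StepOrder r u v) : r ∈ Finset.Icc 1 r := by
  have := h.two_le
  simp; omega

lemma StepOrder.stepInt_add (h : StepOrder r u v) {F G : Space d → ℝ} (hF : Continuous F)
    (hG : Continuous G) {B C : ℝ} (hB : ∀ s, |F s| ≤ B) (hC : ∀ s, |G s| ≤ C) :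
    stepInt r u v (fun s => F s + G s) = stepInt r u v F + stepInt r u v G := by
  have key : ∀ i ∈ Finset.Icc 1 r, ∀ j ∈ Finset.Icc 1 r,
      ∫ s, (F s + G s) ∂stepBlock d u v i j =
        ∫ s, F s ∂stepBlock d u v i j + ∫ s, G s ∂stepBlock d u v i j := by
    intro i hi j hj
    have := h.isProbabilityMeasure (d := d) hi hj
    exact integral_add (integrable_of_bound hF hB) (integrable_of_bound hG hC)
  unfold stepInt
  rw [key 1 h.one_mem 1 h.one_mem, Finset.sum_congr rfl fun i hi => by
    rw [key i (h.mem hi).1 i (h.mem hi).1, key i (h.mem hi).1 (i - 1) (h.mem hi).2]]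
  simp only [Finset.sum_sub_distrib, Finset.sum_add_distrib]
  ring

lemma stepInt_const_mul (c : ℝ) (F : Space d → ℝ) :
    stepInt r u v (fun s => c * F s) = c * stepInt r u v F := by
  unfold stepInt
  simp only [integral_const_mul, mul_add, Finset.mul_sum, mul_sub]

/-- The blocks `(i, i)` and `(i, i - 1)` share the same first band, so every signed pair cancels and
only the narrowest band remains. -/
lemma StepOrder.stepInt_axisPart (h : StepOrder r u v) {F : Space d → ℝ} (hF : Continuous F) :
    stepInt r u v (fun s => F (axisPart s)) = ∫ s, F (axisPart s) ∂stepBlock d u v 1 1 := by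
  unfold stepInt
  rw [add_eq_left]
  refine Finset.sum_eq_zero fun i hi => ?_
  have := h.band_axis (h.mem hi).1
  have := h.band_rest (h.mem hi).1
  have := h.band_rest (h.mem hi).2
  unfold stepBlock blockMeasure
  rw [sub_eq_zero]
  exact integral_axisPart hF

/-- Here a block average depends on `j` only, so the pairs telescope from `j = 1` down to the
smallest transversal size `v r`. -/
lemma StepOrder.stepInt_restPart (h : StepOrder r u v) {F : Space d → ℝ} (hF : Continuous F) :
    stepInt r u v (fun s => F (restPart s)) = ∫ s, F (restPart s) ∂stepBlock d u v r r := by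
  have key : ∀ i ∈ Finset.Icc 1 r, ∀ j ∈ Finset.Icc 1 r,
      ∫ s, F (restPart s) ∂stepBlock d u v i j = ∫ s, F (restPart s) ∂stepBlock d u v 1 j := by
    intro i hi j hj
    have := h.band_axis hi
    have := h.band_axis h.one_mem
    have := h.band_rest hj
    unfold stepBlock blockMeasure
    exact integral_restPart hF
  unfold stepInt
  rw [Finset.sum_congr rfl fun i hi => by
    rw [key i (h.mem hi).1 i (h.mem hi).1, key i (h.mem hi).1 (i - 1) (h.mem hi).2],
    key r h.last_mem r h.last_mem]
  generalize hψ : (fun j => ∫ s, F (restPart s) ∂stepBlock d u v 1 j) = ψ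
  have hψ' : ∀ j, ∫ s, F (restPart s) ∂stepBlock d u v 1 j = ψ j := fun j => by rw [← hψ]
  simp only [hψ']
  have : ∀ n, 2 ≤ n → ψ 1 + ∑ i ∈ Finset.Icc 2 n, (ψ i - ψ (i - 1)) = ψ n := by
    intro n hn
    induction n, hn using Nat.le_induction with
    | base => simp
    | succ n hn ih =>
      rw [Finset.sum_Icc_succ_top (by omega), ← add_assoc, ih]
      simp
  exact this r h.two_le

lemma StepOrder.abs_stepInt_le (h : StepOrder r u v) {F : Space d → ℝ} {b : ℕ → ℕ → ℝ}
    (hb : ∀ i ∈ Finset.Icc 1 r, ∀ j ∈ Finset.Icc 1 r, |∫ s, F s ∂stepBlock d u v i j| ≤ b i j) :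
    |stepInt r u v F| ≤ b 1 1 + ∑ i ∈ Finset.Icc 2 r, (b i i + b i (i - 1)) := by
  unfold stepInt
  refine (abs_add_le _ _).trans (add_le_add (hb 1 h.one_mem 1 h.one_mem) ?_)
  refine (Finset.abs_sum_le_sum_abs _ _).trans (Finset.sum_le_sum fun i hi => ?_)
  exact (abs_sub _ _).trans (add_le_add (hb i (h.mem hi).1 i (h.mem hi).1)
    (hb i (h.mem hi).1 (i - 1) (h.mem hi).2))

lemma StepOrder.integral_axisFlip (h : StepOrder r u v) {i j : ℕ} (hi : i ∈ Finset.Icc 1 r)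
    (hj : j ∈ Finset.Icc 1 r) {F : Space d → ℝ} (hF : Continuous F) :
    ∫ s, F (axisFlip s) ∂stepBlock d u v i j = ∫ s, F s ∂stepBlock d u v i j := by
  have := h.band_axis hi
  have := h.band_rest hj
  exact Composite.integral_axisFlip band_map_neg hF

lemma StepOrder.integral_restFlip (h : StepOrder r u v) {i j : ℕ} (hi : i ∈ Finset.Icc 1 r)
    (hj : j ∈ Finset.Icc 1 r) {F : Space d → ℝ} (hF : Continuous F) :
    ∫ s, F (restFlip s) ∂stepBlock d u v i j = ∫ s, F s ∂stepBlock d u v i j := by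
  have := h.band_axis hi
  have := h.band_rest hj
  exact Composite.integral_restFlip band_map_neg hF

lemma integrable_boxMean_mul {a b c e : ℝ} (ha : 0 ≤ a) (hab : a < b) (hc : 0 ≤ c) (hce : c < e)
    {F : Space d → ℝ} (hF : Measurable F) {B : ℝ} (hB : ∀ s, |F s| ≤ B) :
    Integrable (fun y => boxMean a b c e y * F y) := by
  have : Integrable (boxMean a b c e : Space d → ℝ) := by
    -- The integral of a function that is not integrable is `0` by convention, whereas the previous
    -- lemma evaluates it as `2 ^ d`.
    by_contra hn
    have h1 := integral_boxMean_mul (d := d) ha hab hc hce (F := fun _ => 1) measurable_const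
    have := isProbabilityMeasure_band ha hab
    have := isProbabilityMeasure_band hc hce
    simp only [mul_one, integral_undef hn] at h1
    unfold blockMeasure at h1
    simp only [integral_const, probReal_univ, smul_eq_mul, mul_one] at h1
    exact pow_ne_zero d two_ne_zero h1.symm
  exact this.mul_bdd (c := B) hF.aestronglyMeasurable (Eventually.of_forall hB)

lemma StepOrder.integral_stepWeight_mul (h : StepOrder r u v) {F : Space d → ℝ}
    (hF : Measurable F) {B : ℝ} (hB : ∀ s, |F s| ≤ B) :
    ∫ y, stepWeight r u v y * F y = stepInt r u v F := by
  have low1 := h.low h.one_mem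
  simp only [if_true] at low1
  have v1 := h.v_lt 1 h.one_mem
  have v2 : 0 ≤ v 2 := h.v_nonneg 2 (by have := h.two_le; simp; omega)
  have hmid : ∀ i ∈ Finset.Icc 2 r, (if i = 1 then 0 else u (i - 1)) = u (i - 1) ∧
      0 ≤ u (i - 1) ∧ u (i - 1) < u i ∧ 0 ≤ v (i + 1) ∧ v (i + 1) < v i ∧ 0 ≤ v i ∧
      v i < v (i - 1) ∧ i - 1 + 1 = i := by
    intro i hi
    have h1 := h.u_lt i hi
    have h2 := (h.u_pos _ (h.mem hi).2).le
    have h3 := h.v_lt i (h.mem hi).1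
    have h4 := h.v_lt _ (h.mem hi).2
    have h7 : i - 1 + 1 = i := by simp only [Finset.mem_Icc] at hi; omega
    rw [h7] at h4
    have h5 : 0 ≤ v (i + 1) := h.v_nonneg _ (by simp only [Finset.mem_Icc] at *; omega)
    have h6 : 0 ≤ v i := h.v_nonneg _ (by simp only [Finset.mem_Icc] at *; omega)
    exact ⟨if_neg (by simp only [Finset.mem_Icc] at hi; omega), h2, h1, h5, h3, h6, h4, h7⟩
  have e : ∀ y, stepWeight r u v y * F y = (2 ^ d)⁻¹ * (boxMean 0 (u 1) (v 2) (v 1) y * F y +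
      ∑ i ∈ Finset.Icc 2 r, (boxMean (u (i - 1)) (u i) (v (i + 1)) (v i) y * F y
        - boxMean (u (i - 1)) (u i) (v i) (v (i - 1)) y * F y)) := by
    intro y
    simp only [stepWeight, ← sub_mul, ← Finset.sum_mul]
    ring
  simp only [e]
  rw [integral_const_mul, integral_add, integral_finsetSum,
    integral_boxMean_mul low1.1 low1.2 v2 v1 hF]
  · rw [Finset.sum_congr rfl fun i hi => by
      obtain ⟨h0, h1, h2, h3, h4, h5, h6, h7⟩ := hmid i hi
      rw [integral_sub (integrable_boxMean_mul h1 h2 h3 h4 hF hB)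
        (integrable_boxMean_mul h1 h2 h5 h6 hF hB), integral_boxMean_mul h1 h2 h3 h4 hF,
        integral_boxMean_mul h1 h2 h5 h6 hF, ← mul_sub], ← Finset.mul_sum, ← mul_add,
      inv_mul_cancel_left₀ (by positivity)]
    unfold stepInt stepBlock
    congr 1
    refine Finset.sum_congr rfl fun i hi => ?_
    obtain ⟨h0, h1, h2, h3, h4, h5, h6, h7⟩ := hmid i hi
    rw [h0, h7]
  · intro i hi
    obtain ⟨h0, h1, h2, h3, h4, h5, h6, h7⟩ := hmid i hi
    exact (integrable_boxMean_mul h1 h2 h3 h4 hF hB).sub (integrable_boxMean_mul h1 h2 h5 h6 hF hB)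
  · exact integrable_boxMean_mul low1.1 low1.2 v2 v1 hF hB
  · refine integrable_finsetSum _ fun i hi => ?_
    obtain ⟨h0, h1, h2, h3, h4, h5, h6, h7⟩ := hmid i hi
    exact (integrable_boxMean_mul h1 h2 h3 h4 hF hB).sub (integrable_boxMean_mul h1 h2 h5 h6 hF hB)

end Functional

lemma boxcar_eq (h₁ h₂ : ℝ) :
    (boxcar h₁ h₂ : Space d → ℝ) = fun y => (2 ^ d)⁻¹ * boxMean 0 h₁ 0 h₂ y := by
  ext y
  have : (2 : ℝ) ^ d = 2 * 2 ^ (d - 1) := by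
    rw [← pow_succ', Nat.sub_add_cancel (NeZero.one_le)]
  simp only [boxcar, boxMean, this, mul_pow, mul_inv, sub_zero]
  ring

lemma integral_boxcar_mul {h₁ h₂ : ℝ} (hh₁ : 0 < h₁) (hh₂ : 0 < h₂) {F : Space d → ℝ}
    (hF : Measurable F) :
    ∫ y, boxcar h₁ h₂ y * F y = ∫ s, F s ∂blockMeasure d 0 h₁ 0 h₂ := by
  rw [boxcar_eq]
  simp only [mul_assoc]
  rw [integral_const_mul, integral_boxMean_mul le_rfl hh₁ le_rfl hh₂ hF,
    inv_mul_cancel_left₀ (by positivity)]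

variable {d : ℕ} [NeZero d]

/-! ### The bias of a step weight -/

lemma TaylorBound.apply_real {f : ℝ → ℝ} {D : ℝ → ℝ →L[ℝ] ℝ} {γ L : ℝ} (_ : TaylorBound f D γ L)
    (a t : ℝ) : D a t = D a 1 * t := by
  have := (D a).map_smul t 1
  rw [smul_eq_mul, mul_one, smul_eq_mul] at this
  rw [this, mul_comm]

lemma TaylorBound.slope_le {f : ℝ → ℝ} {D : ℝ → ℝ →L[ℝ] ℝ} {γ L : ℝ} (h : TaylorBound f D γ L)
    (a : ℝ) : |D a 1| ≤ L := by
  have := (D a).le_opNorm 1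
  simp only [norm_one, mul_one] at this
  exact this.trans (h.deriv_bound a)

lemma TaylorBound.slope_sub_le {f : ℝ → ℝ} {D : ℝ → ℝ →L[ℝ] ℝ} {γ L : ℝ}
    (h : TaylorBound f D γ L) (hγ : 1 < γ) (hγ2 : γ ≤ 2) (a b : ℝ) :
    |D b 1 - D a 1| ≤ 6 * L * |b - a| ^ (γ - 1) := by
  have := (D b - D a).le_opNorm 1
  simp only [norm_one, mul_one] at this
  exact this.trans (h.deriv_holder hγ hγ2 a b)

lemma TaylorBound.continuous_slope {f : ℝ → ℝ} {D : ℝ → ℝ →L[ℝ] ℝ} {γ L : ℝ}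
    (h : TaylorBound f D γ L) (hγ : 1 < γ) (hγ2 : γ ≤ 2) : Continuous fun a => D a 1 := by
  rw [continuous_iff_continuousAt]
  intro a
  rw [ContinuousAt, tendsto_iff_norm_sub_tendsto_zero]
  have h2 : Tendsto (fun b : ℝ => 6 * L * |b - a| ^ (γ - 1)) (𝓝 a) (𝓝 0) := by
    have : Continuous fun b : ℝ => 6 * L * |b - a| ^ (γ - 1) := by
      refine continuous_const.mul (Continuous.rpow_const (by fun_prop) fun _ => Or.inr (by linarith))
    have h3 := this.tendsto a
    simpa [Real.zero_rpow (by linarith : γ - 1 ≠ 0)] using h3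
  exact squeeze_zero (fun _ => norm_nonneg _) (fun b => h.slope_sub_le hγ hγ2 a b) h2

variable {r : ℕ} {u v : ℕ → ℝ} {H : Space d → ℝ} {DH : Space d → Space d →L[ℝ] ℝ} {f : ℝ → ℝ}
  {Df : ℝ → ℝ →L[ℝ] ℝ} {γ β L : ℝ}

lemma two_mul_rpow_le {L γ p : ℝ} (hL : 1 ≤ L) (hγ2 : γ ≤ 2) (hp : 0 ≤ p) :
    (2 * L * p) ^ γ ≤ 4 * L ^ 2 * p ^ γ := by
  rw [Real.mul_rpow (by linarith) hp]
  gcongr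
  calc (2 * L) ^ γ ≤ (2 * L) ^ (2 : ℝ) := Real.rpow_le_rpow_of_exponent_le (by linarith) hγ2
    _ = 4 * L ^ 2 := by rw [Real.rpow_two]; ring

omit [NeZero d] in
-- Expand `f` at `H 0`. The linear term multiplies the symmetric second difference of `H`, which is
-- of order `β`; the remainders are of order `γ` because `H` is Lipschitz.
lemma symm_axis_le (hH : TaylorBound H DH β L) (hf : TaylorBound f Df γ L) (hL : 1 ≤ L)
    (hγ : 0 < γ) (hγ2 : γ ≤ 2) (hβ : 1 ≤ β) (w : Space d) :
    |f (H w) + f (H (-w)) - 2 * f (H 0)| ≤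
      2 * (4 * L ^ 3 * ‖w‖ ^ γ + L ^ 2 * ‖w‖ ^ β) := by
  have hA : ∀ x : Space d, |f (H x) - f (H 0) - Df (H 0) 1 * (H x - H 0)| ≤
      4 * L ^ 3 * ‖x‖ ^ γ := by
    intro x
    have h1 := hf.taylor (H 0) (H x)
    rw [hf.apply_real] at h1
    have h2 := hH.lipschitz hβ 0 x
    rw [sub_zero] at h2
    refine h1.trans ?_
    calc L * ‖H x - H 0‖ ^ γ ≤ L * (2 * L * ‖x‖) ^ γ := by gcongr; exact h2
      _ ≤ L * (4 * L ^ 2 * ‖x‖ ^ γ) := by gcongr; exact two_mul_rpow_le hL hγ2 (norm_nonneg _)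
      _ = _ := by ring
  have h1 := hA w
  have h2 := hA (-w)
  rw [norm_neg] at h2
  have h3 := hH.abs_symm_sub_le 0 w
  rw [zero_add, zero_sub] at h3
  have h4 : |Df (H 0) 1 * (H w + H (-w) - 2 * H 0)| ≤ L * (2 * (L * ‖w‖ ^ β)) := by
    rw [abs_mul]
    exact mul_le_mul (hf.slope_le _) h3 (abs_nonneg _) (by linarith)
  rw [abs_le] at *
  constructor <;> nlinarith [h1.1, h1.2, h2.1, h2.2, h4.1, h4.2]

omit [NeZero d] in
lemma slope_diff_le (hH : TaylorBound H DH β L) (hf : TaylorBound f Df γ L) (hL : 1 ≤ L)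
    (hγ : 1 < γ) (hγ2 : γ ≤ 2) (hβ : 1 ≤ β) (w : Space d) :
    |Df (H w) 1 - Df (H 0) 1| ≤ 12 * L ^ 2 * ‖w‖ ^ (γ - 1) := by
  have h2 := hH.lipschitz hβ 0 w
  rw [sub_zero] at h2
  refine (hf.slope_sub_le hγ hγ2 _ _).trans ?_
  calc 6 * L * |H w - H 0| ^ (γ - 1) ≤ 6 * L * (2 * L * ‖w‖) ^ (γ - 1) := by
        gcongr
    _ = 6 * L * ((2 * L) ^ (γ - 1) * ‖w‖ ^ (γ - 1)) := by
        rw [Real.mul_rpow (by linarith) (norm_nonneg _)]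
    _ ≤ 6 * L * ((2 * L) * ‖w‖ ^ (γ - 1)) := by
        gcongr
        calc (2 * L) ^ (γ - 1) ≤ (2 * L) ^ (1 : ℝ) :=
              Real.rpow_le_rpow_of_exponent_le (by linarith) (by linarith)
          _ = 2 * L := Real.rpow_one _
    _ = _ := by ring

/-- The bias bound of a step weight, in terms of its steps. -/
def stepBias (d : ℕ) (γ β κ : ℝ) (r : ℕ) (u v : ℕ → ℝ) : ℝ :=
  u 1 ^ γ + u 1 ^ β + (√d * v r) ^ β + ∑ i ∈ Finset.Icc 2 r, u i ^ β +
    (u 1 ^ (γ - 1) * (√d * v 1) ^ β + ∑ i ∈ Finset.Icc 2 r,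
      u i ^ (γ - 1) * ((√d * v i) ^ β + (√d * v (i - 1)) ^ β)) +
    ((κ * (√d * v 1)) ^ γ + ∑ i ∈ Finset.Icc 2 r,
      ((κ * (√d * v i)) ^ γ + (κ * (√d * v (i - 1))) ^ γ))

/-- Each piece of `f ∘ H` is paired with the symmetry or cancellation that makes it small. `f` on
the axis survives only in the band up to `u 1`, where the axis reflection gives `u₁^γ + u₁^β`. In `H
- A`, the part `H - C` is second order in the first coordinate, block by block; `C` telescopes to `v
r` and `A` cancels down to `u 1`. The cross term contains the slope increment `f'(A) - f'(H 0)`,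
which is unchanged by the reflection of the other coordinates, while that reflection makes `H - A`
of order `vⱼ^β`. The Taylor remainder of `f` has no symmetry to exploit and uses the transversal
bound `hB`. -/
lemma StepOrder.abs_stepInt_sub_le (h : StepOrder r u v) (hH : TaylorBound H DH β L)
    (hf : TaylorBound f Df γ L) (hL : 1 ≤ L) (hγ : 1 < γ) (hγ2 : γ ≤ 2) (hβ : 1 < β) {κ R : ℝ}
    (hB : ∀ s, ‖axisPart s‖ ≤ R → ‖restPart s‖ ≤ R →
      |H s - H (axisPart s)| ≤ κ * ‖restPart s‖) (hκ : 0 ≤ κ)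
    (hu : ∀ i ∈ Finset.Icc 1 r, u i ≤ R) (hv : ∀ j ∈ Finset.Icc 1 r, √d * v j ≤ R) :
    |stepInt r u v (fun s => f (H s)) - f (H 0)| ≤ 12 * L ^ 3 * stepBias d γ β κ r u v := by
  have hL0 : 0 ≤ L := by linarith
  have cH : Continuous H := hH.continuous hβ.le
  have cf : Continuous f := hf.continuous hγ.le
  have cs : Continuous fun a => Df a 1 := hf.continuous_slope hγ hγ2
  have cA : Continuous fun s : Space d => H (axisPart s) := cH.comp continuous_axisPart
  have cC : Continuous fun s : Space d => H (restPart s) := cH.comp continuous_restPart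
  have cflip : Continuous (axisFlip : Space d → Space d) :=
    continuous_coordMap continuous_neg continuous_id
  have cflip' : Continuous (restFlip : Space d → Space d) :=
    continuous_coordMap continuous_id continuous_neg
  have npos : ∀ i ∈ Finset.Icc 1 r, 0 ≤ u i := fun i hi => (h.u_pos i hi).le
  have vpos : ∀ j ∈ Finset.Icc 1 r, 0 ≤ √d * v j := fun j hj => by
    have : 0 ≤ v j := h.v_nonneg j (by simp only [Finset.mem_Icc] at *; omega)
    positivity
  have bB : ∀ s, |H s - H (axisPart s)| ≤ 2 * L := fun s =>
    (abs_sub _ _).trans (by linarith [hH.bound s, hH.bound (axisPart s)])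
  -- the function of the first coordinate
  have T1 : |stepInt r u v (fun s => f (H (axisPart s))) - f (H 0)| ≤
      4 * L ^ 3 * u 1 ^ γ + L ^ 2 * u 1 ^ β := by
    have cF : Continuous fun s => f (H s) := cf.comp cH
    rw [h.stepInt_axisPart (F := fun s => f (H s)) cF]
    have := h.isProbabilityMeasure (d := d) h.one_mem h.one_mem
    have cfA : Continuous fun s : Space d => f (H (axisPart s)) := cf.comp cA
    refine abs_integral_sub_le_of_flip (σ := axisFlip) (C := L) cfA cflip
      (fun s => hf.bound _) (h.integral_axisFlip h.one_mem h.one_mem cfA) ?_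
    filter_upwards [h.ae_norm h.one_mem h.one_mem] with s hs
    rw [axisPart_axisFlip]
    refine (symm_axis_le hH hf hL (by linarith) hγ2 hβ.le _).trans ?_
    have := hs.1
    gcongr
  -- the increment in the other coordinates
  have T2a : |stepInt r u v (fun s => H (restPart s)) - H 0| ≤ L * (√d * v r) ^ β := by
    rw [h.stepInt_restPart cH]
    have := h.isProbabilityMeasure (d := d) h.last_mem h.last_mem
    refine abs_integral_sub_le_of_flip (σ := restFlip) (C := L) cC cflip'
      (fun s => hH.bound _) (h.integral_restFlip h.last_mem h.last_mem cC) ?_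
    filter_upwards [h.ae_norm h.last_mem h.last_mem] with s hs
    rw [restPart_restFlip]
    have h3 := hH.abs_symm_sub_le 0 (restPart s)
    rw [zero_add, zero_sub] at h3
    refine h3.trans ?_
    have := hs.2
    gcongr
  have T2b : |stepInt r u v (fun s => H (axisPart s)) - H 0| ≤ L * u 1 ^ β := by
    rw [h.stepInt_axisPart cH]
    have := h.isProbabilityMeasure (d := d) h.one_mem h.one_mem
    refine abs_integral_sub_le_of_flip (σ := axisFlip) (C := L) cA cflip
      (fun s => hH.bound _) (h.integral_axisFlip h.one_mem h.one_mem cA) ?_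
    filter_upwards [h.ae_norm h.one_mem h.one_mem] with s hs
    rw [axisPart_axisFlip]
    have h3 := hH.abs_symm_sub_le 0 (axisPart s)
    rw [zero_add, zero_sub] at h3
    refine h3.trans ?_
    have := hs.1
    gcongr
  have cE1 : Continuous fun s => H s - H (restPart s) := cH.sub cC
  have bE1 : ∀ s, |H s - H (restPart s)| ≤ 2 * L := fun s =>
    (abs_sub _ _).trans (by linarith [hH.bound s, hH.bound (restPart s)])
  have T2c : |stepInt r u v (fun s => H s - H (restPart s))| ≤
      L * u 1 ^ β + ∑ i ∈ Finset.Icc 2 r, (L * u i ^ β + L * u i ^ β) := by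
    refine h.abs_stepInt_le (b := fun i _ => L * u i ^ β) fun i hi j hj => ?_
    have := h.isProbabilityMeasure (d := d) hi hj
    have key := abs_integral_sub_le_of_flip (m := stepBlock d u v i j) (σ := axisFlip) (c := 0)
      (B := L * u i ^ β) cE1 cflip bE1 (h.integral_axisFlip hi hj cE1) ?_
    · rwa [sub_zero] at key
    filter_upwards [h.ae_norm hi hj] with s hs
    rw [restPart_axisFlip, axisFlip_eq]
    have h3 := hH.abs_symm_sub_le (restPart s) (axisPart s)
    rw [add_comm (restPart s), axisPart_add_restPart] at h3
    calc _ = |H s + H (restPart s - axisPart s) - 2 * H (restPart s)| := by congr 1; ring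
      _ ≤ _ := h3
      _ ≤ _ := by
        have := hs.1
        gcongr
  have T2 : |stepInt r u v (fun s => H s - H (axisPart s))| ≤
      L * u 1 ^ β + ∑ i ∈ Finset.Icc 2 r, (L * u i ^ β + L * u i ^ β) + L * (√d * v r) ^ β +
        L * u 1 ^ β := by
    have e : (fun s => H s - H (axisPart s)) =
        fun s => (H s - H (restPart s)) + (H (restPart s) + (-1) * H (axisPart s)) := by
      ext s; ring
    have bneg : ∀ s, |(-1) * H (axisPart s)| ≤ L := fun s => by simpa using hH.bound (axisPart s)
    have cneg : Continuous fun s : Space d => (-1) * H (axisPart s) := continuous_const.mul cA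
    have csum : Continuous fun s : Space d => H (restPart s) + (-1) * H (axisPart s) := cC.add cneg
    rw [e, h.stepInt_add cE1 csum bE1 (C := 2 * L) fun s => (abs_add_le _ _).trans
        (by linarith [hH.bound (restPart s), bneg s]),
      h.stepInt_add cC cneg (fun s => hH.bound _) bneg, stepInt_const_mul]
    rw [abs_le] at *
    constructor <;> linarith [T2a.1, T2a.2, T2b.1, T2b.2, T2c.1, T2c.2]
  -- the cross term
  have cB : Continuous fun s => H s - H (axisPart s) := cH.sub cA
  have bS : ∀ s : Space d, |Df (H (axisPart s)) 1 - Df (H 0) 1| ≤ 2 * L := fun s =>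
    (abs_sub _ _).trans (by linarith [hf.slope_le (H (axisPart s)), hf.slope_le (H 0)])
  set E : Space d → ℝ := fun s =>
    (Df (H (axisPart s)) 1 - Df (H 0) 1) * (H s - H (axisPart s)) with hE
  have cE : Continuous E := ((cs.comp cA).sub continuous_const).mul cB
  have bE : ∀ s, |E s| ≤ 2 * L * (2 * L) := fun s => by
    rw [hE, abs_mul]
    exact mul_le_mul (bS s) (bB s) (abs_nonneg _) (by linarith)
  have T3 : |stepInt r u v E| ≤
      12 * L ^ 3 * (u 1 ^ (γ - 1) * (√d * v 1) ^ β) + ∑ i ∈ Finset.Icc 2 r,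
        (12 * L ^ 3 * (u i ^ (γ - 1) * (√d * v i) ^ β) +
          12 * L ^ 3 * (u i ^ (γ - 1) * (√d * v (i - 1)) ^ β)) := by
    refine h.abs_stepInt_le (b := fun i j => 12 * L ^ 3 * (u i ^ (γ - 1) * (√d * v j) ^ β))
      fun i hi j hj => ?_
    have := h.isProbabilityMeasure (d := d) hi hj
    have key := abs_integral_sub_le_of_flip (m := stepBlock d u v i j) (σ := restFlip) (c := 0)
      (B := 12 * L ^ 3 * (u i ^ (γ - 1) * (√d * v j) ^ β)) cE cflip' bE
      (h.integral_restFlip hi hj cE) ?_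
    · rwa [sub_zero] at key
    filter_upwards [h.ae_norm hi hj] with s hs
    simp only [hE]
    rw [axisPart_restFlip, restFlip_eq]
    have h3 := hH.abs_symm_sub_le (axisPart s) (restPart s)
    rw [axisPart_add_restPart] at h3
    have h4 := slope_diff_le hH hf hL hγ hγ2 hβ.le (axisPart s)
    have hi0 := npos i hi
    have hj0 := vpos j hj
    calc _ = |Df (H (axisPart s)) 1 - Df (H 0) 1| *
          |H s + H (axisPart s - restPart s) - 2 * H (axisPart s)| := by
            rw [← abs_mul]; congr 1; ring
      _ ≤ (12 * L ^ 2 * ‖axisPart s‖ ^ (γ - 1)) * (2 * (L * ‖restPart s‖ ^ β)) := by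
            gcongr
      _ ≤ (12 * L ^ 2 * u i ^ (γ - 1)) * (2 * (L * (√d * v j) ^ β)) := by
            have h5 := hs.1
            have h6 := hs.2
            have : 0 ≤ γ - 1 := by linarith
            gcongr
      _ = _ := by ring
  -- the remainder
  set E' : Space d → ℝ := fun s =>
    f (H s) - f (H (axisPart s)) - Df (H (axisPart s)) 1 * (H s - H (axisPart s)) with hE'
  have cE' : Continuous E' := ((cf.comp cH).sub (cf.comp cA)).sub ((cs.comp cA).mul cB)
  have bE' : ∀ s, |E' s| ≤ 2 * L + L * (2 * L) := fun s => by
    have h1 : |Df (H (axisPart s)) 1 * (H s - H (axisPart s))| ≤ L * (2 * L) := by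
      rw [abs_mul]
      exact mul_le_mul (hf.slope_le _) (bB s) (abs_nonneg _) hL0
    have h2 := hf.bound (H s)
    have h3 := hf.bound (H (axisPart s))
    simp only [hE']
    rw [abs_le] at *
    constructor <;> linarith [h1.1, h1.2, h2.1, h2.2, h3.1, h3.2]
  have T4 : |stepInt r u v E'| ≤
      L * (κ * (√d * v 1)) ^ γ + ∑ i ∈ Finset.Icc 2 r,
        (L * (κ * (√d * v i)) ^ γ + L * (κ * (√d * v (i - 1))) ^ γ) := by
    refine h.abs_stepInt_le (b := fun _ j => L * (κ * (√d * v j)) ^ γ) fun i hi j hj => ?_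
    have := h.isProbabilityMeasure (d := d) hi hj
    refine abs_integral_le_of_ae ?_
    filter_upwards [h.ae_norm hi hj] with s hs
    have h1 := hf.taylor (H (axisPart s)) (H s)
    rw [hf.apply_real] at h1
    refine h1.trans ?_
    have h2 := hB s (hs.1.trans (hu i hi)) (hs.2.trans (hv j hj))
    have h3 : |H s - H (axisPart s)| ≤ κ * (√d * v j) :=
      h2.trans (by have := hs.2; gcongr)
    rw [Real.norm_eq_abs]
    gcongr
  -- The slope is frozen at `H 0` rather than at `A` so that the linear term is a constant multiple
  -- of `H - A` and inherits the telescoping; the error of freezing is `E`.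
  have e : (fun s => f (H s)) = fun s => f (H (axisPart s)) +
      (Df (H 0) 1 * (H s - H (axisPart s)) + (E s + E' s)) := by
    ext s; simp only [hE, hE']; ring
  have cE2 : Continuous fun s => E s + E' s := cE.add cE'
  have bE2 : ∀ s, |E s + E' s| ≤ 2 * L * (2 * L) + (2 * L + L * (2 * L)) := fun s =>
    (abs_add_le _ _).trans (add_le_add (bE s) (bE' s))
  have cE3 : Continuous fun s => Df (H 0) 1 * (H s - H (axisPart s)) := continuous_const.mul cB
  have bE3 : ∀ s, |Df (H 0) 1 * (H s - H (axisPart s))| ≤ L * (2 * L) := fun s => by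
    rw [abs_mul]
    exact mul_le_mul (hf.slope_le _) (bB s) (abs_nonneg _) hL0
  have cfA : Continuous fun s : Space d => f (H (axisPart s)) := cf.comp cA
  have cE4 : Continuous fun s => Df (H 0) 1 * (H s - H (axisPart s)) + (E s + E' s) := cE3.add cE2
  rw [e, h.stepInt_add cfA cE4 (fun s => hf.bound _)
      (fun s => (abs_add_le _ _).trans (add_le_add (bE3 s) (bE2 s))),
    h.stepInt_add cE3 cE2 bE3 bE2, stepInt_const_mul, h.stepInt_add cE cE' bE bE']
  set SH := stepInt r u v fun s => H s - H (axisPart s)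
  have T2' : |Df (H 0) 1 * SH| ≤ L * (L * u 1 ^ β +
      ∑ i ∈ Finset.Icc 2 r, (L * u i ^ β + L * u i ^ β) + L * (√d * v r) ^ β + L * u 1 ^ β) := by
    rw [abs_mul]
    exact mul_le_mul (hf.slope_le _) T2 (abs_nonneg _) hL0
  simp only [← Finset.mul_sum, ← mul_add] at T3 T4
  simp only [Finset.sum_add_distrib, ← Finset.mul_sum] at T2'
  unfold stepBias
  have pa : 0 ≤ u 1 ^ γ := Real.rpow_nonneg (npos 1 h.one_mem) _
  have pb : 0 ≤ u 1 ^ β := Real.rpow_nonneg (npos 1 h.one_mem) _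
  have pc : 0 ≤ (√d * v r) ^ β := Real.rpow_nonneg (vpos r h.last_mem) _
  have pS : 0 ≤ ∑ i ∈ Finset.Icc 2 r, u i ^ β :=
    Finset.sum_nonneg fun i hi => Real.rpow_nonneg (npos i (h.mem hi).1) _
  have pU : 0 ≤ (κ * (√d * v 1)) ^ γ + ∑ i ∈ Finset.Icc 2 r,
      ((κ * (√d * v i)) ^ γ + (κ * (√d * v (i - 1))) ^ γ) := by
    refine add_nonneg (Real.rpow_nonneg (mul_nonneg hκ (vpos 1 h.one_mem)) _)
      (Finset.sum_nonneg fun i hi => add_nonneg ?_ ?_)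
    · exact Real.rpow_nonneg (mul_nonneg hκ (vpos i (h.mem hi).1)) _
    · exact Real.rpow_nonneg (mul_nonneg hκ (vpos (i - 1) (h.mem hi).2)) _
  generalize u 1 ^ γ = a at *
  generalize u 1 ^ β = b at *
  generalize (√d * v r) ^ β = c at *
  generalize ∑ i ∈ Finset.Icc 2 r, u i ^ β = S at *
  generalize (κ * (√d * v 1)) ^ γ + ∑ i ∈ Finset.Icc 2 r,
      ((κ * (√d * v i)) ^ γ + (κ * (√d * v (i - 1))) ^ γ) = U at *
  generalize u 1 ^ (γ - 1) * (√d * v 1) ^ β + ∑ i ∈ Finset.Icc 2 r,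
      u i ^ (γ - 1) * ((√d * v i) ^ β + (√d * v (i - 1)) ^ β) = T at *
  have l2 : L ^ 2 ≤ L ^ 3 := pow_le_pow_right₀ hL (by norm_num)
  have l1 : L ≤ L ^ 3 := le_self_pow₀ hL (by norm_num)
  have m1 : L ^ 2 * (3 * b + 2 * S + c) ≤ L ^ 3 * (3 * b + 2 * S + c) := by gcongr
  have m2 : L * U ≤ L ^ 3 * U := by gcongr
  have l3 : 0 ≤ L ^ 3 := by positivity
  have n1 := mul_nonneg l3 pa
  have n2 := mul_nonneg l3 pb
  have n3 := mul_nonneg l3 pc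
  have n4 := mul_nonneg l3 pS
  have n5 := mul_nonneg l3 pU
  refine (abs_le.2 ⟨?_, ?_⟩ : |_| ≤ 4 * L ^ 3 * a + L ^ 2 * b + L * (L * b + (L * S + L * S)
    + L * c + L * b) + 12 * L ^ 3 * T + L * U).trans (by nlinarith)
  all_goals
    rw [abs_le] at T1 T2' T3 T4
    linarith [T1.1, T1.2, T2'.1, T2'.2, T3.1, T3.2, T4.1, T4.2]

variable {d : ℕ} [NeZero d]

/-! ### Composite functions -/

section Modulus

lemma continuous_of_modulus {E : Type*} [NormedAddCommGroup E] {G : E → ℝ} {C α : ℝ} (hα : 0 < α)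
    (h : ∀ x y, |G y - G x| ≤ C * ‖y - x‖ ^ α) : Continuous G := by
  rw [continuous_iff_continuousAt]
  intro a
  rw [ContinuousAt, tendsto_iff_norm_sub_tendsto_zero]
  have h2 : Tendsto (fun b : E => C * ‖b - a‖ ^ α) (𝓝 a) (𝓝 0) := by
    have : Continuous fun b : E => C * ‖b - a‖ ^ α := by
      refine continuous_const.mul (Continuous.rpow_const (by fun_prop) fun _ => Or.inr hα.le)
    have h3 := this.tendsto a
    simpa [Real.zero_rpow hα.ne'] using h3
  exact squeeze_zero (fun _ => norm_nonneg _) (fun b => h a b) h2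

lemma holderClassReal_modulus {α L : ℝ} (h2 : α ≤ 2) (hL : 0 ≤ L) {f : ℝ → ℝ}
    (hf : f ∈ holderClassReal α L) :
    (∀ x, |f x| ≤ L) ∧ ∀ x y, |f y - f x| ≤ 2 * L * |y - x| ^ min 1 α := by
  rcases le_or_gt α 1 with h | h
  · obtain ⟨a, b⟩ := holderClassReal_of_le_one h hL hf
    rw [min_eq_right h]
    exact ⟨a, fun x y => (b x y).trans (by gcongr; linarith)⟩
  · have := holderClassReal_of_one_lt h h2 hL hf
    rw [min_eq_left h.le]
    refine ⟨this.bound, fun x y => ?_⟩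
    rw [Real.rpow_one]
    exact this.lipschitz h.le x y

omit [NeZero d] in
lemma holderClass_modulus {α L : ℝ} (h2 : α ≤ 2) (hL : 0 ≤ L) {G : Space d → ℝ}
    (hG : G ∈ holderClass d α L) :
    ∀ x y, |G y - G x| ≤ 2 * L * ‖y - x‖ ^ min 1 α := by
  rcases le_or_gt α 1 with h | h
  · obtain ⟨a, b⟩ := holderClass_of_le_one h hL hG
    rw [min_eq_right h]
    exact fun x y => (b x y).trans (by gcongr; linarith)
  · have := holderClass_of_one_lt h h2 hL hG
    rw [min_eq_left h.le]
    intro x y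
    rw [Real.rpow_one]
    exact this.lipschitz h.le x y

variable {γ β L₁ L₂ L : ℝ}

omit [NeZero d] in
-- Hölder exponents capped at one multiply under composition. This crude modulus serves for the
-- passage to the grid and for the bias of cubes when `γ ≤ 1` or `β ≤ 1`.
lemma compositeClass_modulus (hγ : 0 < γ) (hγ2 : γ ≤ 2) (hβ2 : β ≤ 2) (hL₁ : 0 ≤ L₁)
    (hL₂ : 0 ≤ L₂) (hL : 1 ≤ L) (h1 : L₁ ≤ L) (h2 : L₂ ≤ L) {g : Space d → ℝ}
    (hg : g ∈ compositeClass d γ β L₁ L₂) :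
    (∀ x, |g x| ≤ L) ∧ ∀ x y, |g y - g x| ≤ 4 * L ^ 2 * ‖y - x‖ ^ (min 1 γ * min 1 β) := by
  obtain ⟨f, hf, G, hG, rfl⟩ := hg
  obtain ⟨a, b⟩ := holderClassReal_modulus hγ2 hL₁ hf
  have c := holderClass_modulus hβ2 hL₂ hG
  refine ⟨fun x => (a _).trans h1, fun x y => ?_⟩
  have hm : 0 ≤ min 1 γ := by positivity
  calc |f (G y) - f (G x)| ≤ 2 * L₁ * |G y - G x| ^ min 1 γ := b _ _
    _ ≤ 2 * L * (2 * L * ‖y - x‖ ^ min 1 β) ^ min 1 γ := by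
        gcongr
        exact (c x y).trans (by gcongr)
    _ = 2 * L * ((2 * L) ^ min 1 γ * ‖y - x‖ ^ (min 1 γ * min 1 β)) := by
        rw [Real.mul_rpow (by linarith) (by positivity), ← Real.rpow_mul (norm_nonneg _), mul_comm (min 1 β)]
    _ ≤ 2 * L * ((2 * L) * ‖y - x‖ ^ (min 1 γ * min 1 β)) := by
        gcongr
        calc (2 * L) ^ min 1 γ ≤ (2 * L) ^ (1 : ℝ) :=
              Real.rpow_le_rpow_of_exponent_le (by linarith) (min_le_left _ _)
          _ = 2 * L := Real.rpow_one _
    _ = _ := by ring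

omit [NeZero d] in
lemma compositeClass_continuous (hγ : 0 < γ) (hγ2 : γ ≤ 2) (hβ : 0 < β) (hβ2 : β ≤ 2)
    (hL₁ : 0 ≤ L₁) (hL₂ : 0 ≤ L₂) {g : Space d → ℝ} (hg : g ∈ compositeClass d γ β L₁ L₂) :
    Continuous g := by
  have := (compositeClass_modulus hγ hγ2 hβ2 hL₁ hL₂ (le_max_left 1 (max L₁ L₂))
    ((le_max_left _ _).trans (le_max_right _ _)) ((le_max_right _ _).trans (le_max_right _ _)) hg).2
  exact continuous_of_modulus (by positivity) this

end Modulus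

/-! ### Bias of oriented weights over the class -/

lemma TaylorBound.mono {E : Type*} [NormedAddCommGroup E] [NormedSpace ℝ E] {G : E → ℝ}
    {D : E → E →L[ℝ] ℝ} {α L L' : ℝ} (h : TaylorBound G D α L) (hL : L ≤ L') :
    TaylorBound G D α L' where
  bound x := (h.bound x).trans hL
  deriv_bound x := (h.deriv_bound x).trans hL
  taylor x y := (h.taylor x y).trans (by gcongr)

omit [NeZero d] in
-- Moving the base point and the orientation into the inner function reduces every bias estimate to
-- the unrotated weight at the origin, with the same constants.
lemma TaylorBound.comp_isometry {G : Space d → ℝ} {D : Space d → Space d →L[ℝ] ℝ} {α L : ℝ}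
    (h : TaylorBound G D α L) (z : Space d) (M : Space d ≃ₗᵢ[ℝ] Space d) :
    TaylorBound (fun s => G (z + M s))
      (fun s => (D (z + M s)).comp (M.toContinuousLinearEquiv : Space d →L[ℝ] Space d)) α L where
  bound s := h.bound _
  deriv_bound s := by
    refine ContinuousLinearMap.opNorm_le_bound _ h.nonneg fun w => ?_
    refine ((D (z + M s)).le_opNorm _).trans ?_
    have : ‖M.toContinuousLinearEquiv w‖ = ‖w‖ := M.norm_map w
    exact mul_le_mul (h.deriv_bound _) this.le (norm_nonneg _) h.nonneg
  taylor s t := by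
    have h1 := h.taylor (z + M s) (z + M t)
    have e : z + M t - (z + M s) = M (t - s) := by rw [map_sub]; abel
    rw [e, M.norm_map] at h1
    exact h1

/-- The bias of the weight `K`, suitably oriented at `x` with precision `δ`, is at most `B` at all
points of the ball of radius `R` around `x`. -/
def SmallBias (𝒢 : Set (Space d → ℝ)) (K : Space d → ℝ) (R δ B : ℝ) : Prop :=
  ∀ g ∈ 𝒢, ∀ x, ∃ θ : Space d, ‖θ‖ = 1 ∧ ∀ M : Space d ≃ₗᵢ[ℝ] Space d,
    ‖M (EuclideanSpace.single 0 1) - θ‖ ≤ δ →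
    ∀ z, ‖z - x‖ ≤ R → |(∫ s, K s * g (z + M s)) - g z| ≤ B

lemma norm_single_one : ‖(EuclideanSpace.single 0 1 : Space d)‖ = 1 := by simp

/-- Take `θ` along the gradient at `x` (any unit vector if it vanishes). Across `θ` the derivative
at `x` is zero. Tilting the axis by `δ` costs `L δ`, and moving the base point to `z` costs `6 L
R^(β-1)` by Hölder continuity of the derivative. -/
lemma exists_gradient_direction {G : Space d → ℝ} {D : Space d → Space d →L[ℝ] ℝ} {β L : ℝ}
    (h : TaylorBound G D β L) (hβ : 1 < β) (hβ2 : β ≤ 2) (x : Space d) {R δ : ℝ} :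
    ∃ θ : Space d, ‖θ‖ = 1 ∧ ∀ M : Space d ≃ₗᵢ[ℝ] Space d,
      ‖M (EuclideanSpace.single 0 1) - θ‖ ≤ δ → ∀ z, ‖z - x‖ ≤ R → ∀ w : Space d,
        |D z (M (restPart w))| ≤ (L * δ + 6 * L * R ^ (β - 1)) * ‖restPart w‖ := by
  have hL := h.nonneg
  obtain ⟨θ, hθ, c, hc0, hc, hD⟩ : ∃ θ : Space d, ‖θ‖ = 1 ∧ ∃ c : ℝ, 0 ≤ c ∧ c ≤ L ∧
      ∀ y, D x y = c * inner ℝ θ y := by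
    set n := (InnerProductSpace.toDual ℝ (Space d)).symm (D x) with hn
    have hDn : ∀ y, D x y = inner ℝ n y := fun y => by
      rw [hn, InnerProductSpace.toDual_symm_apply]
    have hnL : ‖n‖ ≤ L := by
      rw [hn, LinearIsometryEquiv.norm_map]; exact h.deriv_bound x
    rcases eq_or_ne n 0 with h0 | h0
    · refine ⟨EuclideanSpace.single 0 1, norm_single_one, 0, le_rfl, hL, fun y => ?_⟩
      rw [hDn, h0, inner_zero_left, zero_mul]
    · have hpos : 0 < ‖n‖ := norm_pos_iff.2 h0
      refine ⟨‖n‖⁻¹ • n, ?_, ‖n‖, hpos.le, hnL, fun y => ?_⟩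
      · rw [norm_smul, norm_inv, norm_norm, inv_mul_cancel₀ hpos.ne']
      · rw [hDn, real_inner_smul_left, mul_inv_cancel_left₀ hpos.ne']
  refine ⟨θ, hθ, fun M hM z hz w => ?_⟩
  have h1 : |D x (M (restPart w))| ≤ L * δ * ‖restPart w‖ := by
    -- `M (restPart w)` is orthogonal to the image of the first axis, so `θ` may be replaced by its
    -- difference from that image.
    have e : inner ℝ θ (M (restPart w)) =
        inner ℝ (θ - M (EuclideanSpace.single 0 1)) (M (restPart w)) := by
      rw [inner_sub_left, M.inner_map_map, inner_single_restPart, sub_zero]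
    rw [hD, e, abs_mul, abs_of_nonneg hc0, mul_assoc]
    refine mul_le_mul hc ((abs_real_inner_le_norm _ _).trans ?_) (abs_nonneg _) hL
    rw [M.norm_map, norm_sub_rev]
    gcongr
  have h2 : |(D z - D x) (M (restPart w))| ≤ 6 * L * R ^ (β - 1) * ‖restPart w‖ := by
    refine ((D z - D x).le_opNorm _).trans ?_
    rw [M.norm_map]
    gcongr
    exact (h.deriv_holder hβ hβ2 x z).trans (by gcongr)
  rw [sub_apply] at h2
  rw [abs_le] at *
  constructor <;> linarith [h1.1, h1.2, h2.1, h2.2]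

variable {γ β L₁ L₂ L : ℝ}

/-- The bias of step weights. -/
lemma StepOrder.smallBias {r : ℕ} {u v : ℕ → ℝ} (h : StepOrder r u v) (hγ : 1 < γ) (hγ2 : γ ≤ 2)
    (hβ : 1 < β) (hβ2 : β ≤ 2) (hL₁ : 0 ≤ L₁) (hL₂ : 0 ≤ L₂) (hL : 1 ≤ L) (h1 : L₁ ≤ L)
    (h2 : L₂ ≤ L) {R δ : ℝ} (hδ : δ ≤ R ^ (β - 1)) (hR : 0 ≤ R)
    (hu : ∀ i ∈ Finset.Icc 1 r, u i ≤ R) (hv : ∀ j ∈ Finset.Icc 1 r, √d * v j ≤ R) :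
    SmallBias (compositeClass d γ β L₁ L₂) (stepWeight r u v) R δ
      (12 * L ^ 3 * stepBias d γ β (14 * L * R ^ (β - 1)) r u v) := by
  rintro g ⟨f, hf, G, hG, rfl⟩ x
  have tf := (holderClassReal_of_one_lt hγ hγ2 hL₁ hf).mono h1
  have tG := (holderClass_of_one_lt hβ hβ2 hL₂ hG).mono h2
  obtain ⟨θ, hθ, hM⟩ := exists_gradient_direction tG hβ hβ2 x (R := R) (δ := δ)
  refine ⟨θ, hθ, fun M hMθ z hz => ?_⟩
  have hw := hM M hMθ z hz
  have tH := tG.comp_isometry z M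
  have cH := tH.continuous hβ.le
  have cf := tf.continuous hγ.le
  have e : ∫ s, stepWeight r u v s * (f ∘ G) (z + M s) =
      stepInt r u v fun s => f (G (z + M s)) :=
    h.integral_stepWeight_mul (cf.comp cH).measurable (B := L) fun s => tf.bound _
  rw [e]
  -- The constant is `14 = 1 + 6 + 7`: tilt of the axis, shift of the base point, and the variation
  -- of `H` inside the region.
  have key := h.abs_stepInt_sub_le tH tf hL hγ hγ2 hβ (κ := 14 * L * R ^ (β - 1)) (R := R) ?_
    (by positivity) hu hv
  · simpa using key
  · intro s hs1 hs2
    refine (tH.abs_sub_axisPart_le hβ hβ2 (R := R) (η := L * δ + 6 * L * R ^ (β - 1)) ?_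
      hs1 hs2).trans ?_
    · intro w
      simpa using hw w
    · gcongr
      have : L * δ ≤ L * R ^ (β - 1) := by gcongr
      linarith

/-- The bias of box weights adapted to a smooth inner and a rough outer function. -/
lemma smallBias_boxcar_singleIndex (hγ : 0 < γ) (hγ1 : γ ≤ 1) (hβ : 1 < β) (hβ2 : β ≤ 2)
    (hL₁ : 0 ≤ L₁) (hL₂ : 0 ≤ L₂) (hL : 1 ≤ L) (h1 : L₁ ≤ L) (h2 : L₂ ≤ L) {R δ a b : ℝ}
    (hδ : δ ≤ R ^ (β - 1)) (ha : 0 < a) (hb : 0 < b) (haR : a ≤ R)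
    (hbR : √d * b ≤ R) :
    SmallBias (compositeClass d γ β L₁ L₂) (boxcar a b) R δ
      (14 * L ^ 2 * (R ^ (γ * β) + a ^ γ)) := by
  rintro g ⟨f, hf, G, hG, rfl⟩ x
  obtain ⟨bf, tf⟩ := holderClassReal_of_le_one hγ1 hL₁ hf
  have tG := (holderClass_of_one_lt hβ hβ2 hL₂ hG).mono h2
  obtain ⟨θ, hθ, hM⟩ := exists_gradient_direction tG hβ hβ2 x (R := R) (δ := δ)
  refine ⟨θ, hθ, fun M hMθ z hz => ?_⟩
  have hw := hM M hMθ z hz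
  have tH := tG.comp_isometry z M
  have cH := tH.continuous hβ.le
  have cf : Continuous f := continuous_of_modulus hγ tf
  have hR : 0 ≤ R := ha.le.trans haR
  have i1 := isProbabilityMeasure_band le_rfl ha
  have i2 := isProbabilityMeasure_band le_rfl hb
  have : IsProbabilityMeasure (blockMeasure d 0 a 0 b) := by
    unfold blockMeasure; infer_instance
  have cg : Continuous fun s => (f ∘ G) (z + M s) := cf.comp cH
  rw [integral_boxcar_mul ha hb cg.measurable]
  have e : ∫ s, (f ∘ G) (z + M s) ∂blockMeasure d 0 a 0 b - (f ∘ G) z =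
      ∫ s, ((f ∘ G) (z + M s) - (f ∘ G) z) ∂blockMeasure d 0 a 0 b := by
    rw [integral_sub (integrable_of_bound cg (C := L₁) fun s => bf _) (integrable_const _)]
    simp
  rw [e]
  refine abs_integral_le_of_ae ?_
  filter_upwards [ae_blockMeasure (d := d) le_rfl ha le_rfl hb] with s hs
  have hs1 : ‖axisPart s‖ ≤ a := by rw [norm_axisPart]; exact hs.1.2
  have hs2 : ‖restPart s‖ ≤ R := (norm_restPart_le hb.le fun k hk => (hs.2 k hk).2).trans hbR
  have h3 := tH.abs_sub_axisPart_le hβ hβ2 (R := R) (η := L * δ + 6 * L * R ^ (β - 1))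
    (fun w => by simpa using hw w) (hs1.trans haR) hs2
  -- Two legs: across the axis `G` moves by `O(R^β)`, along it by `O(a)`. Applying the `γ`-Hölder
  -- outer function turns these into `R^(γβ)` and `a^γ`.
  have h4 : |G (z + M s) - G (z + M (axisPart s))| ≤ 14 * L * R ^ β := by
    refine h3.trans ?_
    have e2 : R ^ β = R ^ (β - 1) * R := by
      rw [← Real.rpow_add_one' hR (by linarith)]; congr 1; ring
    rw [e2, ← mul_assoc]
    gcongr
    have : L * δ ≤ L * R ^ (β - 1) := by gcongr
    linarith
  have h5 : |G (z + M (axisPart s)) - G z| ≤ 2 * L * a := by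
    have := tH.lipschitz hβ.le 0 (axisPart s)
    simp only [map_zero, add_zero, sub_zero] at this
    exact this.trans (by gcongr)
  have low : ∀ x : ℝ, 1 ≤ x → x ^ γ ≤ x := fun x hx => by
    simpa using Real.rpow_le_rpow_of_exponent_le hx hγ1
  have h6 : |f (G (z + M s)) - f (G (z + M (axisPart s)))| ≤ 14 * L ^ 2 * R ^ (γ * β) := by
    calc _ ≤ L₁ * |G (z + M s) - G (z + M (axisPart s))| ^ γ := tf _ _
      _ ≤ L * (14 * L * R ^ β) ^ γ := by gcongr
      _ = L * ((14 * L) ^ γ * R ^ (γ * β)) := by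
          rw [Real.mul_rpow (by linarith) (by positivity), ← Real.rpow_mul hR, mul_comm β]
      _ ≤ L * (14 * L * R ^ (γ * β)) := by gcongr; exact low _ (by linarith)
      _ = _ := by ring
  have h7 : |f (G (z + M (axisPart s))) - f (G z)| ≤ 14 * L ^ 2 * a ^ γ := by
    calc _ ≤ L₁ * |G (z + M (axisPart s)) - G z| ^ γ := tf _ _
      _ ≤ L * (2 * L * a) ^ γ := by gcongr
      _ = L * ((2 * L) ^ γ * a ^ γ) := by rw [Real.mul_rpow (by linarith) ha.le]
      _ ≤ L * (14 * L * a ^ γ) := by gcongr; exact (low _ (by linarith)).trans (by linarith)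
      _ = _ := by ring
  simp only [Function.comp]
  rw [abs_le] at *
  constructor <;> linarith [h6.1, h6.2, h7.1, h7.2]

/-- The bias of cubic box weights, in terms of the modulus of continuity. -/
lemma smallBias_boxcar_modulus (hγ : 0 < γ) (hγ2 : γ ≤ 2) (hβ : 0 < β) (hβ2 : β ≤ 2)
    (hL₁ : 0 ≤ L₁) (hL₂ : 0 ≤ L₂) (hL : 1 ≤ L) (h1 : L₁ ≤ L) (h2 : L₂ ≤ L) {R δ a : ℝ}
    (ha : 0 < a) :
    SmallBias (compositeClass d γ β L₁ L₂) (boxcar a a) R δ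
      (4 * L ^ 2 * (√d * a) ^ (min 1 γ * min 1 β)) := by
  rintro g hg x
  refine ⟨EuclideanSpace.single 0 1, norm_single_one, fun M _ z _ => ?_⟩
  obtain ⟨bg, mg⟩ := compositeClass_modulus hγ hγ2 hβ2 hL₁ hL₂ hL h1 h2 hg
  have cg := compositeClass_continuous hγ hγ2 hβ hβ2 hL₁ hL₂ hg
  have cH : Continuous fun s => g (z + M s) := cg.comp (continuous_const.add M.continuous)
  have i1 := isProbabilityMeasure_band le_rfl ha
  have : IsProbabilityMeasure (blockMeasure d 0 a 0 a) := by
    unfold blockMeasure; infer_instance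
  rw [integral_boxcar_mul ha ha cH.measurable]
  have e : ∫ s, g (z + M s) ∂blockMeasure d 0 a 0 a - g z =
      ∫ s, (g (z + M s) - g z) ∂blockMeasure d 0 a 0 a := by
    rw [integral_sub (integrable_of_bound cH (C := L) fun s => bg _) (integrable_const _)]
    simp
  rw [e]
  refine abs_integral_le_of_ae ?_
  filter_upwards [ae_blockMeasure (d := d) le_rfl ha le_rfl ha] with s hs
  refine (mg z (z + M s)).trans ?_
  rw [add_sub_cancel_left, M.norm_map]
  have : ‖s‖ ≤ √d * a := norm_le_sqrt_mul ha.le fun k => by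
    by_cases hk : k = 0
    · rw [hk]; exact hs.1.2
    · exact (hs.2 k hk).2
  gcongr

/-- The bias of cubic box weights for smooth outer and inner functions. -/
lemma smallBias_boxcar_smooth (hγ : 1 < γ) (hγ2 : γ ≤ 2) (hβ : 1 < β) (hβγ : β ≤ γ)
    (hL₁ : 0 ≤ L₁) (hL₂ : 0 ≤ L₂) (hL : 1 ≤ L) (h1 : L₁ ≤ L) (h2 : L₂ ≤ L) {R δ a : ℝ}
    (ha : 0 < a) :
    SmallBias (compositeClass d γ β L₁ L₂) (boxcar a a) R δ
      (4 * L ^ 3 * (√d * a) ^ γ + L ^ 2 * (√d * a) ^ β) := by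
  rintro g ⟨f, hf, G, hG, rfl⟩ x
  refine ⟨EuclideanSpace.single 0 1, norm_single_one, fun M _ z _ => ?_⟩
  have tf := (holderClassReal_of_one_lt hγ hγ2 hL₁ hf).mono h1
  have tG := (holderClass_of_one_lt hβ (hβγ.trans hγ2) hL₂ hG).mono h2
  have tH := tG.comp_isometry z M
  have cH : Continuous fun s => f (G (z + M s)) :=
    (tf.continuous hγ.le).comp (tH.continuous hβ.le)
  have i1 := isProbabilityMeasure_band le_rfl ha
  have : IsProbabilityMeasure (blockMeasure d 0 a 0 a) := by
    unfold blockMeasure; infer_instance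
  have e := integral_boxcar_mul (d := d) ha ha cH.measurable
  simp only [Function.comp]
  rw [e]
  refine abs_integral_sub_le_of_flip (σ := fun s => -s) (C := L) cH continuous_neg
    (fun s => tf.bound _) ?_ ?_
  -- The reflection is the central one here: the cube is symmetric and no axis plays a special role.
  · have hneg : (fun s : Space d => -s) = coordMap (fun t => -t) (fun t => -t) := by
      ext s k; simp [coordMap]
    have := integral_prodMeasure_coordMap (d := d) (μ := band 0 a) (ν := band 0 a)
      measurable_neg measurable_neg cH
    rw [show (band 0 a).map Neg.neg = band 0 a from band_map_neg] at this
    refine Eq.trans ?_ this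
    rw [show (Neg.neg : ℝ → ℝ) = fun t => -t from rfl, ← hneg]
    rfl
  filter_upwards [ae_blockMeasure (d := d) le_rfl ha le_rfl ha] with s hs
  have hs' : ‖s‖ ≤ √d * a := norm_le_sqrt_mul ha.le fun k => by
    by_cases hk : k = 0
    · rw [hk]; exact hs.1.2
    · exact (hs.2 k hk).2
  have h3 := symm_axis_le tH tf hL (by linarith) hγ2 hβ.le s
  simp only [map_zero, add_zero] at h3
  refine h3.trans ?_
  gcongr

variable {d : ℕ} [NeZero d]

/-! ### Norms of weights -/

/-- Basic properties of a weight: support in the ball of radius `R`, unit integral, `L₁`-norm at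
most `N`, `L₂`-norm between `A` and `B`. -/
structure WeightBounds (K : Space d → ℝ) (R N A B : ℝ) : Prop where
  measurable : Measurable K
  bounded : ∃ C, ∀ y, |K y| ≤ C
  support : ∀ y, K y ≠ 0 → ‖y‖ ≤ R
  integrable : Integrable K
  integral_eq_one : ∫ y, K y = 1
  normOne_le : normOne K ≤ N
  le_normTwo : A ≤ normTwo K
  normTwo_le : normTwo K ≤ B

/-- Adjacent bands share an end point. The strict inequality lets an indicator separate neighbouring
blocks almost surely. -/
lemma ae_band_lt (a b : ℝ) : ∀ᵐ t ∂band a b, a < |t| ∧ |t| ≤ b := by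
  have h1 : ∀ᵐ t ∂(volume : Measure ℝ), |t| ≠ a := by
    refine measure_mono_null (t := {a, -a}) ?_ (Set.Finite.measure_zero (by simp) _)
    intro t ht
    simp only [Set.mem_compl_iff, Set.mem_ofPred_eq, ne_eq, not_not] at ht
    rcases abs_choice t with h | h
    · left; linarith
    · right; simp; linarith
  have h2 : band a b ≪ volume := cond_absolutelyContinuous
  filter_upwards [ae_band a b, h2.ae_le h1] with t ht hne
  exact ⟨lt_of_le_of_ne ht.1 (Ne.symm hne), ht.2⟩

lemma ae_blockMeasure_lt {a b c e : ℝ} (ha : 0 ≤ a) (hab : a < b) (hc : 0 ≤ c) (hce : c < e) :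
    ∀ᵐ s ∂blockMeasure d a b c e, (a < |s 0| ∧ |s 0| ≤ b) ∧
      ∀ k, k ≠ 0 → c < |s k| ∧ |s k| ≤ e := by
  have := isProbabilityMeasure_band ha hab
  have := isProbabilityMeasure_band hc hce
  exact ae_prodMeasure (ae_band_lt a b) (ae_band_lt c e)

lemma boxIndicator_mem (a b c e : ℝ) (y : Space d) :
    boxIndicator a b c e y = 0 ∨ boxIndicator a b c e y = 1 := by
  unfold boxIndicator; split_ifs <;> simp

lemma mem_of_boxIndicator_ne_zero {a b c e : ℝ} {y : Space d} (h : boxIndicator a b c e y ≠ 0) :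
    (a ≤ |y 0| ∧ |y 0| ≤ b) ∧ ∀ k : Fin d, k ≠ 0 → c ≤ |y k| ∧ |y k| ≤ e := by
  by_contra hc
  exact h (if_neg hc)

lemma abs_boxIndicator_le (a b c e : ℝ) (y : Space d) : |boxIndicator a b c e y| ≤ 1 := by
  rcases boxIndicator_mem a b c e y with h | h <;> rw [h] <;> simp

lemma boxMean_nonneg {a b c e : ℝ} (hab : a ≤ b) (hce : c ≤ e) (y : Space d) :
    0 ≤ boxMean a b c e y := by
  unfold boxMean
  have h1 : 0 ≤ b - a := by linarith
  have h2 : 0 ≤ e - c := by linarith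
  rcases boxIndicator_mem a b c e y with h | h <;> rw [h] <;> positivity

lemma boxMean_le {a b c e : ℝ} (hab : a ≤ b) (hce : c ≤ e) (y : Space d) :
    |boxMean a b c e y| ≤ ((b - a) * (e - c) ^ (d - 1))⁻¹ := by
  have h1 : 0 ≤ b - a := by linarith
  have h2 : 0 ≤ e - c := by linarith
  rw [abs_of_nonneg (boxMean_nonneg hab hce y)]
  unfold boxMean
  rcases boxIndicator_mem a b c e y with h | h <;> rw [h]
  · rw [mul_zero]; positivity
  · rw [mul_one]

lemma integrable_boxMean {a b c e : ℝ} (ha : 0 ≤ a) (hab : a < b) (hc : 0 ≤ c) (hce : c < e) :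
    Integrable (boxMean a b c e : Space d → ℝ) := by
  simpa using integrable_boxMean_mul (d := d) ha hab hc hce (F := fun _ => 1) measurable_const
    (B := 1) (by simp)

lemma integral_abs_boxMean {a b c e : ℝ} (ha : 0 ≤ a) (hab : a < b) (hc : 0 ≤ c) (hce : c < e) :
    ∫ y : Space d, |boxMean a b c e y| = 2 ^ d := by
  have h1 := integral_boxMean_mul (d := d) ha hab hc hce (F := fun _ => 1) measurable_const
  have := isProbabilityMeasure_band ha hab
  have := isProbabilityMeasure_band hc hce
  have : IsProbabilityMeasure (blockMeasure d a b c e) := by unfold blockMeasure; infer_instance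
  simp only [mul_one, integral_const, probReal_univ, smul_eq_mul] at h1
  rw [← h1]
  exact integral_congr_ae (Eventually.of_forall fun y =>
    abs_of_nonneg (boxMean_nonneg hab.le hce.le y))

lemma integral_boxMean_sq {a b c e : ℝ} (ha : 0 ≤ a) (hab : a < b) (hc : 0 ≤ c) (hce : c < e) :
    ∫ y : Space d, boxMean a b c e y ^ 2 = 2 ^ d * ((b - a) * (e - c) ^ (d - 1))⁻¹ := by
  have h1 := integral_boxMean_mul (d := d) ha hab hc hce (measurable_boxMean a b c e)
  have := isProbabilityMeasure_band ha hab
  have := isProbabilityMeasure_band hc hce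
  have : IsProbabilityMeasure (blockMeasure d a b c e) := by unfold blockMeasure; infer_instance
  simp only [← sq] at h1
  rw [h1]
  congr 1
  have : ∀ᵐ y ∂blockMeasure d a b c e,
      boxMean a b c e y = ((b - a) * (e - c) ^ (d - 1))⁻¹ := by
    filter_upwards [ae_blockMeasure ha hab hc hce] with y hy
    unfold boxMean boxIndicator
    rw [if_pos hy, mul_one]
  rw [integral_congr_ae this]
  simp

omit [NeZero d] in
lemma normTwo_eq_eLpNorm {K : Space d → ℝ} (hK : MemLp K 2) :
    normTwo K = (eLpNorm K 2).toReal := by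
  rw [normTwo, hK.eLpNorm_eq_integral_rpow_norm (by simp) (by simp), ENNReal.toReal_ofReal (by positivity)]
  simp only [ENNReal.toReal_ofNat, Real.rpow_two, Real.norm_eq_abs, sq_abs]
  rw [Real.sqrt_eq_rpow]; norm_num

omit [NeZero d] in
lemma memLp_two_of_bounded {K : Space d → ℝ} (hK : Integrable K) {C : ℝ} (hb : ∀ y, |K y| ≤ C) :
    MemLp K 2 := by
  rw [memLp_two_iff_integrable_sq hK.aestronglyMeasurable]
  have := hK.mul_bdd (c := C) hK.aestronglyMeasurable (Eventually.of_forall hb)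
  simpa only [sq] using this

omit [NeZero d] in
lemma WeightBounds.memLp {K : Space d → ℝ} {R N A B : ℝ} (h : WeightBounds K R N A B) :
    MemLp K 2 := by
  obtain ⟨C, hC⟩ := h.bounded
  exact memLp_two_of_bounded h.integrable hC

lemma memLp_boxMean {a b c e : ℝ} (ha : 0 ≤ a) (hab : a < b) (hc : 0 ≤ c) (hce : c < e) :
    MemLp (boxMean a b c e : Space d → ℝ) 2 :=
  memLp_two_of_bounded (integrable_boxMean ha hab hc hce) (boxMean_le hab.le hce.le)

lemma eLpNorm_boxMean {a b c e : ℝ} (ha : 0 ≤ a) (hab : a < b) (hc : 0 ≤ c) (hce : c < e) :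
    eLpNorm (boxMean a b c e : Space d → ℝ) 2 =
      ENNReal.ofReal √(2 ^ d * ((b - a) * (e - c) ^ (d - 1))⁻¹) := by
  have h := memLp_boxMean (d := d) ha hab hc hce
  rw [← ENNReal.ofReal_toReal h.eLpNorm_ne_top, ← normTwo_eq_eLpNorm h, normTwo,
    integral_boxMean_sq ha hab hc hce]

lemma normTwo_boxcar {h₁ h₂ : ℝ} (hh₁ : 0 < h₁) (hh₂ : 0 < h₂) :
    normTwo (boxcar h₁ h₂ : Space d → ℝ) = √((2 ^ d * (h₁ * h₂ ^ (d - 1)))⁻¹) := by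
  rw [normTwo, boxcar_eq]
  simp only [mul_pow]
  rw [integral_const_mul, integral_boxMean_sq le_rfl hh₁ le_rfl hh₂]
  congr 1
  rw [sub_zero, sub_zero, mul_inv]
  field_simp

lemma weightBounds_boxcar {h₁ h₂ R : ℝ} (hh₁ : 0 < h₁) (hh₂ : 0 < h₂) (h1 : h₁ ≤ R)
    (h2 : h₂ ≤ R) :
    WeightBounds (boxcar h₁ h₂ : Space d → ℝ) (√d * R) 1
      √((2 ^ d * (h₁ * h₂ ^ (d - 1)))⁻¹) √((2 ^ d * (h₁ * h₂ ^ (d - 1)))⁻¹) where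
  measurable := by
    rw [boxcar_eq]; exact (measurable_boxMean _ _ _ _).const_mul _
  bounded := by
    rw [boxcar_eq]
    refine ⟨|(2 ^ d)⁻¹| * ((h₁ - 0) * (h₂ - 0) ^ (d - 1))⁻¹, fun y => ?_⟩
    rw [abs_mul]
    exact mul_le_mul_of_nonneg_left (boxMean_le hh₁.le hh₂.le y) (abs_nonneg _)
  support y hy := by
    have hc := mem_of_boxIndicator_ne_zero (right_ne_zero_of_mul hy)
    refine norm_le_sqrt_mul (hh₁.le.trans h1) fun k => ?_
    by_cases hk : k = 0
    · rw [hk]; exact hc.1.2.trans h1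
    · exact (hc.2 k hk).2.trans h2
  integrable := by
    rw [boxcar_eq]; exact (integrable_boxMean le_rfl hh₁ le_rfl hh₂).const_mul _
  integral_eq_one := by
    have := integral_boxcar_mul (d := d) hh₁ hh₂ (F := fun _ => 1) measurable_const
    have := isProbabilityMeasure_band le_rfl hh₁
    have := isProbabilityMeasure_band le_rfl hh₂
    have : IsProbabilityMeasure (blockMeasure d 0 h₁ 0 h₂) := by
      unfold blockMeasure; infer_instance
    simp_all
  normOne_le := by
    rw [normOne, boxcar_eq]
    simp only [abs_mul]
    rw [integral_const_mul, integral_abs_boxMean le_rfl hh₁ le_rfl hh₂, abs_of_pos (by positivity),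
      inv_mul_cancel₀ (by positivity)]
  le_normTwo := (normTwo_boxcar hh₁ hh₂).ge
  normTwo_le := (normTwo_boxcar hh₁ hh₂).le

/-- Testing a weight against the indicator of a box bounds its `L₂`-norm from below. -/
lemma le_normTwo_of_integral_box {K : Space d → ℝ} (hK : Integrable K) {C : ℝ}
    (hb : ∀ y, |K y| ≤ C) {a b : ℝ} (ha : 0 < a) (hbp : 0 < b)
    (h : ∫ y, K y * boxIndicator 0 a 0 b y = 1) :
    √((2 ^ d * (a * b ^ (d - 1)))⁻¹) ≤ normTwo K := by
  have hm2 := memLp_two_of_bounded hK hb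
  have hB := (weightBounds_boxcar (d := d) ha hbp (le_max_left a b) (le_max_right a b))
  have hB2 := hB.memLp
  set w := (2 ^ d * (a * b ^ (d - 1)))⁻¹ with hw
  have e : ∀ y : Space d, boxcar a b y = w * boxIndicator 0 a 0 b y := by
    intro y
    rw [boxcar_eq]
    simp only [boxMean, sub_zero, hw, mul_inv]
    ring
  have h1 : ∫ y, K y * boxcar a b y = w := by
    have e2 : ∀ y, K y * boxcar a b y = w * (K y * boxIndicator 0 a 0 b y) := fun y => by
      rw [e]; ring
    simp only [e2]
    rw [integral_const_mul, h, mul_one]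
  have h2 : ∫ y : Space d, boxcar a b y ^ 2 = w := by
    have := normTwo_boxcar (d := d) ha hbp
    rw [normTwo, Real.sqrt_inj (by positivity) (by positivity)] at this
    exact this
  have i1 := hm2.integrable_sq
  have i2 := hB2.integrable_sq
  have i3 : Integrable (fun y => K y * boxcar a b y) := hm2.integrable_mul hB2
  -- Cauchy–Schwarz in disguise: the normalized indicator has inner product `w` with `K` and squared
  -- norm `w`, so `∫ K² - w` is the integral of a square.
  have h3 : 0 ≤ ∫ y, (K y - boxcar a b y) ^ 2 := integral_nonneg fun y => sq_nonneg _
  have h4 : ∫ y, (K y - boxcar a b y) ^ 2 = (∫ y, K y ^ 2) - 2 * w + w := by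
    have e3 : ∀ y, (K y - boxcar a b y) ^ 2 =
        K y ^ 2 - 2 * (K y * boxcar a b y) + boxcar a b y ^ 2 := fun y => by ring
    simp only [e3]
    have i4 : Integrable (fun y => K y ^ 2 - 2 * (K y * boxcar a b y)) := i1.sub (i3.const_mul 2)
    rw [integral_add i4 i2, integral_sub i1 (i3.const_mul 2), integral_const_mul, h1, h2]
  exact Real.sqrt_le_sqrt (by linarith)

/-! ### Norms of step weights -/

section Step

variable {r : ℕ} {u v : ℕ → ℝ}

/-- The normalized indicator of the block with indices `i` and `j`. -/
def stepMean (u v : ℕ → ℝ) (i j : ℕ) : Space d → ℝ :=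
  boxMean (if i = 1 then 0 else u (i - 1)) (u i) (v (j + 1)) (v j)

/-- The volume of the block with indices `i` and `j`, up to the factor `2 ^ d`. -/
def stepVol (d : ℕ) (u v : ℕ → ℝ) (i j : ℕ) : ℝ :=
  (u i - if i = 1 then 0 else u (i - 1)) * (v j - v (j + 1)) ^ (d - 1)

/-- The bound on the `L₂`-norm of a step weight that is obtained by adding up its blocks. -/
def stepNorm (d : ℕ) (r : ℕ) (u v : ℕ → ℝ) : ℝ :=
  √(stepVol d u v 1 1)⁻¹ +
    ∑ i ∈ Finset.Icc 2 r, (√(stepVol d u v i i)⁻¹ + √(stepVol d u v i (i - 1))⁻¹)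

lemma stepWeight_eq (r : ℕ) (u v : ℕ → ℝ) :
    (stepWeight r u v : Space d → ℝ) = fun y => (2 ^ d)⁻¹ * (stepMean u v 1 1 y +
      ∑ i ∈ Finset.Icc 2 r, (stepMean u v i i y - stepMean u v i (i - 1) y)) := by
  ext y
  unfold stepWeight stepMean
  congr 2
  refine Finset.sum_congr rfl fun i hi => ?_
  simp only [Finset.mem_Icc] at hi
  rw [if_neg (by omega), show i - 1 + 1 = i by omega]

/-- The admissible parameters of the block with indices `i` and `j`. -/
lemma StepOrder.block (h : StepOrder r u v) {i j : ℕ} (hi : i ∈ Finset.Icc 1 r)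
    (hj : j ∈ Finset.Icc 1 r) :
    0 ≤ (if i = 1 then 0 else u (i - 1)) ∧ (if i = 1 then 0 else u (i - 1)) < u i ∧
      0 ≤ v (j + 1) ∧ v (j + 1) < v j :=
  ⟨(h.low hi).1, (h.low hi).2, h.v_nonneg _ (by simp only [Finset.mem_Icc] at *; omega), h.v_lt j hj⟩

lemma StepOrder.integrable_stepMean (h : StepOrder r u v) {i j : ℕ} (hi : i ∈ Finset.Icc 1 r)
    (hj : j ∈ Finset.Icc 1 r) : Integrable (stepMean u v i j : Space d → ℝ) := by
  obtain ⟨h0, h1, h2, h3⟩ := h.block hi hj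
  exact integrable_boxMean h0 h1 h2 h3

lemma StepOrder.integrable_stepWeight (h : StepOrder r u v) :
    Integrable (stepWeight r u v : Space d → ℝ) := by
  rw [stepWeight_eq]
  exact ((h.integrable_stepMean h.one_mem h.one_mem).add (integrable_finsetSum _ fun i hi =>
    (h.integrable_stepMean (h.mem hi).1 (h.mem hi).1).sub
      (h.integrable_stepMean (h.mem hi).1 (h.mem hi).2))).const_mul _

lemma StepOrder.bounded_stepWeight (h : StepOrder r u v) :
    ∃ C, ∀ y : Space d, |stepWeight r u v y| ≤ C := by
  have key : ∀ i ∈ Finset.Icc 1 r, ∀ j ∈ Finset.Icc 1 r, ∀ y : Space d,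
      |stepMean u v i j y| ≤ (stepVol d u v i j)⁻¹ := by
    intro i hi j hj y
    obtain ⟨h0, h1, h2, h3⟩ := h.block hi hj
    exact boxMean_le h1.le h3.le y
  refine ⟨|((2 : ℝ) ^ d)⁻¹| * ((stepVol d u v 1 1)⁻¹ + ∑ i ∈ Finset.Icc 2 r,
    ((stepVol d u v i i)⁻¹ + (stepVol d u v i (i - 1))⁻¹)), fun y => ?_⟩
  rw [stepWeight_eq, abs_mul]
  refine mul_le_mul_of_nonneg_left ((abs_add_le _ _).trans (add_le_add
    (key 1 h.one_mem 1 h.one_mem y) ((Finset.abs_sum_le_sum_abs _ _).trans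
      (Finset.sum_le_sum fun i hi => (abs_sub _ _).trans (add_le_add ?_ ?_))))) (abs_nonneg _)
  · exact key i (h.mem hi).1 i (h.mem hi).1 y
  · exact key i (h.mem hi).1 (i - 1) (h.mem hi).2 y

/-- The weight is a signed sum of `2 r - 1` blocks of mass one. When `r` grows with `λ` this bound
is what produces the logarithmic factor in `𝒫₂`. -/
lemma StepOrder.normOne_stepWeight_le (h : StepOrder r u v) :
    normOne (stepWeight r u v : Space d → ℝ) ≤ 2 * r := by
  have key : ∀ i ∈ Finset.Icc 1 r, ∀ j ∈ Finset.Icc 1 r,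
      ∫ y : Space d, |stepMean u v i j y| = 2 ^ d := by
    intro i hi j hj
    obtain ⟨h0, h1, h2, h3⟩ := h.block hi hj
    exact integral_abs_boxMean h0 h1 h2 h3
  have i1 := h.integrable_stepMean (d := d) h.one_mem h.one_mem
  have i2 : ∀ i ∈ Finset.Icc 2 r, Integrable fun y : Space d =>
      |stepMean u v i i y| + |stepMean u v i (i - 1) y| := fun i hi =>
    (h.integrable_stepMean (h.mem hi).1 (h.mem hi).1).abs.add
      (h.integrable_stepMean (h.mem hi).1 (h.mem hi).2).abs
  calc normOne (stepWeight r u v : Space d → ℝ)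
      ≤ ∫ y : Space d, (2 ^ d)⁻¹ * (|stepMean u v 1 1 y| + ∑ i ∈ Finset.Icc 2 r,
          (|stepMean u v i i y| + |stepMean u v i (i - 1) y|)) := by
        refine integral_mono h.integrable_stepWeight.abs
          ((i1.abs.add (integrable_finsetSum _ i2)).const_mul _) fun y => ?_
        rw [stepWeight_eq]
        simp only [abs_mul]
        rw [abs_of_pos (by positivity : (0 : ℝ) < (2 ^ d)⁻¹)]
        refine mul_le_mul_of_nonneg_left ((abs_add_le _ _).trans (add_le_add le_rfl
          ((Finset.abs_sum_le_sum_abs _ _).trans (Finset.sum_le_sum fun i hi => abs_sub _ _))))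
          (by positivity)
    _ = (2 ^ d)⁻¹ * (2 ^ d + ∑ i ∈ Finset.Icc 2 r, (2 ^ d + 2 ^ d)) := by
        rw [integral_const_mul, integral_add i1.abs (integrable_finsetSum _ i2),
          integral_finsetSum _ i2, key 1 h.one_mem 1 h.one_mem]
        congr 2
        refine Finset.sum_congr rfl fun i hi => ?_
        rw [integral_add (h.integrable_stepMean (h.mem hi).1 (h.mem hi).1).abs
          (h.integrable_stepMean (h.mem hi).1 (h.mem hi).2).abs,
          key i (h.mem hi).1 i (h.mem hi).1, key i (h.mem hi).1 (i - 1) (h.mem hi).2]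
    _ = 1 + (r - 1) * 2 := by
        rw [Finset.sum_const, Nat.card_Icc, nsmul_eq_mul]
        have : ((r + 1 - 2 : ℕ) : ℝ) = r - 1 := by
          rw [Nat.cast_sub (by have := h.two_le; omega)]; push_cast; ring
        rw [this]
        field_simp
        ring
    _ ≤ 2 * r := by linarith

lemma StepOrder.normTwo_stepWeight_le (h : StepOrder r u v) :
    normTwo (stepWeight r u v : Space d → ℝ) ≤ stepNorm d r u v := by
  have key : ∀ i ∈ Finset.Icc 1 r, ∀ j ∈ Finset.Icc 1 r,
      eLpNorm (stepMean u v i j : Space d → ℝ) 2 ≤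
        ENNReal.ofReal (2 ^ d * √(stepVol d u v i j)⁻¹) := by
    intro i hi j hj
    obtain ⟨h0, h1, h2, h3⟩ := h.block hi hj
    -- The factor `√(2 ^ d)` is enlarged to `2 ^ d` so that it cancels against the normalization of
    -- the weight.
    refine (eLpNorm_boxMean h0 h1 h2 h3).le.trans (ENNReal.ofReal_le_ofReal ?_)
    rw [Real.sqrt_mul (by positivity)]
    refine mul_le_mul_of_nonneg_right ?_ (Real.sqrt_nonneg _)
    rw [Real.sqrt_le_left (by positivity)]
    exact le_self_pow₀ (one_le_pow₀ (by norm_num)) two_ne_zero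
  have meas : ∀ i ∈ Finset.Icc 1 r, ∀ j ∈ Finset.Icc 1 r,
      AEStronglyMeasurable (stepMean u v i j : Space d → ℝ) :=
    fun i hi j hj => (h.integrable_stepMean hi hj).aestronglyMeasurable
  obtain ⟨C, hC⟩ := h.bounded_stepWeight (d := d)
  rw [normTwo_eq_eLpNorm (memLp_two_of_bounded h.integrable_stepWeight hC)]
  refine ENNReal.toReal_le_of_le_ofReal ?_ ?_
  · unfold stepNorm; positivity
  rw [stepWeight_eq]
  have e : (fun y : Space d => ((2 : ℝ) ^ d)⁻¹ * (stepMean u v 1 1 y +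
      ∑ i ∈ Finset.Icc 2 r, (stepMean u v i i y - stepMean u v i (i - 1) y))) =
      ((2 : ℝ) ^ d)⁻¹ • (stepMean u v 1 1 +
        ∑ i ∈ Finset.Icc 2 r, (stepMean u v i i - stepMean u v i (i - 1))) := by
    ext y; simp
  have msum : ∀ i ∈ Finset.Icc 2 r, AEStronglyMeasurable
      (stepMean u v i i - stepMean u v i (i - 1) : Space d → ℝ) := fun i hi =>
    (meas i (h.mem hi).1 i (h.mem hi).1).sub (meas i (h.mem hi).1 (i - 1) (h.mem hi).2)
  rw [e, eLpNorm_const_smul]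
  calc _ ≤ ‖((2 : ℝ) ^ d)⁻¹‖ₑ * (ENNReal.ofReal (2 ^ d * √(stepVol d u v 1 1)⁻¹) +
        ∑ i ∈ Finset.Icc 2 r, (ENNReal.ofReal (2 ^ d * √(stepVol d u v i i)⁻¹) +
          ENNReal.ofReal (2 ^ d * √(stepVol d u v i (i - 1))⁻¹))) := by
        gcongr
        refine (eLpNorm_add_le (meas 1 h.one_mem 1 h.one_mem)
          (Finset.aestronglyMeasurable_sum _ msum) (by norm_num)).trans
          (add_le_add (key 1 h.one_mem 1 h.one_mem) ?_)
        refine (eLpNorm_sum_le msum (by norm_num)).trans (Finset.sum_le_sum fun i hi => ?_)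
        refine (eLpNorm_sub_le (meas i (h.mem hi).1 i (h.mem hi).1)
          (meas i (h.mem hi).1 (i - 1) (h.mem hi).2) (by norm_num)).trans (add_le_add ?_ ?_)
        · exact key i (h.mem hi).1 i (h.mem hi).1
        · exact key i (h.mem hi).1 (i - 1) (h.mem hi).2
    _ = ENNReal.ofReal (stepNorm d r u v) := by
        rw [Finset.sum_congr rfl fun i _ => (ENNReal.ofReal_add (by positivity)
          (by positivity)).symm, ← ENNReal.ofReal_sum_of_nonneg (by intros; positivity),
          ← ENNReal.ofReal_add (by positivity) (Finset.sum_nonneg (by intros; positivity)),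
          Real.enorm_eq_ofReal (by positivity), ← ENNReal.ofReal_mul (by positivity)]
        congr 1
        simp only [← mul_add, ← Finset.mul_sum]
        rw [inv_mul_cancel_left₀ (by positivity)]
        rfl

lemma integral_boxIndicator_eq {m : Measure (Space d)} [IsProbabilityMeasure m] {a b c e t : ℝ}
    (h : ∀ᵐ y ∂m, boxIndicator a b c e y = t) : ∫ y, boxIndicator a b c e y ∂m = t := by
  rw [integral_congr_ae h]; simp

lemma measurable_boxIndicator (a b c e : ℝ) : Measurable (boxIndicator a b c e : Space d → ℝ) := by
  have h : (boxIndicator a b c e : Space d → ℝ) = fun y =>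
      (blockSet d a b c e).indicator 1 (WithLp.ofLp y) := by
    ext y
    rw [← boxIndicator_eq]
  rw [h]
  exact (measurable_one.indicator (measurableSet_blockSet a b c e)).comp
    (PiLp.volume_preserving_ofLp (Fin d)).measurable

lemma boxIndicator_of_axis_lt {a b c e : ℝ} {y : Space d} (h : b < |y 0|) :
    boxIndicator a b c e y = 0 := by
  unfold boxIndicator
  rw [if_neg fun hy => absurd hy.1.2 (not_le.2 h)]

lemma boxIndicator_of_rest_lt {a b c e : ℝ} {y : Space d} {k : Fin d} (hk : k ≠ 0)
    (h : e < |y k|) : boxIndicator a b c e y = 0 := by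
  unfold boxIndicator
  rw [if_neg fun hy => absurd (hy.2 k hk).2 (not_le.2 h)]

lemma StepOrder.u_mono (h : StepOrder r u v) {i j : ℕ} (hi : 1 ≤ i) (hij : i ≤ j) (hj : j ≤ r) :
    u i ≤ u j := by
  induction j, hij using Nat.le_induction with
  | base => exact le_rfl
  | succ n hn ih =>
    have := h.u_lt (n + 1) (by simp; omega)
    simp only [Nat.add_sub_cancel] at this
    exact (ih (by omega)).trans this.le

lemma StepOrder.v_anti (h : StepOrder r u v) {i j : ℕ} (hi : 1 ≤ i) (hij : i ≤ j) (hj : j ≤ r + 1) :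
    v j ≤ v i := by
  induction j, hij using Nat.le_induction with
  | base => exact le_rfl
  | succ n hn ih =>
    have := h.v_lt n (by simp; omega)
    exact this.le.trans (ih (by omega))

/-- The lower bound on the `L₂`-norm from the first block. -/
lemma StepOrder.le_normTwo_first (h : StepOrder r u v) :
    √((2 ^ d * (u 1 * v 1 ^ (d - 1)))⁻¹) ≤ normTwo (stepWeight r u v : Space d → ℝ) := by
  obtain ⟨C, hC⟩ := h.bounded_stepWeight (d := d)
  have hv1 : 0 < v 1 := lt_of_le_of_lt
    (h.v_nonneg 2 (by have := h.two_le; simp; omega)) (h.v_lt 1 h.one_mem)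
  refine le_normTwo_of_integral_box h.integrable_stepWeight hC (h.u_pos 1 h.one_mem) hv1 ?_
  rw [h.integral_stepWeight_mul (measurable_boxIndicator _ _ _ _) (abs_boxIndicator_le 0 (u 1) 0 (v 1))]
  unfold stepInt
  -- All blocks with `i ≥ 2` have first coordinate beyond `u 1`, so the test indicator sees the
  -- block `(1, 1)` alone.
  have z : ∀ i ∈ Finset.Icc 2 r, ∀ j ∈ Finset.Icc 1 r,
      ∫ y, boxIndicator 0 (u 1) 0 (v 1) y ∂stepBlock d u v i j = 0 := by
    intro i hi j hj
    have := h.isProbabilityMeasure (d := d) (h.mem hi).1 hj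
    refine integral_boxIndicator_eq ?_
    obtain ⟨h0, h1, h2, h3⟩ := h.block (h.mem hi).1 hj
    filter_upwards [ae_blockMeasure_lt h0 h1 h2 h3] with y hy
    refine boxIndicator_of_axis_lt (lt_of_le_of_lt ?_ hy.1.1)
    simp only [Finset.mem_Icc] at hi
    rw [if_neg (by omega)]
    exact h.u_mono le_rfl (by omega) (by omega)
  rw [Finset.sum_eq_zero fun i hi => by
    rw [z i hi i (h.mem hi).1, z i hi (i - 1) (h.mem hi).2, sub_zero], add_zero]
  have := h.isProbabilityMeasure (d := d) h.one_mem h.one_mem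
  refine integral_boxIndicator_eq ?_
  filter_upwards [h.ae_mem h.one_mem h.one_mem] with y hy
  unfold boxIndicator
  exact if_pos ⟨⟨abs_nonneg _, hy.1.2⟩, fun k hk => ⟨abs_nonneg _, (hy.2 k hk).2⟩⟩

/-- The lower bound on the `L₂`-norm from the last block. -/
lemma StepOrder.le_normTwo_last (h : StepOrder r u v) (hd : 2 ≤ d) :
    √((2 ^ d * (u r * v r ^ (d - 1)))⁻¹) ≤ normTwo (stepWeight r u v : Space d → ℝ) := by
  obtain ⟨C, hC⟩ := h.bounded_stepWeight (d := d)
  have h2r := h.two_le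
  have hvr : 0 < v r := lt_of_le_of_lt (h.v_nonneg (r + 1) (by simp)) (h.v_lt r h.last_mem)
  refine le_normTwo_of_integral_box h.integrable_stepWeight hC (h.u_pos r h.last_mem) hvr ?_
  rw [h.integral_stepWeight_mul (measurable_boxIndicator _ _ _ _) (abs_boxIndicator_le 0 (u r) 0 (v r))]
  -- A block with `j < r` has its transversal coordinates beyond `v r`. For `d ≥ 2` there is such a
  -- coordinate, so only the block `(r, r)` is seen.
  have z : ∀ i ∈ Finset.Icc 1 r, ∀ j ∈ Finset.Icc 1 r, j < r →
      ∫ y, boxIndicator 0 (u r) 0 (v r) y ∂stepBlock d u v i j = 0 := by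
    intro i hi j hj hjr
    have := h.isProbabilityMeasure (d := d) hi hj
    refine integral_boxIndicator_eq ?_
    obtain ⟨h0, h1, h2, h3⟩ := h.block hi hj
    filter_upwards [ae_blockMeasure_lt h0 h1 h2 h3] with y hy
    have hk : (⟨1, by omega⟩ : Fin d) ≠ 0 := by
      intro he
      have := congrArg Fin.val he
      simp at this
    refine boxIndicator_of_rest_lt hk (lt_of_le_of_lt ?_ (hy.2 _ hk).1)
    exact h.v_anti (by omega) (by omega) (by omega)
  have one : ∫ y, boxIndicator 0 (u r) 0 (v r) y ∂stepBlock d u v r r = 1 := by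
    have := h.isProbabilityMeasure (d := d) h.last_mem h.last_mem
    refine integral_boxIndicator_eq ?_
    filter_upwards [h.ae_mem h.last_mem h.last_mem] with y hy
    unfold boxIndicator
    exact if_pos ⟨⟨abs_nonneg _, hy.1.2⟩, fun k hk => ⟨abs_nonneg _, (hy.2 k hk).2⟩⟩
  unfold stepInt
  rw [z 1 h.one_mem 1 h.one_mem (by omega), zero_add,
    Finset.sum_eq_single_of_mem r (by simp; omega), one,
    z r h.last_mem (r - 1) (by simp; omega) (by omega), sub_zero]
  intro i hi hir
  have hi' := hi
  simp only [Finset.mem_Icc] at hi'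
  rw [z i (h.mem hi).1 i (h.mem hi).1 (by omega),
    z i (h.mem hi).1 (i - 1) (h.mem hi).2 (by omega), sub_zero]

lemma StepOrder.weightBounds (h : StepOrder r u v) {R A B : ℝ}
    (hu : ∀ i ∈ Finset.Icc 1 r, u i ≤ R) (hv : ∀ j ∈ Finset.Icc 1 r, v j ≤ R)
    (hA : A ≤ normTwo (stepWeight r u v : Space d → ℝ)) (hB : stepNorm d r u v ≤ B) :
    WeightBounds (stepWeight r u v : Space d → ℝ) (√d * R) (2 * r) A B where
  measurable := by
    rw [stepWeight_eq]
    refine Measurable.const_mul (Measurable.add (measurable_boxMean _ _ _ _)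
      (Finset.measurable_fun_sum _ fun i _ => ?_)) _
    exact (measurable_boxMean _ _ _ _).sub (measurable_boxMean _ _ _ _)
  bounded := h.bounded_stepWeight
  support y hy := by
    have key : ∀ i ∈ Finset.Icc 1 r, ∀ j ∈ Finset.Icc 1 r, stepMean u v i j y ≠ 0 →
        ‖y‖ ≤ √d * R := by
      intro i hi j hj hne
      have hc := mem_of_boxIndicator_ne_zero (right_ne_zero_of_mul hne)
      refine norm_le_sqrt_mul ((h.u_pos i hi).le.trans (hu i hi)) fun k => ?_
      by_cases hk : k = 0
      · rw [hk]; exact hc.1.2.trans (hu i hi)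
      · exact (hc.2 k hk).2.trans (hv j hj)
    by_contra hR
    have z : ∀ i ∈ Finset.Icc 1 r, ∀ j ∈ Finset.Icc 1 r, stepMean u v i j y = 0 := by
      intro i hi j hj
      by_contra hne
      exact hR (key i hi j hj hne)
    apply hy
    rw [stepWeight_eq]
    simp only
    rw [z 1 h.one_mem 1 h.one_mem, Finset.sum_eq_zero fun i hi => by
      rw [z i (h.mem hi).1 i (h.mem hi).1, z i (h.mem hi).1 (i - 1) (h.mem hi).2, sub_zero]]
    simp
  integrable := h.integrable_stepWeight
  integral_eq_one := by
    have h1 := h.integral_stepWeight_mul (d := d) (F := fun _ => 1) measurable_const (B := 1)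
      (by simp)
    simp only [mul_one] at h1
    have := h.isProbabilityMeasure (d := d) h.one_mem h.one_mem
    -- A constant is a function of the first coordinate, so the signed pairs cancel and the first
    -- block contributes mass one.
    have h2 := h.stepInt_axisPart (d := d) (F := fun _ => 1) continuous_const
    rw [h1, h2]
    simp
  normOne_le := h.normOne_stepWeight_le
  le_normTwo := hA
  normTwo_le := h.normTwo_stepWeight_le.trans hB

end Step

/-! ### Gaussian tails -/

section Gaussian

variable {Ω : Type*} [MeasurableSpace Ω] {P : Measure Ω} [IsProbabilityMeasure P]

lemma measure_abs_gt_le_of_gaussian {X : Ω → ℝ} (hX : HasGaussianLaw X P) (hm : ∫ ω, X ω ∂P = 0)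
    {σ : ℝ} (hv : ∫ ω, X ω ^ 2 ∂P ≤ σ ^ 2) {t : ℝ} (ht : 0 ≤ t) :
    P {ω | t < |X ω|} ≤ ENNReal.ofReal (2 * Real.exp (-t ^ 2 / (2 * σ ^ 2))) := by
  have hvar : Var[X; P] ≤ σ ^ 2 := by
    rw [variance_eq_sub hX.memLp_two, hm]
    simpa using hv
  have hmap := hX.map_eq_gaussianReal
  have hmgf : ∀ s, mgf X P s = Real.exp (Var[X; P] * s ^ 2 / 2) := by
    intro s
    rw [mgf_gaussianReal hmap, hm, Real.coe_toNNReal _ (variance_nonneg _ _)]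
    simp
  have hsub : HasSubgaussianMGF X (Real.toNNReal (σ ^ 2)) P := by
    refine ⟨fun s => ?_, fun s => ?_⟩
    -- Otherwise the moment generating function would be `0` by convention, contradicting its
    -- positive value from `hmgf`.
    · by_contra hn
      have h1 := hmgf s
      rw [mgf, integral_undef hn] at h1
      exact (Real.exp_pos _).ne h1
    · rw [hmgf]
      rw [Real.coe_toNNReal _ (sq_nonneg σ)]
      gcongr
  have h1 := hsub.measure_ge_le ht
  have h2 := hsub.neg.measure_ge_le ht
  rw [Real.coe_toNNReal _ (sq_nonneg σ)] at h1 h2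
  have hs : {ω | t < |X ω|} ⊆ {ω | t ≤ X ω} ∪ {ω | t ≤ (-X) ω} := by
    intro ω hω
    rcases lt_abs.1 (show t < |X ω| from hω) with h | h
    · exact Or.inl h.le
    · exact Or.inr h.le
  refine (measure_mono hs).trans ((measure_union_le _ _).trans ?_)
  rw [two_mul, ENNReal.ofReal_add (Real.exp_pos _).le (Real.exp_pos _).le,
    ← ofReal_measureReal (measure_ne_top P _), ← ofReal_measureReal (measure_ne_top P _)]
  gcongr

variable {d : ℕ} {D : Set (Space d)} {W : L2 D → Ω → ℝ}

lemma IsWhiteNoise.measure_abs_gt_le (hW : IsWhiteNoise P D W) (h : L2 D) {σ t : ℝ}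
    (hσ : ‖h‖ ≤ σ) (ht : 0 ≤ t) :
    P {ω | t < |W h ω|} ≤ ENNReal.ofReal (2 * Real.exp (-t ^ 2 / (2 * σ ^ 2))) := by
  refine measure_abs_gt_le_of_gaussian (hW.gaussian.hasGaussianLaw_eval h) (hW.mean h)
    ?_ ht
  have := hW.covariance h h
  simp only [← sq] at this
  rw [this, real_inner_self_eq_norm_sq]
  gcongr

lemma IsWhiteNoise.measure_abs_sub_gt_le (hW : IsWhiteNoise P D W) (h k : L2 D) {σ t : ℝ}
    (hσ : ‖h - k‖ ≤ σ) (ht : 0 ≤ t) :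
    P {ω | t < |W h ω - W k ω|} ≤ ENNReal.ofReal (2 * Real.exp (-t ^ 2 / (2 * σ ^ 2))) := by
  have lh := (hW.gaussian.hasGaussianLaw_eval h).memLp_two
  have lk := (hW.gaussian.hasGaussianLaw_eval k).memLp_two
  refine measure_abs_gt_le_of_gaussian (hW.gaussian.hasGaussianLaw_fun_sub (s := h) (t := k)) ?_ ?_ ht
  · rw [integral_sub (lh.integrable (by norm_num)) (lk.integrable (by norm_num)), hW.mean, hW.mean,
      sub_zero]
  · have e : ∀ ω, (W h ω - W k ω) ^ 2 =
        W h ω * W h ω - 2 * (W h ω * W k ω) + W k ω * W k ω := fun ω => by ring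
    simp only [e]
    have i1 : Integrable (fun ω => W h ω * W h ω) P := lh.integrable_mul lh
    have i2 : Integrable (fun ω => 2 * (W h ω * W k ω)) P := (lh.integrable_mul lk).const_mul 2
    have i3 : Integrable (fun ω => W k ω * W k ω) P := lk.integrable_mul lk
    have i4 : Integrable (fun ω => W h ω * W h ω - 2 * (W h ω * W k ω)) P := i1.sub i2
    rw [integral_add i4 i3, integral_sub i1 i2, integral_const_mul, hW.covariance, hW.covariance,
      hW.covariance, real_inner_self_eq_norm_sq, real_inner_self_eq_norm_sq,
      ← norm_sub_sq_real]
    gcongr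

end Gaussian

/-! ### Convolutions of weights -/

section Convolution

variable {d : ℕ} {K K' : Space d → ℝ}

lemma convolve_eq_convolution (K' K : Space d → ℝ) :
    convolve K' K = convolution K K' (ContinuousLinearMap.mul ℝ ℝ) volume := by
  ext t
  simp only [convolve, convolution, ContinuousLinearMap.mul_apply']
  exact integral_congr_ae (Eventually.of_forall fun y => mul_comm _ _)

lemma convolve_comm (K' K : Space d → ℝ) : convolve K' K = convolve K K' := by
  ext t
  unfold convolve
  rw [← integral_sub_left_eq_self (fun y => K' (t - y) * K y) volume t]
  refine integral_congr_ae (Eventually.of_forall fun y => ?_)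
  simp only [sub_sub_cancel]
  exact mul_comm _ _

lemma integrable_convolve (h' : Integrable K') (h : Integrable K) : Integrable (convolve K' K) := by
  rw [convolve_eq_convolution]
  exact h.integrable_convolution _ h'

lemma normOne_nonneg (K : Space d → ℝ) : 0 ≤ normOne K := integral_nonneg fun _ => abs_nonneg _

lemma abs_convolve_le (h : Integrable K) {C : ℝ} (hC : ∀ y, |K' y| ≤ C) (t : Space d) :
    |convolve K' K t| ≤ C * normOne K := by
  unfold convolve normOne
  rw [← integral_const_mul]
  rw [← Real.norm_eq_abs]
  refine norm_integral_le_of_norm_le (f := fun y => K' (t - y) * K y) (h.abs.const_mul C)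
    (Eventually.of_forall fun y => ?_)
  rw [norm_mul]
  exact mul_le_mul_of_nonneg_right (hC _) (norm_nonneg _)

lemma memLp_convolve (h' : Integrable K') (h : Integrable K) {C : ℝ} (hC : ∀ y, |K' y| ≤ C) :
    MemLp (convolve K' K) 2 :=
  memLp_two_of_bounded (integrable_convolve h' h) (abs_convolve_le h hC)

lemma convolve_support {R R' : ℝ} (h' : ∀ y, K' y ≠ 0 → ‖y‖ ≤ R') (h : ∀ y, K y ≠ 0 → ‖y‖ ≤ R)
    (t : Space d) (ht : convolve K' K t ≠ 0) : ‖t‖ ≤ R' + R := by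
  by_contra hn
  apply ht
  unfold convolve
  refine integral_eq_zero_of_ae (Eventually.of_forall fun y => ?_)
  simp only [Pi.zero_apply, mul_eq_zero]
  by_contra hne
  push Not at hne
  have e : t = (t - y) + y := by abel
  apply hn
  rw [e]
  exact (norm_add_le _ _).trans (add_le_add (h' _ hne.1) (h _ hne.2))

/-- Young's inequality for the convolution of an integrable and a square integrable weight. -/
lemma normTwo_convolve_le (m' : Measurable K') (m : Measurable K) (h' : Integrable K')
    (h : Integrable K) {C' : ℝ} (hC' : ∀ y, |K' y| ≤ C') :
    normTwo (convolve K' K) ≤ normTwo K' * normOne K := by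
  have l' := memLp_two_of_bounded h' hC'
  have hsq := l'.integrable_sq
  -- Cauchy–Schwarz for the factorization `√|K| · √(K'² |K|)` of the integrand; integrating over `t`
  -- then finishes by Fubini.
  have hpt : ∀ t, convolve K' K t ^ 2 ≤
      normOne K * convolve (fun y => K' y ^ 2) (fun y => |K y|) t := by
    intro t
    have hb : ∀ y, 0 ≤ K' (t - y) ^ 2 * |K y| := fun y => by positivity
    have mt : Measurable fun y => K' (t - y) := m'.comp (measurable_const.sub measurable_id)
    have i2 : Integrable fun y => K' (t - y) ^ 2 * |K y| := by
      refine h.abs.bdd_mul (c := C' ^ 2) (mt.pow_const 2).aestronglyMeasurable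
        (Eventually.of_forall fun y => ?_)
      rw [Real.norm_eq_abs, abs_of_nonneg (sq_nonneg _), ← sq_abs]
      exact pow_le_pow_left₀ (abs_nonneg _) (hC' _) 2
    have m1 : MemLp (fun y => √|K y|) (ENNReal.ofReal 2) := by
      rw [ENNReal.ofReal_ofNat, memLp_two_iff_integrable_sq m.abs.sqrt.aestronglyMeasurable]
      simpa only [Real.sq_sqrt (abs_nonneg _)] using h.abs
    have m2 : MemLp (fun y => √(K' (t - y) ^ 2 * |K y|)) (ENNReal.ofReal 2) := by
      have mm : Measurable fun y => √(K' (t - y) ^ 2 * |K y|) := ((mt.pow_const 2).mul m.abs).sqrt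
      rw [ENNReal.ofReal_ofNat, memLp_two_iff_integrable_sq mm.aestronglyMeasurable]
      simpa only [Real.sq_sqrt (hb _)] using i2
    have key := integral_mul_le_Lp_mul_Lq_of_nonneg Real.HolderConjugate.two_two
      (Eventually.of_forall fun y => Real.sqrt_nonneg _)
      (Eventually.of_forall fun y => Real.sqrt_nonneg _) m1 m2
    simp only [Real.rpow_two, Real.sq_sqrt (abs_nonneg _), Real.sq_sqrt (hb _)] at key
    have e : ∀ y, √|K y| * √(K' (t - y) ^ 2 * |K y|) = |K' (t - y) * K y| := fun y => by
      rw [Real.sqrt_mul (sq_nonneg _), Real.sqrt_sq_eq_abs, mul_left_comm,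
        Real.mul_self_sqrt (abs_nonneg _), abs_mul]
    simp only [e, ← Real.sqrt_eq_rpow] at key
    have h1 : |convolve K' K t| ≤ √(∫ y, |K y|) * √(∫ y, K' (t - y) ^ 2 * |K y|) :=
      (norm_integral_le_integral_norm fun y => K' (t - y) * K y).trans key
    rw [← sq_abs]
    refine (pow_le_pow_left₀ (abs_nonneg _) h1 2).trans (le_of_eq ?_)
    rw [mul_pow, Real.sq_sqrt (integral_nonneg fun y => abs_nonneg _),
      Real.sq_sqrt (integral_nonneg hb)]
    rfl
  have hi : ∫ t, convolve (fun y => K' y ^ 2) (fun y => |K y|) t =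
      normOne K * ∫ t, K' t ^ 2 := by
    rw [convolve_eq_convolution, integral_convolution _ h.abs hsq]
    rfl
  rw [normTwo, normTwo, Real.sqrt_le_left (mul_nonneg (Real.sqrt_nonneg _) (normOne_nonneg K)),
    mul_pow, Real.sq_sqrt (integral_nonneg fun y => sq_nonneg _)]
  calc ∫ t, convolve K' K t ^ 2
      ≤ ∫ t, normOne K * convolve (fun y => K' y ^ 2) (fun y => |K y|) t :=
        integral_mono (memLp_convolve h' h hC').integrable_sq
          ((integrable_convolve hsq h.abs).const_mul _) hpt
    _ = (∫ t, K' t ^ 2) * normOne K ^ 2 := by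
        rw [integral_const_mul, hi]; ring

/-- By Fubini, the mean of the convolved estimator at `y` is the `K'`-average of the means of the
`K`-estimator at the points `y + w`. Hence the bias of `K` must be controlled on the whole support
of `K'`, not only at `y`. -/
lemma integral_convolve_mul (h' : Integrable K') (h : Integrable K) {g : Space d → ℝ}
    (hg : Continuous g) {T : ℝ} (hT : ∀ x, |g x| ≤ T) (y : Space d) :
    ∫ s, convolve K' K s * g (y + s) = ∫ w, K' w * ∫ s, K s * g (y + w + s) := by
  rw [convolve_comm]
  unfold convolve
  simp only [← integral_mul_const]
  have hint : Integrable (Function.uncurry fun s w => K (s - w) * K' w * g (y + s))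
      (volume.prod volume) := by
    have h1 := h'.convolution_integrand (ContinuousLinearMap.mul ℝ ℝ) h (μ := volume)
    have hc : Continuous fun p : Space d × Space d => g (y + p.1) := by fun_prop
    have h2 := h1.mul_bdd (c := T) (g := fun p : Space d × Space d => g (y + p.1))
      hc.aestronglyMeasurable (Eventually.of_forall fun p => hT _)
    refine h2.congr (Eventually.of_forall fun p => ?_)
    simp only [ContinuousLinearMap.mul_apply', Function.uncurry]
    ring
  rw [integral_integral_swap hint]
  refine integral_congr_ae (Eventually.of_forall fun w => ?_)
  simp only
  rw [← integral_const_mul, ← integral_add_right_eq_self _ w]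
  refine integral_congr_ae (Eventually.of_forall fun s => ?_)
  simp only [add_sub_cancel_right]
  rw [show y + (s + w) = y + w + s by abel]
  ring

end Convolution

/-! ### Oriented weights -/

section Oriented

variable {d : ℕ} {M : Space d → (Space d ≃ₗᵢ[ℝ] Space d)} {K : Space d → ℝ}

lemma integral_oriented_mul (K F : Space d → ℝ) (θ : Space d) :
    ∫ s, oriented M K θ s * F s = ∫ s, K s * F (M θ s) := by
  rw [← (M θ).measurePreserving.integral_comp (M θ).toHomeomorph.measurableEmbedding]
  simp [oriented]

lemma normOne_oriented (K : Space d → ℝ) (θ : Space d) :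
    normOne (oriented M K θ) = normOne K :=
  (M θ).symm.measurePreserving.integral_comp (M θ).symm.toHomeomorph.measurableEmbedding
    fun t => |K t|

lemma normTwo_oriented (K : Space d → ℝ) (θ : Space d) :
    normTwo (oriented M K θ) = normTwo K :=
  congrArg Real.sqrt <|
    (M θ).symm.measurePreserving.integral_comp (M θ).symm.toHomeomorph.measurableEmbedding
      fun t => K t ^ 2

lemma WeightBounds.oriented {R N A B : ℝ} (h : WeightBounds K R N A B) (θ : Space d) :
    WeightBounds (oriented M K θ) R N A B where
  measurable := h.measurable.comp (M θ).symm.continuous.measurable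
  bounded := by
    obtain ⟨C, hC⟩ := h.bounded
    exact ⟨C, fun y => hC _⟩
  support y hy := by
    rw [← (M θ).symm.norm_map y]
    exact h.support _ hy
  integrable := (M θ).symm.measurePreserving.integrable_comp_of_integrable h.integrable
  integral_eq_one := by
    rw [← h.integral_eq_one]
    exact (M θ).symm.measurePreserving.integral_comp
      (M θ).symm.toHomeomorph.measurableEmbedding K
  normOne_le := by rw [normOne_oriented]; exact h.normOne_le
  le_normTwo := by rw [normTwo_oriented]; exact h.le_normTwo
  normTwo_le := by rw [normTwo_oriented]; exact h.normTwo_le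

lemma WeightBounds.one_le_normOne {R N A B : ℝ} (h : WeightBounds K R N A B) :
    1 ≤ normOne K := by
  rw [← h.integral_eq_one]
  exact integral_mono h.integrable h.integrable.abs fun y => le_abs_self _

end Oriented

/-! ### Linear estimators -/

section Linear

variable {d : ℕ} {D : Set (Space d)} {K K' : Space d → ℝ}

lemma memLp_translate (h : MemLp K 2) (D : Set (Space d)) (y : Space d) :
    MemLp (fun t => K (t - y)) 2 (volume.restrict D) :=
  (h.comp_measurePreserving (measurePreserving_sub_right volume y)).restrict D

lemma linearEstimator_eq (X : Observation D) (h : MemLp K 2) (y : Space d) :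
    linearEstimator X K y = X ((memLp_translate h D y).toLp _) :=
  dif_pos (memLp_translate h D y)

lemma norm_translate_le (h : MemLp K 2) (D : Set (Space d)) (y : Space d) :
    ‖(memLp_translate h D y).toLp (fun t => K (t - y))‖ ≤ normTwo K := by
  rw [Lp.norm_toLp, normTwo_eq_eLpNorm h]
  refine ENNReal.toReal_mono h.2.ne ?_
  rw [← eLpNorm_comp_measurePreserving h.1 (measurePreserving_sub_right volume y)]
  exact eLpNorm_mono_measure _ Measure.restrict_le_self

variable {Ω : Type*} {W : L2 D → Ω → ℝ}

/-- The support condition keeps the translated weight inside `D`, so the observation window does not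
truncate its mean. -/
lemma linearEstimator_observe (h : MemLp K 2) (y : Space d)
    (hs : ∀ s, K s ≠ 0 → y + s ∈ D) (g : Space d → ℝ) (ε : ℝ) (ω : Ω) :
    linearEstimator (observe W g ε ω) K y =
      (∫ s, K s * g (y + s)) + ε * linearEstimator (fun h => W h ω) K y := by
  rw [linearEstimator_eq _ h, linearEstimator_eq _ h, observe]
  congr 1
  have e : ∫ t in D, ((memLp_translate h D y).toLp (fun t => K (t - y))) t * g t =
      ∫ t in D, K (t - y) * g t := by
    refine integral_congr_ae ?_
    filter_upwards [(memLp_translate h D y).coeFn_toLp] with t ht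
    rw [ht]
  rw [e, setIntegral_eq_integral_of_forall_compl_eq_zero,
    ← integral_sub_right_eq_self (fun s => K s * g (y + s)) y]
  · simp
  · intro t ht
    by_contra hne
    have := hs (t - y) (left_ne_zero_of_mul hne)
    rw [add_sub_cancel] at this
    exact ht this

variable [MeasurableSpace Ω] {P : Measure Ω} [IsProbabilityMeasure P]

omit [IsProbabilityMeasure P] in
lemma IsWhiteNoise.measurable_linearEstimator (hW : IsWhiteNoise P D W) (h : MemLp K 2)
    (y : Space d) : Measurable fun ω => linearEstimator (fun h => W h ω) K y := by
  simp only [linearEstimator_eq _ h]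
  exact hW.measurable _

lemma IsWhiteNoise.measure_linearEstimator_gt (hW : IsWhiteNoise P D W) (h : MemLp K 2)
    (y : Space d) {σ t : ℝ} (hσ : normTwo K ≤ σ) (ht : 0 ≤ t) :
    P {ω | t < |linearEstimator (fun h => W h ω) K y|} ≤
      ENNReal.ofReal (2 * Real.exp (-t ^ 2 / (2 * σ ^ 2))) := by
  simp only [linearEstimator_eq _ h]
  exact hW.measure_abs_gt_le _ ((norm_translate_le h D y).trans hσ) ht

lemma IsWhiteNoise.measure_linearEstimator_sub_gt (hW : IsWhiteNoise P D W) (h : MemLp K 2)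
    (h' : MemLp K' 2) (y : Space d) {σ t : ℝ} (hσ : normTwo K' + normTwo K ≤ σ) (ht : 0 ≤ t) :
    P {ω | t < |linearEstimator (fun h => W h ω) K' y - linearEstimator (fun h => W h ω) K y|} ≤
      ENNReal.ofReal (2 * Real.exp (-t ^ 2 / (2 * σ ^ 2))) := by
  simp only [linearEstimator_eq _ h, linearEstimator_eq _ h']
  refine hW.measure_abs_sub_gt_le _ _ ?_ ht
  exact (norm_sub_le _ _).trans
    ((add_le_add (norm_translate_le h' D y) (norm_translate_le h D y)).trans hσ)

end Linear

/-! ### The oracle inequality at a point -/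

section Oracle

variable {d : ℕ} {D : Set (Space d)} {M : Space d → (Space d ≃ₗᵢ[ℝ] Space d)}
  {K : Space d → ℝ}

/-- The difference is the `K'`-average of the bias of the weight oriented by `θ` at points within
`R` of `y`, where that bias is at most `b` by assumption. No property of `θ'` is needed. -/
lemma abs_integral_convolve_sub_le {R N A B b : ℝ} (h : WeightBounds K R N A B)
    {g : Space d → ℝ} (hg : Continuous g) {L : ℝ} (hL : ∀ x, |g x| ≤ L) {θ : Space d}
    (y : Space d) (hb : ∀ z, ‖z - y‖ ≤ R → |(∫ s, K s * g (z + M θ s)) - g z| ≤ b)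
    (θ' : Space d) :
    |(∫ s, convolve (oriented M K θ') (oriented M K θ) s * g (y + s)) -
      ∫ s, oriented M K θ' s * g (y + s)| ≤ normOne K * b := by
  have h1 := h.oriented (M := M) θ
  have h2 := h.oriented (M := M) θ'
  obtain ⟨C, hC⟩ := h2.bounded
  rw [integral_convolve_mul h2.integrable h1.integrable hg hL]
  have e : ∀ z, ∫ s, oriented M K θ s * g (z + s) = ∫ s, K s * g (z + M θ s) := fun z =>
    integral_oriented_mul K (fun s => g (z + s)) θ
  have hconv : Integrable fun w => oriented M K θ' w * ∫ s, oriented M K θ s * g (y + w + s) := by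
    have m : Continuous fun w : Space d => ∫ s, oriented M K θ s * g (y + w + s) := by
      refine continuous_of_dominated (bound := fun s => |oriented M K θ s| * L) (fun w => ?_)
        (fun w => Eventually.of_forall fun s => ?_) (h1.integrable.abs.mul_const _)
        (Eventually.of_forall fun s => by fun_prop)
      · exact (h1.measurable.mul (by fun_prop)).aestronglyMeasurable
      · rw [norm_mul]
        exact mul_le_mul_of_nonneg_left (hL _) (norm_nonneg _)
    refine h2.integrable.mul_bdd (c := normOne K * L) m.aestronglyMeasurable
      (Eventually.of_forall fun w => ?_)
    rw [← normOne_oriented (M := M) K θ, normOne, ← integral_mul_const]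
    refine norm_integral_le_of_norm_le (h1.integrable.abs.mul_const _)
      (Eventually.of_forall fun s => ?_)
    rw [norm_mul]
    exact mul_le_mul_of_nonneg_left (hL _) (norm_nonneg _)
  have hg' : Integrable fun w => oriented M K θ' w * g (y + w) := by
    have hc : Continuous fun w : Space d => g (y + w) := by fun_prop
    exact h2.integrable.mul_bdd (c := L) hc.aestronglyMeasurable
      (Eventually.of_forall fun w => hL _)
  rw [← integral_sub hconv hg', ← normOne_oriented (M := M) K θ', normOne, ← integral_mul_const,
    ← Real.norm_eq_abs]
  refine norm_integral_le_of_norm_le (h2.integrable.abs.mul_const _)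
    (Eventually.of_forall fun w => ?_)
  rw [← mul_sub, norm_mul, e, Real.norm_eq_abs]
  rcases eq_or_ne (oriented M K θ' w) 0 with h0 | h0
  · simp [h0]
  · refine mul_le_mul_of_nonneg_left (hb _ ?_) (abs_nonneg _)
    rw [add_sub_cancel_left]
    exact h2.support _ h0

/-- If the stochastic errors at `y` are small and one orientation of the net has a small bias
around `y`, then the selected estimator has an error of the order of the threshold. -/
lemma abs_pointEstimator_sub_le {p ε q b : ℝ} {S : Finset (Space d)}
    {sel : Space d → Observation D → Space d} (hsel : IsSelection p ε M S K sel)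
    {X : Observation D} {y : Space d} {E : Space d → ℝ} {E₂ : Space d → Space d → ℝ} {a : ℝ}
    (hq : q = normOne K * normTwo K * (ε * √(Real.log (1 / ε))))
    (h1 : ∀ θ ∈ S, |linearEstimator X (oriented M K θ) y - E θ| ≤ √(4 * p + 8 * d) * q)
    (h2 : ∀ θ' ∈ S, ∀ θ ∈ S,
      |(linearEstimator X (convolve (oriented M K θ') (oriented M K θ)) y
        - linearEstimator X (oriented M K θ') y) - (E₂ θ' θ - E θ')| ≤ 2 * √(4 * p + 8 * d) * q)
    {θ₀ : Space d} (hθ₀ : θ₀ ∈ S) (h3 : ∀ θ' ∈ S, |E₂ θ' θ₀ - E θ'| ≤ normOne K * b)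
    (h4 : |E θ₀ - a| ≤ normOne K * b) (hb : normOne K * b ≤ 4 * q) :
    |pointEstimator p ε M S K sel X y - a| ≤ (12 + 5 * √(4 * p + 8 * d)) * q := by
  set τ := √(4 * p + 8 * d) with hτ
  have hthr : ∀ θ' θ : Space d, threshold p ε (oriented M K θ') (oriented M K θ) =
      (4 + 2 * τ) * q := by
    intro θ' θ
    rw [threshold, normOne_oriented, normOne_oriented, normTwo_oriented, ← hτ, hq]
    ring
  -- The rotations preserve the norms, so the threshold is `(4 + 2 τ) q` for every pair. It covers
  -- the bias difference `4 q` plus the noise `2 τ q`.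
  have hacc : θ₀ ∈ acceptable p ε M S K X y := by
    refine ⟨hθ₀, fun θ' hθ' => ?_⟩
    rw [hthr]
    have k1 := abs_le.1 (h2 θ' hθ' θ₀ hθ₀)
    have k2 := abs_le.1 (h3 θ' hθ')
    rw [abs_le]
    constructor <;> linarith
  have hne : (acceptable p ε M S K X y).Nonempty := ⟨θ₀, hacc⟩
  have hmem := (hsel y).2 X hne
  rw [pointEstimator, if_pos hne]
  set θ := sel y X
  have k1 := hacc.2 θ hmem.1
  have k2 := hmem.2 θ₀ hθ₀
  rw [hthr] at k1 k2
  -- Both acceptability inequalities now involve the same convolved weight. They put the two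
  -- estimators within `2 (4 + 2 τ) q` of each other; the noise `τ q` and bias `4 q` of `θ₀`
  -- complete the total `(12 + 5 τ) q`.
  rw [convolve_comm] at k2
  have k1 := abs_le.1 k1
  have k2 := abs_le.1 k2
  have k3 := abs_le.1 (h1 θ₀ hθ₀)
  have k4 := abs_le.1 h4
  rw [abs_le]
  constructor <;> linarith

end Oracle

/-! ### The grid -/

section Grid

variable {d : ℕ}

/-- The points `ε² z`, `z ∈ ℤ^d`, with all coordinates of `z` at most `⌈1 / ε²⌉` in modulus. -/
def gridSet (d : ℕ) (ε : ℝ) : Finset (Space d) :=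
  open Classical in
  (Fintype.piFinset fun _ : Fin d => Finset.Icc (-⌈1 / ε ^ 2⌉) ⌈1 / ε ^ 2⌉).image
    fun z => WithLp.toLp 2 fun k => ε ^ 2 * (z k : ℝ)

lemma gridPoint_mem_gridSet (ε : ℝ) {x : Space d} (hx : x ∈ unitCube d) :
    gridPoint ε x ∈ gridSet d ε := by
  classical
  refine Finset.mem_image.2 ⟨fun k => ⌈x k / ε ^ 2⌉, ?_, rfl⟩
  rw [Fintype.mem_piFinset]
  intro k
  have h2 : 0 ≤ ε ^ 2 := sq_nonneg ε
  rw [Finset.mem_Icc]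
  constructor
  · rw [neg_le, ← Int.floor_neg]
    refine (Int.floor_le_ceil _).trans (Int.ceil_le_ceil ?_)
    rw [← neg_div]
    exact div_le_div_of_nonneg_right (by linarith [(hx k).1]) h2
  · exact Int.ceil_le_ceil (div_le_div_of_nonneg_right (hx k).2 h2)

lemma abs_le_of_mem_gridSet {ε : ℝ} (hε : 0 < ε) {y : Space d} (hy : y ∈ gridSet d ε) (k : Fin d) :
    |y k| ≤ 1 + ε ^ 2 := by
  classical
  obtain ⟨z, hz, rfl⟩ := Finset.mem_image.1 hy
  rw [Fintype.mem_piFinset] at hz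
  have h1 := Finset.mem_Icc.1 (hz k)
  have h2 : 0 < ε ^ 2 := by positivity
  have h3 : |(z k : ℝ)| ≤ ⌈1 / ε ^ 2⌉ := by
    rw [abs_le]
    exact_mod_cast h1
  have h4 := (Int.ceil_lt_add_one (1 / ε ^ 2)).le
  simp only [abs_mul, abs_of_pos h2]
  calc ε ^ 2 * |(z k : ℝ)| ≤ ε ^ 2 * (1 / ε ^ 2 + 1) := by gcongr; exact h3.trans h4
    _ = 1 + ε ^ 2 := by field_simp

lemma card_gridSet_le {ε : ℝ} (hε : 0 < ε) (hε1 : ε ≤ 1) :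
    ((gridSet d ε).card : ℝ) ≤ (5 / ε ^ 2) ^ d := by
  classical
  have h2 : 0 < ε ^ 2 := by positivity
  have h1 : (1 : ℝ) ≤ 1 / ε ^ 2 := by
    rw [le_div_iff₀ h2]
    nlinarith
  have h4 := (Int.ceil_lt_add_one (1 / ε ^ 2)).le
  have h0 : (0 : ℝ) ≤ ⌈1 / ε ^ 2⌉ := (zero_le_one.trans h1).trans (Int.le_ceil _)
  have h0' : (0 : ℤ) ≤ ⌈1 / ε ^ 2⌉ := by exact_mod_cast h0
  have hc : ((gridSet d ε).card : ℝ) ≤ ((2 * ⌈1 / ε ^ 2⌉ + 1 : ℤ) : ℝ) ^ d := by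
    refine (Nat.cast_le.2 Finset.card_image_le).trans (le_of_eq ?_)
    rw [Fintype.card_piFinset]
    simp only [Int.card_Icc, Finset.prod_const, Finset.card_univ, Fintype.card_fin, Nat.cast_pow]
    congr 1
    have : ((⌈1 / ε ^ 2⌉ + 1 - -⌈1 / ε ^ 2⌉).toNat : ℤ) = 2 * ⌈1 / ε ^ 2⌉ + 1 := by
      rw [Int.toNat_of_nonneg (by linarith)]
      ring
    exact_mod_cast this
  -- `2 ⌈1/ε²⌉ + 1 ≤ 2/ε² + 3 ≤ 5/ε²`, since `ε ≤ 1`.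
  refine hc.trans (pow_le_pow_left₀ (by push_cast; linarith) ?_ d)
  push_cast
  have : 5 / ε ^ 2 = 5 * (1 / ε ^ 2) := by ring
  rw [this]
  linarith

lemma norm_sub_gridPoint_le [NeZero d] {ε : ℝ} (hε : 0 < ε) (x : Space d) :
    ‖x - gridPoint ε x‖ ≤ √d * ε ^ 2 := by
  have h2 : 0 < ε ^ 2 := by positivity
  refine norm_le_sqrt_mul h2.le fun k => ?_
  have h3 := Int.le_ceil (x k / ε ^ 2)
  have h4 := Int.ceil_lt_add_one (x k / ε ^ 2)
  rw [div_le_iff₀ h2] at h3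
  have h5 : (⌈x k / ε ^ 2⌉ : ℝ) * ε ^ 2 < x k + ε ^ 2 := by
    calc (⌈x k / ε ^ 2⌉ : ℝ) * ε ^ 2 < (x k / ε ^ 2 + 1) * ε ^ 2 := by gcongr
      _ = x k + ε ^ 2 := by field_simp
  simp only [gridPoint, PiLp.sub_apply, abs_le]
  constructor <;> linarith

lemma add_mem_openBox {a b : Fin d → ℝ} {η ρ : ℝ} {y s : Space d} (hy : ∀ k, |y k| ≤ 1 + η)
    (hs : ‖s‖ ≤ ρ) (hab : ∀ k, a k < -(1 + η + ρ) ∧ 1 + η + ρ < b k) : y + s ∈ openBox a b := by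
  intro k
  have h1 := abs_le.1 (hy k)
  have h2 := abs_le.1 ((PiLp.norm_apply_le s k).trans hs)
  have h3 := hab k
  rw [PiLp.add_apply]
  constructor <;> linarith

lemma abs_truncate_le {T : ℝ} (hT : 0 ≤ T) (s : ℝ) : |truncate T s| ≤ T := by
  unfold truncate
  split_ifs with h
  · exact h
  · rw [abs_mul, abs_of_nonneg hT]
    refine mul_le_of_le_one_right hT ?_
    rcases Real.sign_apply_eq s with h | h | h <;> simp [h]

/-- Truncation is the projection onto `[-T, T]`, which contains `a`, so it can only bring `s`
closer. -/
lemma abs_truncate_sub_le {T a : ℝ} (ha : |a| ≤ T) (s : ℝ) : |truncate T s - a| ≤ |s - a| := by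
  unfold truncate
  split_ifs with h
  · rfl
  · have hT : 0 ≤ T := (abs_nonneg a).trans ha
    push Not at h
    obtain ⟨h1, h2⟩ := abs_le.1 ha
    rcases lt_abs.1 h with h | h
    · rw [Real.sign_of_pos (by linarith), mul_one, abs_of_nonneg (by linarith),
        abs_of_nonneg (by linarith)]
      linarith
    · rw [Real.sign_of_neg (by linarith), mul_neg_one, abs_of_nonpos (by linarith),
        abs_of_nonpos (by linarith)]
      linarith

end Grid

/-! ### The risk at a fixed noise level -/

section Risk

/-- The constant in the threshold is chosen for this: half its square is `2 p + 4 d`, enough to pay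
for the union bound and for the crude loss on the bad event. -/
lemma exp_tail_eq {p ε s : ℝ} (hp : 0 ≤ p) (d : ℕ) (hε : 0 < ε) (hε1 : ε ≤ 1) (hs : s ≠ 0) :
    Real.exp (-(√(4 * p + 8 * d) * s * √(Real.log (1 / ε))) ^ 2 / (2 * s ^ 2)) =
      ε ^ (2 * p + 4 * d) := by
  have h0 : 0 ≤ Real.log (1 / ε) := Real.log_nonneg (by rw [le_div_iff₀ hε]; linarith)
  rw [mul_pow, mul_pow, Real.sq_sqrt (by positivity), Real.sq_sqrt h0, Real.rpow_def_of_pos hε]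
  congr 1
  rw [one_div, Real.log_inv]
  field_simp
  ring

variable {d : ℕ} [NeZero d] {D : Set (Space d)} {M : Space d → (Space d ≃ₗᵢ[ℝ] Space d)}
  {K : Space d → ℝ} {Ω : Type*} [MeasurableSpace Ω] {P : Measure Ω} [IsProbabilityMeasure P]
  {W : L2 D → Ω → ℝ}

/-- The event that one of the stochastic terms is large at `y`. -/
def noiseEvent (W : L2 D → Ω → ℝ) (p ε : ℝ) (M : Space d → (Space d ≃ₗᵢ[ℝ] Space d))
    (K : Space d → ℝ) (y θ' θ : Space d) : Set Ω :=
  {ω | √(4 * p + 8 * d) * (2 * (normOne K * normTwo K)) * √(Real.log (1 / ε)) <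
      |linearEstimator (fun h => W h ω) (convolve (oriented M K θ') (oriented M K θ)) y -
        linearEstimator (fun h => W h ω) (oriented M K θ') y|} ∪
  {ω | √(4 * p + 8 * d) * (normOne K * normTwo K) * √(Real.log (1 / ε)) <
      |linearEstimator (fun h => W h ω) (oriented M K θ) y|}

omit [NeZero d] [IsProbabilityMeasure P] in
lemma measurableSet_noiseEvent (hW : IsWhiteNoise P D W) {R N A B : ℝ}
    (hK : WeightBounds K R N A B) (p ε : ℝ) (y θ' θ : Space d) :
    MeasurableSet (noiseEvent W p ε M K y θ' θ) := by
  have h1 := hK.oriented (M := M) θ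
  have h2 := hK.oriented (M := M) θ'
  obtain ⟨C, hC⟩ := h2.bounded
  have hc := memLp_convolve h2.integrable h1.integrable hC
  exact (measurableSet_lt measurable_const ((hW.measurable_linearEstimator hc y).sub
    (hW.measurable_linearEstimator h2.memLp y)).abs).union
    (measurableSet_lt measurable_const (hW.measurable_linearEstimator h1.memLp y).abs)

omit [NeZero d] in
lemma measure_noiseEvent_le (hW : IsWhiteNoise P D W) {R N A B : ℝ} (hK : WeightBounds K R N A B)
    (hK2 : 0 < normTwo K) {p ε : ℝ} (hp : 0 ≤ p) (hε : 0 < ε) (hε1 : ε ≤ 1) (y θ' θ : Space d) :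
    P (noiseEvent W p ε M K y θ' θ) ≤ ENNReal.ofReal (4 * ε ^ (2 * p + 4 * d)) := by
  have h1 := hK.oriented (M := M) θ
  have h2 := hK.oriented (M := M) θ'
  obtain ⟨C, hC⟩ := h2.bounded
  have hc := memLp_convolve h2.integrable h1.integrable hC
  have hn := hK.one_le_normOne
  have hn0 : 0 < normOne K := by linarith
  have hy := normTwo_convolve_le h2.measurable h1.measurable h2.integrable h1.integrable hC
  rw [normTwo_oriented, normOne_oriented] at hy
  -- Young's inequality bounds the norm of the convolution by `‖K‖₁ ‖K‖₂`, and `‖K‖₂ ≤ ‖K‖₁ ‖K‖₂`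
  -- because a weight of integral one has `‖K‖₁ ≥ 1`. This explains the factor `2`.
  have b1 := hW.measure_linearEstimator_sub_gt h2.memLp hc y
    (σ := 2 * (normOne K * normTwo K))
    (t := √(4 * p + 8 * d) * (2 * (normOne K * normTwo K)) * √(Real.log (1 / ε)))
    (by rw [normTwo_oriented]; nlinarith) (by positivity)
  have b2 := hW.measure_linearEstimator_gt h1.memLp y (σ := normOne K * normTwo K)
    (t := √(4 * p + 8 * d) * (normOne K * normTwo K) * √(Real.log (1 / ε)))
    (by rw [normTwo_oriented]; nlinarith) (by positivity)
  rw [exp_tail_eq hp d hε hε1 (by positivity)] at b1 b2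
  refine (measure_union_le _ _).trans ((add_le_add b1 b2).trans (le_of_eq ?_))
  rw [← ENNReal.ofReal_add (by positivity) (by positivity)]
  ring_nf

/-- There are at most `(5/ε²)^d` grid points and `c² ε^(-2(d-1))` pairs of orientations, so the
exponent is `2p + 4d - 2d - 2(d-1) = 2p + 2`. -/
lemma measure_iUnion_noiseEvent_le (hW : IsWhiteNoise P D W) {R N A B : ℝ}
    (hK : WeightBounds K R N A B) (hK2 : 0 < normTwo K) {p ε c : ℝ} (hp : 0 ≤ p) (hε : 0 < ε)
    (hε1 : ε ≤ 1) {S : Finset (Space d)} (hS : (S.card : ℝ) ≤ c * (1 / ε) ^ (d - 1)) :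
    P (⋃ y ∈ gridSet d ε, ⋃ θ' ∈ S, ⋃ θ ∈ S, noiseEvent W p ε M K y θ' θ) ≤
      ENNReal.ofReal (4 * 5 ^ d * c ^ 2 * ε ^ (2 * p + 2)) := by
  have h1 : P (⋃ y ∈ gridSet d ε, ⋃ θ' ∈ S, ⋃ θ ∈ S, noiseEvent W p ε M K y θ' θ) ≤
      ∑ _y ∈ gridSet d ε, ∑ _θ' ∈ S, ∑ _θ ∈ S, ENNReal.ofReal (4 * ε ^ (2 * p + 4 * d)) := by
    refine (measure_biUnion_finset_le _ _).trans (Finset.sum_le_sum fun y _ => ?_)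
    refine (measure_biUnion_finset_le _ _).trans (Finset.sum_le_sum fun θ' _ => ?_)
    refine (measure_biUnion_finset_le _ _).trans (Finset.sum_le_sum fun θ _ => ?_)
    exact measure_noiseEvent_le hW hK hK2 hp hε hε1 y θ' θ
  refine h1.trans ?_
  simp only [Finset.sum_const, nsmul_eq_mul]
  rw [← ENNReal.ofReal_natCast, ← ENNReal.ofReal_natCast,
    ← ENNReal.ofReal_mul (Nat.cast_nonneg _), ← ENNReal.ofReal_mul (Nat.cast_nonneg _),
    ← ENNReal.ofReal_mul (Nat.cast_nonneg _)]
  refine ENNReal.ofReal_le_ofReal ?_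
  have e : ε ^ (2 * p + 4 * d) = ε ^ (2 * p + 2) * ((ε ^ 2) ^ d * (ε ^ (d - 1)) ^ 2) := by
    rw [← pow_mul, ← pow_mul, ← pow_add, ← Real.rpow_natCast, ← Real.rpow_add hε]
    congr 1
    have hd : (((d - 1 : ℕ) : ℕ) : ℝ) = d - 1 := by
      rw [Nat.cast_sub NeZero.one_le, Nat.cast_one]
    push_cast
    rw [hd]
    ring
  calc ((gridSet d ε).card : ℝ) * (S.card * (S.card * (4 * ε ^ (2 * p + 4 * d))))
      ≤ (5 / ε ^ 2) ^ d * (c * (1 / ε) ^ (d - 1) * (c * (1 / ε) ^ (d - 1) *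
        (4 * ε ^ (2 * p + 4 * d)))) := by
        have := card_gridSet_le (d := d) hε hε1
        have h0 : 0 ≤ c * (1 / ε) ^ (d - 1) := (Nat.cast_nonneg _).trans hS
        gcongr
    _ = 4 * 5 ^ d * c ^ 2 * ε ^ (2 * p + 2) := by
        rw [e, div_pow, one_div, inv_pow]
        field_simp

/-- The risk of the selected estimator at a fixed noise level. -/
lemma maxRisk_le {a b : Fin d → ℝ} {W : L2 (openBox a b) → Ω → ℝ}
    (hW : IsWhiteNoise P (openBox a b) W) (hM : IsFrame M) {p ε c : ℝ} (hp : 0 < p) (hε : 0 < ε)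
    (hε1 : ε ≤ 1) {S : Finset (Space d)} (hS : (S.card : ℝ) ≤ c * (1 / ε) ^ (d - 1))
    (hS1 : ∀ θ ∈ S, ‖θ‖ = 1) (hS2 : ∀ θ : Space d, ‖θ‖ = 1 → ∃ θ' ∈ S, ‖θ - θ'‖ ≤ ε)
    {sel : Space d → Observation (openBox a b) → Space d} (hsel : IsSelection p ε M S K sel)
    {R N A B δ β₀ : ℝ} (hK : WeightBounds K R N A B) (hK2 : 0 < normTwo K)
    {𝒢 : Set (Space d → ℝ)} (hbias : SmallBias 𝒢 K R δ β₀) (hδ : ε ≤ δ)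
    (hβ₀ : β₀ ≤ 4 * (normTwo K * (ε * √(Real.log (1 / ε)))))
    {L H μ : ℝ} (hg1 : ∀ g ∈ 𝒢, Continuous g) (hg2 : ∀ g ∈ 𝒢, ∀ x, |g x| ≤ L)
    (hg3 : ∀ g ∈ 𝒢, ∀ x y, |g y - g x| ≤ H * ‖y - x‖ ^ μ) (hH : 0 ≤ H) (hμ : 0 ≤ μ)
    (hL : L ≤ Real.log (Real.log (1 / ε))) (hT : Real.log (Real.log (1 / ε)) ≤ 1 / ε)
    (hT0 : 0 ≤ Real.log (Real.log (1 / ε)))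
    (hab : ∀ k, a k < -(1 + ε ^ 2 + (R + R)) ∧ 1 + ε ^ 2 + (R + R) < b k) {ψ C : ℝ} (hψ : ε ≤ ψ)
    (hC : (12 + 5 * √(4 * p + 8 * d)) * (normOne K * normTwo K * (ε * √(Real.log (1 / ε)))) +
      H * (√d * ε ^ 2) ^ μ ≤ C * ψ) :
    maxRisk P W 𝒢 p ε ψ (globalEstimator p ε M S K sel) ≤
      ENNReal.ofReal C ^ p + ENNReal.ofReal (2 ^ p * (4 * 5 ^ d * c ^ 2)) := by
  set T := Real.log (Real.log (1 / ε)) with hTdef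
  set Bad := ⋃ y ∈ gridSet d ε, ⋃ θ' ∈ S, ⋃ θ ∈ S, noiseEvent W p ε M K y θ' θ with hBad
  have hψ0 : 0 < ψ := hε.trans_le hψ
  have hn := hK.one_le_normOne
  have hκ : 0 ≤ ε * √(Real.log (1 / ε)) := by positivity
  have hR : 0 ≤ R := by
    by_contra hR
    have h0 : ∀ y, K y = 0 := fun y => by
      by_contra hy
      exact hR ((norm_nonneg y).trans (hK.support y hy))
    have := hK.integral_eq_one
    simp [h0] at this
  have good : ∀ g ∈ 𝒢, ∀ ω ∉ Bad, ∀ x ∈ unitCube d,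
      |globalEstimator p ε M S K sel (observe W g ε ω) x - g x| ≤ C * ψ := by
    intro g hg ω hω x hx
    set y := gridPoint ε x with hy
    have hyg : y ∈ gridSet d ε := gridPoint_mem_gridSet ε hx
    simp only [hBad, Set.mem_iUnion, not_exists] at hω
    have hω : ∀ θ' ∈ S, ∀ θ ∈ S, ω ∉ noiseEvent W p ε M K y θ' θ := fun θ' h' θ h =>
      hω y hyg θ' h' θ h
    obtain ⟨θs, hθs, hb⟩ := hbias g hg y
    obtain ⟨θ₀, hθ₀, hn₀⟩ := hS2 θs hθs
    have hb := hb (M θ₀) (by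
      rw [hM θ₀ (hS1 θ₀ hθ₀), norm_sub_rev]
      exact hn₀.trans hδ)
    have hyb := abs_le_of_mem_gridSet hε hyg
    have hβ0 : 0 ≤ β₀ := (abs_nonneg _).trans (hb y (by simpa using hR))
    have obs1 : ∀ θ, linearEstimator (observe W g ε ω) (oriented M K θ) y =
        (∫ s, oriented M K θ s * g (y + s)) +
          ε * linearEstimator (fun h => W h ω) (oriented M K θ) y := fun θ =>
      linearEstimator_observe (hK.oriented θ).memLp y (fun s hs => add_mem_openBox hyb
        (((hK.oriented θ).support s hs).trans (by linarith)) hab) g ε ω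
    have obs2 : ∀ θ' θ, linearEstimator (observe W g ε ω)
          (convolve (oriented M K θ') (oriented M K θ)) y =
        (∫ s, convolve (oriented M K θ') (oriented M K θ) s * g (y + s)) +
          ε * linearEstimator (fun h => W h ω) (convolve (oriented M K θ') (oriented M K θ)) y := by
      intro θ' θ
      obtain ⟨C', hC'⟩ := (hK.oriented (M := M) θ').bounded
      exact linearEstimator_observe
        (memLp_convolve (hK.oriented θ').integrable (hK.oriented θ).integrable hC') y
        (fun s hs => add_mem_openBox hyb
          (convolve_support (hK.oriented θ').support (hK.oriented θ).support s hs) hab) g ε ω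
    have main : |pointEstimator p ε M S K sel (observe W g ε ω) y - g y| ≤
        (12 + 5 * √(4 * p + 8 * d)) *
          (normOne K * normTwo K * (ε * √(Real.log (1 / ε)))) := by
      refine abs_pointEstimator_sub_le hsel (b := β₀)
        (E := fun θ => ∫ s, oriented M K θ s * g (y + s))
        (E₂ := fun θ' θ => ∫ s, convolve (oriented M K θ') (oriented M K θ) s * g (y + s))
        rfl ?_ ?_ hθ₀ ?_ ?_ ?_
      · intro θ hθ
        have := hω θ hθ θ hθ
        simp only [noiseEvent, Set.mem_union, not_or, Set.mem_ofPred_eq, not_lt] at this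
        rw [obs1, add_sub_cancel_left, abs_mul, abs_of_pos hε]
        refine (mul_le_mul_of_nonneg_left this.2 hε.le).trans (le_of_eq (by ring))
      · intro θ' hθ' θ hθ
        have := hω θ' hθ' θ hθ
        simp only [noiseEvent, Set.mem_union, not_or, Set.mem_ofPred_eq, not_lt] at this
        rw [obs1, obs2]
        have e : ∀ a b c d : ℝ, a + ε * b - (c + ε * d) - (a - c) = ε * (b - d) := by
          intros; ring
        rw [e, abs_mul, abs_of_pos hε]
        refine (mul_le_mul_of_nonneg_left this.1 hε.le).trans (le_of_eq (by ring))
      · exact fun θ' _ => abs_integral_convolve_sub_le hK (hg1 g hg) (hg2 g hg) y hb θ'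
      · rw [integral_oriented_mul K (fun s => g (y + s))]
        refine (hb y (by simpa using hR)).trans ?_
        nlinarith
      · rw [mul_assoc, mul_left_comm]
        exact mul_le_mul_of_nonneg_left hβ₀ (by linarith)
    have h1 : |globalEstimator p ε M S K sel (observe W g ε ω) x - g y| ≤ _ :=
      (abs_truncate_sub_le ((hg2 g hg y).trans hL) _).trans main
    have h2 : |g y - g x| ≤ H * (√d * ε ^ 2) ^ μ := by
      refine (hg3 g hg x y).trans ?_
      rw [norm_sub_rev]
      have := norm_sub_gridPoint_le hε x
      gcongr
    exact (abs_sub_le _ (g y) _).trans ((add_le_add h1 h2).trans hC)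
  have crude : ∀ g ∈ 𝒢, ∀ ω, ∀ x,
      |globalEstimator p ε M S K sel (observe W g ε ω) x - g x| ≤ 2 * T := by
    intro g hg ω x
    refine (abs_sub _ _).trans ?_
    have h1 : |globalEstimator p ε M S K sel (observe W g ε ω) x| ≤ T := abs_truncate_le hT0 _
    have h2 := (hg2 g hg x).trans hL
    linarith
  have sup_le : ∀ (g₁ g₂ : Space d → ℝ) (B : ℝ), (∀ x ∈ unitCube d, |g₁ x - g₂ x| ≤ B * ψ) →
      (supDist g₁ g₂ / ENNReal.ofReal ψ) ^ p ≤ ENNReal.ofReal B ^ p := by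
    intro g₁ g₂ B hB
    refine ENNReal.rpow_le_rpow ?_ hp.le
    rw [ENNReal.div_le_iff (by simpa using hψ0) ENNReal.ofReal_ne_top,
      ← ENNReal.ofReal_mul' hψ0.le]
    refine iSup₂_le fun x hx => ?_
    rw [Real.enorm_eq_ofReal_abs]
    exact ENNReal.ofReal_le_ofReal (hB x hx)
  have mBad : MeasurableSet Bad :=
    Finset.measurableSet_biUnion _ fun y _ => Finset.measurableSet_biUnion _ fun θ' _ =>
      Finset.measurableSet_biUnion _ fun θ _ => measurableSet_noiseEvent hW hK p ε y θ' θ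
  refine iSup₂_le fun g hg => ?_
  -- The loss is dominated pointwise by a constant plus a multiple of the indicator of a measurable
  -- event, so the loss itself need not be measurable. On the bad event, truncation bounds it by `2
  -- T ≤ 2/ε ≤ (2/ε²) ψ`.
  have pw : ∀ ω, (supDist (globalEstimator p ε M S K sel (observe W g ε ω)) g /
      ENNReal.ofReal ψ) ^ p ≤
      ENNReal.ofReal C ^ p + Bad.indicator (fun _ => ENNReal.ofReal (2 / ε ^ 2) ^ p) ω := by
    intro ω
    by_cases hω : ω ∈ Bad
    · rw [Set.indicator_of_mem hω]
      refine le_add_left (sup_le _ _ _ fun x _ => (crude g hg ω x).trans ?_)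
      calc 2 * T ≤ 2 * (1 / ε) := by linarith
        _ = 2 / ε ^ 2 * ε := by field_simp
        _ ≤ 2 / ε ^ 2 * ψ := by gcongr
    · rw [Set.indicator_of_notMem hω, add_zero]
      exact sup_le _ _ _ (good g hg ω hω)
  refine (lintegral_mono pw).trans ?_
  rw [lintegral_add_left measurable_const, lintegral_const, measure_univ, mul_one,
    lintegral_indicator_const mBad]
  gcongr
  refine (mul_le_mul_right (measure_iUnion_noiseEvent_le hW hK hK2 hp.le hε hε1 hS) _).trans ?_
  rw [ENNReal.ofReal_rpow_of_pos (by positivity), ← ENNReal.ofReal_mul (by positivity)]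
  refine ENNReal.ofReal_le_ofReal ?_
  -- The crude loss to the power `p` exactly consumes the factor `ε^(2p)` of the probability.
  have e : (2 / ε ^ 2) ^ p * ε ^ (2 * p) = 2 ^ p := by
    rw [Real.div_rpow (by norm_num) (by positivity), Real.rpow_mul hε.le, Real.rpow_two]
    field_simp
  have e2 : ε ^ (2 * p + 2) = ε ^ (2 * p) * ε ^ 2 := by
    rw [Real.rpow_add hε, Real.rpow_two]
  rw [e2]
  calc (2 / ε ^ 2) ^ p * (4 * 5 ^ d * c ^ 2 * (ε ^ (2 * p) * ε ^ 2))
      = 2 ^ p * (4 * 5 ^ d * c ^ 2) * ε ^ 2 := by rw [← e]; ring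
    _ ≤ 2 ^ p * (4 * 5 ^ d * c ^ 2) := by
        refine mul_le_of_le_one_right (by positivity) ?_
        exact pow_le_one₀ hε.le hε1

end Risk

variable {d : ℕ} [NeZero d]

/-! ### Families of weights -/

/-- A family of weights of size `λ` whose bias over the class `𝒢` is of order `λ` and whose
`L₂`-norm is of the exact order `λ ^ (-e / 2)`, for small `λ`. -/
def IsWeightFamily (𝒢 : Set (Space d → ℝ)) (K : ℝ → Space d → ℝ) (e : ℝ) (N : ℝ → ℝ) : Prop :=
  ∃ R : ℝ → ℝ, Tendsto R (𝓝[>] 0) (𝓝 0) ∧ ∃ c C B : ℝ, 0 < c ∧ 0 < C ∧ 0 < B ∧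
    ∀ᶠ l in 𝓝[>] (0 : ℝ),
      WeightBounds (K l) (R l) (N l) (c * l ^ (-e / 2)) (C * l ^ (-e / 2)) ∧
      SmallBias 𝒢 (K l) (R l) (l ^ (1 + e / 2)) (B * l)

lemma IsWeightFamily.congr {𝒢 : Set (Space d → ℝ)} {K K' : ℝ → Space d → ℝ} {e : ℝ} {N : ℝ → ℝ}
    (h : IsWeightFamily 𝒢 K e N) (hK : ∀ᶠ l in 𝓝[>] (0 : ℝ), K' l = K l) :
    IsWeightFamily 𝒢 K' e N := by
  obtain ⟨R, hR, c, C, B, hc, hC, hB, H⟩ := h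
  refine ⟨R, hR, c, C, B, hc, hC, hB, ?_⟩
  filter_upwards [H, hK] with l h1 h2
  rwa [h2]

lemma eventually_Ioo : ∀ᶠ l in 𝓝[>] (0 : ℝ), 0 < l ∧ l < 1 := by
  filter_upwards [Ioo_mem_nhdsGT (zero_lt_one (α := ℝ))] with l hl using hl

lemma tendsto_rpow_nhdsGT {s : ℝ} (hs : 0 < s) : Tendsto (fun l : ℝ => l ^ s) (𝓝[>] 0) (𝓝 0) := by
  have h := (Real.continuousAt_rpow_const 0 s (Or.inr hs.le)).tendsto
  rw [Real.zero_rpow hs.ne'] at h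
  exact h.mono_left nhdsWithin_le_nhds

lemma tendsto_sqrt_mul_rpow (d : ℕ) {s : ℝ} (hs : 0 < s) :
    Tendsto (fun l : ℝ => √d * l ^ s) (𝓝[>] 0) (𝓝 0) := by
  simpa using (tendsto_rpow_nhdsGT hs).const_mul √d

lemma one_le_sqrt_dim (d : ℕ) [NeZero d] : 1 ≤ √(d : ℝ) :=
  Real.one_le_sqrt.2 (by exact_mod_cast NeZero.one_le)

lemma cast_pred (d : ℕ) [NeZero d] : (((d - 1 : ℕ) : ℕ) : ℝ) = d - 1 := by
  rw [Nat.cast_sub NeZero.one_le, Nat.cast_one]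

lemma sqrt_inv_rpow {l : ℝ} (hl : 0 < l) {k : ℝ} (hk : 0 ≤ k) (e : ℝ) :
    √((k * l ^ e)⁻¹) = √k⁻¹ * l ^ (-e / 2) := by
  rw [mul_inv, Real.sqrt_mul (inv_nonneg.2 hk), ← Real.rpow_neg hl.le, Real.sqrt_eq_rpow (l ^ _),
    ← Real.rpow_mul hl.le]
  congr 2
  ring

lemma rpow_mul_rpow_pow (d : ℕ) [NeZero d] {l : ℝ} (hl : 0 < l) (x y : ℝ) :
    l ^ x * (l ^ y) ^ (d - 1) = l ^ (x + ((d : ℝ) - 1) * y) := by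
  rw [← Real.rpow_natCast, cast_pred, ← Real.rpow_mul hl.le, ← Real.rpow_add hl, mul_comm y]

lemma isWeightFamily_boxcar {𝒢 : Set (Space d → ℝ)} {x y e B : ℝ} (hy : 0 < y)
    (hyx : y ≤ x) (he : x + ((d : ℝ) - 1) * y = e) (hB : 0 < B)
    (hb : ∀ l : ℝ, 0 < l → l < 1 →
      SmallBias 𝒢 (boxcar (l ^ x) (l ^ y)) (√d * l ^ y) (l ^ (1 + e / 2)) (B * l)) :
    IsWeightFamily 𝒢 (fun l => boxcar (l ^ x) (l ^ y)) e (fun _ => 1) := by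
  have h2 : 0 < √((2 : ℝ) ^ d)⁻¹ := by positivity
  refine ⟨fun l => √d * l ^ y, tendsto_sqrt_mul_rpow d hy, _, _, B, h2, h2, hB, ?_⟩
  filter_upwards [eventually_Ioo] with l ⟨hl, hl1⟩
  refine ⟨?_, hb l hl hl1⟩
  have := weightBounds_boxcar (d := d) (Real.rpow_pos_of_pos hl x) (Real.rpow_pos_of_pos hl y)
    (Real.rpow_le_rpow_of_exponent_ge hl hl1.le hyx) le_rfl
  rwa [rpow_mul_rpow_pow d hl, he, sqrt_inv_rpow hl (by positivity)] at this

section Classes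

variable {γ β L₁ L₂ : ℝ}

lemma exists_common_radius (L₁ L₂ : ℝ) : ∃ L : ℝ, 1 ≤ L ∧ L₁ ≤ L ∧ L₂ ≤ L :=
  ⟨max 1 (max L₁ L₂), le_max_left _ _, (le_max_left _ _).trans (le_max_right _ _),
    (le_max_right _ _).trans (le_max_right _ _)⟩

lemma SmallBias.mono {𝒢 : Set (Space d → ℝ)} {K : Space d → ℝ} {R δ B B' : ℝ}
    (h : SmallBias 𝒢 K R δ B) (hB : B ≤ B') : SmallBias 𝒢 K R δ B' := fun g hg x => by
  obtain ⟨θ, h1, h2⟩ := h g hg x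
  exact ⟨θ, h1, fun M hM z hz => (h2 M hM z hz).trans hB⟩

lemma isWeightFamily_slow (hγ : 0 < γ) (hγ1 : γ ≤ 1) (hβ : 0 < β) (hβ1 : β ≤ 1) (hL₁ : 0 ≤ L₁)
    (hL₂ : 0 ≤ L₂) :
    IsWeightFamily (compositeClass d γ β L₁ L₂)
      (fun l => boxcar (l ^ (1 / (γ * β))) (l ^ (1 / (γ * β)))) (d / (γ * β)) fun _ => 1 := by
  obtain ⟨L, hL, h1, h2⟩ := exists_common_radius L₁ L₂
  have hd := one_le_sqrt_dim d
  refine isWeightFamily_boxcar (B := 4 * L ^ 2 * √d ^ (γ * β)) (by positivity) le_rfl (by ring)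
    (by positivity) fun l hl _ => ?_
  refine (smallBias_boxcar_modulus hγ (by linarith) hβ (by linarith) hL₁ hL₂ hL h1 h2
    (by positivity)).mono (le_of_eq ?_)
  rw [min_eq_right hγ1, min_eq_right hβ1, Real.mul_rpow (by positivity) (by positivity),
    ← Real.rpow_mul hl.le, one_div_mul_cancel (by positivity), Real.rpow_one, ← mul_assoc]

lemma isWeightFamily_singleIndex (hγ : 0 < γ) (hγ1 : γ ≤ 1) (hβ : 1 < β) (hβ2 : β ≤ 2)
    (hL₁ : 0 ≤ L₁) (hL₂ : 0 ≤ L₂) :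
    IsWeightFamily (compositeClass d γ β L₁ L₂)
      (fun l => boxcar (l ^ (1 / γ)) (l ^ (1 / (γ * β)))) (1 / γ + ((d : ℝ) - 1) / (γ * β))
      fun _ => 1 := by
  obtain ⟨L, hL, h1, h2⟩ := exists_common_radius L₁ L₂
  have hd := one_le_sqrt_dim d
  have hd1 : (1 : ℝ) ≤ d := by exact_mod_cast NeZero.one_le
  have hyx : 1 / (γ * β) ≤ 1 / γ := one_div_le_one_div_of_le hγ (by nlinarith)
  refine isWeightFamily_boxcar (B := 14 * L ^ 2 * (√d ^ (γ * β) + 1)) (by positivity) hyx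
    (by ring) (by positivity) fun l hl hl1 => ?_
  have hpos : 0 < l ^ (1 / (γ * β)) := by positivity
  refine (smallBias_boxcar_singleIndex (b := l ^ (1 / (γ * β))) hγ hγ1 hβ hβ2 hL₁ hL₂ hL h1 h2 ?_
    (by positivity) (by positivity) ?_ le_rfl).mono (le_of_eq ?_)
  · rw [Real.mul_rpow (by positivity) (by positivity), ← Real.rpow_mul hl.le]
    refine le_trans ?_ (le_mul_of_one_le_left (by positivity)
      (Real.one_le_rpow hd (by linarith)))
    refine Real.rpow_le_rpow_of_exponent_ge hl hl1.le ?_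
    -- Since `β ≤ 2`, the exponent `1/γ - 1/(γβ)` is at most `1/(2γ)`, which is below `1 + e/2`; so
    -- the demanded angular precision is finer than `R^(β-1)`.
    have e1 : 1 / (γ * β) * (β - 1) = 1 / γ - 1 / (γ * β) := by
      field_simp
    have e2 : 1 / γ / 2 ≤ 1 / (γ * β) := by
      rw [div_div]
      exact one_div_le_one_div_of_le (by positivity) (by nlinarith)
    have e3 : 0 ≤ ((d : ℝ) - 1) / (γ * β) := div_nonneg (by linarith) (by positivity)
    rw [e1]
    linarith
  · exact (Real.rpow_le_rpow_of_exponent_ge hl hl1.le hyx).trans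
      (le_mul_of_one_le_left (by positivity) hd)
  · rw [Real.mul_rpow (by positivity) (by positivity), ← Real.rpow_mul hl.le, ← Real.rpow_mul hl.le,
      one_div_mul_cancel (by positivity), one_div_mul_cancel (by positivity), Real.rpow_one]
    ring

/-- With `β ≤ γ` the outer function does not lower the order of smoothness of `G`, so cubes of side
`λ^(1/β)` do, in any orientation: the Lipschitz property of `f` handles `β ≤ 1`, central symmetry
handles `β > 1`. -/
lemma isWeightFamily_inactive (hγ : 1 < γ) (hγ2 : γ ≤ 2) (hβ : 0 < β) (hβγ : β ≤ γ)
    (hL₁ : 0 ≤ L₁) (hL₂ : 0 ≤ L₂) :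
    IsWeightFamily (compositeClass d γ β L₁ L₂)
      (fun l => boxcar (l ^ (1 / β)) (l ^ (1 / β))) (d / β) fun _ => 1 := by
  obtain ⟨L, hL, h1, h2⟩ := exists_common_radius L₁ L₂
  have hd := one_le_sqrt_dim d
  refine isWeightFamily_boxcar (B := 4 * L ^ 3 * √d ^ γ + 4 * L ^ 2 * √d ^ β) (by positivity)
    le_rfl (by ring) (by positivity) fun l hl hl1 => ?_
  have eβ : (√d * l ^ (1 / β)) ^ β = √d ^ β * l := by
    rw [Real.mul_rpow (by positivity) (by positivity), ← Real.rpow_mul hl.le,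
      one_div_mul_cancel (by positivity), Real.rpow_one]
  have p1 : 0 ≤ 4 * L ^ 3 * √d ^ γ * l := by positivity
  have p2 : 0 ≤ L ^ 2 * √d ^ β * l := by positivity
  rcases le_or_gt β 1 with h | h
  · refine (smallBias_boxcar_modulus (by linarith) hγ2 hβ (by linarith) hL₁ hL₂ hL h1 h2
      (by positivity)).mono ?_
    rw [min_eq_left hγ.le, min_eq_right h, one_mul, eβ]
    linarith
  · refine (smallBias_boxcar_smooth hγ hγ2 h hβγ hL₁ hL₂ hL h1 h2 (by positivity)).mono ?_
    have eγ : (√d * l ^ (1 / β)) ^ γ ≤ √d ^ γ * l := by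
      rw [Real.mul_rpow (by positivity) (by positivity), ← Real.rpow_mul hl.le]
      refine mul_le_mul_of_nonneg_left ?_ (by positivity)
      refine (Real.rpow_le_rpow_of_exponent_ge hl hl1.le ?_).trans (Real.rpow_one l).le
      rw [one_div_mul_eq_div, le_div_iff₀ hβ]
      linarith
    rw [eβ]
    have := mul_le_mul_of_nonneg_left eγ (by positivity : 0 ≤ 4 * L ^ 3)
    linarith

end Classes

/-! ### Families of step weights -/

section Step

variable {γ β : ℝ} {r : ℕ} {u v : ℕ → ℝ}

/-- Since `v i ≤ v (i - 1)`, the blocks `(i, i - 1)` dominate the mixed terms and the remainders,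
and the terms with index `1` are dominated by those with index `2`. Five size conditions therefore
control all of `stepBias`; `hκ` converts the remainder into order `λ`. -/
lemma StepOrder.stepBias_le (h : StepOrder r u v) (hγ : 1 < γ) (hγ2 : γ ≤ 2) (hβ : 1 < β)
    (hβ2 : β ≤ 2) {l C κ Q : ℝ} (hκ0 : 0 ≤ κ) (hκ : κ ^ γ * l ^ (1 / β) ≤ Q * l) (hC : 0 ≤ C)
    (h1 : u 1 ^ γ ≤ C * l) (h2 : ∑ i ∈ Finset.Icc 2 r, u i ^ β ≤ C * l) (h3 : v r ^ β ≤ C * l)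
    (h4 : ∑ i ∈ Finset.Icc 2 r, u i ^ (γ - 1) * v (i - 1) ^ β ≤ C * l)
    (h5 : ∑ i ∈ Finset.Icc 2 r, v (i - 1) ^ γ ≤ C * l ^ (1 / β)) :
    stepBias d γ β κ r u v ≤ ((3 + 4 * d + 3 * d * Q) * C) * l := by
  have hd := one_le_sqrt_dim d
  have hd0 : (0 : ℝ) ≤ d := Nat.cast_nonneg d
  have hpow : ∀ s : ℝ, s ≤ 2 → √(d : ℝ) ^ s ≤ d := fun s hs => by
    refine (Real.rpow_le_rpow_of_exponent_le hd hs).trans (le_of_eq ?_)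
    rw [Real.rpow_two, Real.sq_sqrt hd0]
  have two_mem : 2 ∈ Finset.Icc 2 r := Finset.mem_Icc.2 ⟨le_rfl, h.two_le⟩
  have up : ∀ i ∈ Finset.Icc 1 r, 0 ≤ u i := fun i hi => (h.u_pos i hi).le
  have mem1 : ∀ {i}, i ∈ Finset.Icc 2 r → i ∈ Finset.Icc 1 r := fun hi => by
    rw [Finset.mem_Icc] at hi ⊢; omega
  have mem2 : ∀ {i}, i ∈ Finset.Icc 2 r → i - 1 ∈ Finset.Icc 1 r := fun hi => by
    rw [Finset.mem_Icc] at hi ⊢; omega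
  have vp : ∀ i ∈ Finset.Icc 1 r, 0 ≤ v i := fun i hi => h.v_nonneg i <| by
    rw [Finset.mem_Icc] at hi ⊢; omega
  have one_mem : 1 ∈ Finset.Icc 1 r := h.one_mem
  have v_le : ∀ {i}, i ∈ Finset.Icc 2 r → v i ≤ v (i - 1) := fun {i} hi => by
    have := h.v_lt _ (mem2 hi)
    rw [Finset.mem_Icc] at hi
    rw [show i - 1 + 1 = i by omega] at this
    exact this.le
  have u12 : u 1 ≤ u 2 := (h.u_lt 2 two_mem).le
  have sβ : ∀ i ∈ Finset.Icc 1 r, (√(d : ℝ) * v i) ^ β ≤ d * v i ^ β := fun i hi => by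
    rw [Real.mul_rpow (by positivity) (vp i hi)]
    exact mul_le_mul_of_nonneg_right (hpow β hβ2) (Real.rpow_nonneg (vp i hi) _)
  have sγ : ∀ i ∈ Finset.Icc 1 r, (κ * (√(d : ℝ) * v i)) ^ γ ≤ κ ^ γ * (d * v i ^ γ) := fun i hi => by
    have := vp i hi
    rw [Real.mul_rpow hκ0 (by positivity), Real.mul_rpow (by positivity) this]
    have := hpow γ hγ2
    gcongr
  have t2 : u 1 ^ β ≤ C * l := by
    refine le_trans (Real.rpow_le_rpow (up 1 one_mem) u12 (by linarith)) (le_trans ?_ h2)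
    exact Finset.single_le_sum (f := fun i => u i ^ β)
      (fun i hi => Real.rpow_nonneg (up i (mem1 hi)) _) two_mem
  have t3 : (√(d : ℝ) * v r) ^ β ≤ d * (C * l) :=
    (sβ r h.last_mem).trans (mul_le_mul_of_nonneg_left h3 hd0)
  have nn4 : ∀ i ∈ Finset.Icc 2 r, 0 ≤ u i ^ (γ - 1) * v (i - 1) ^ β := fun i hi =>
    mul_nonneg (Real.rpow_nonneg (up i (mem1 hi)) _) (Real.rpow_nonneg (vp _ (mem2 hi)) _)
  have t4 : u 1 ^ (γ - 1) * (√(d : ℝ) * v 1) ^ β ≤ d * (C * l) := by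
    have a1 : u 1 ^ (γ - 1) * v 1 ^ β ≤ C * l := by
      refine le_trans ?_ (le_trans (Finset.single_le_sum nn4 two_mem) h4)
      exact mul_le_mul_of_nonneg_right
        (Real.rpow_le_rpow (up 1 one_mem) u12 (by linarith)) (Real.rpow_nonneg (vp 1 one_mem) _)
    calc u 1 ^ (γ - 1) * (√(d : ℝ) * v 1) ^ β ≤ u 1 ^ (γ - 1) * (d * v 1 ^ β) :=
          mul_le_mul_of_nonneg_left (sβ 1 one_mem) (Real.rpow_nonneg (up 1 one_mem) _)
      _ = d * (u 1 ^ (γ - 1) * v 1 ^ β) := by ring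
      _ ≤ d * (C * l) := mul_le_mul_of_nonneg_left a1 hd0
  have t5 : ∑ i ∈ Finset.Icc 2 r, u i ^ (γ - 1) *
      ((√(d : ℝ) * v i) ^ β + (√(d : ℝ) * v (i - 1)) ^ β) ≤ 2 * d * (C * l) := by
    calc _ ≤ ∑ i ∈ Finset.Icc 2 r, 2 * d * (u i ^ (γ - 1) * v (i - 1) ^ β) := by
          refine Finset.sum_le_sum fun i hi => ?_
          have a1 := sβ i (mem1 hi)
          have a2 := sβ _ (mem2 hi)
          have a3 : v i ^ β ≤ v (i - 1) ^ β :=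
            Real.rpow_le_rpow (vp _ (mem1 hi)) (v_le hi) (by linarith)
          have a4 := Real.rpow_nonneg (up i (mem1 hi)) (γ - 1)
          calc _ ≤ u i ^ (γ - 1) * (d * v (i - 1) ^ β + d * v (i - 1) ^ β) := by
                gcongr
                exact a1.trans (mul_le_mul_of_nonneg_left a3 hd0)
            _ = _ := by ring
      _ = 2 * d * ∑ i ∈ Finset.Icc 2 r, u i ^ (γ - 1) * v (i - 1) ^ β := by
          rw [Finset.mul_sum]
      _ ≤ _ := by gcongr
  have nn5 : ∀ i ∈ Finset.Icc 2 r, 0 ≤ v (i - 1) ^ γ := fun i hi =>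
    Real.rpow_nonneg (vp _ (mem2 hi)) _
  have kk : 0 ≤ κ ^ γ := Real.rpow_nonneg hκ0 _
  have fin : κ ^ γ * (d * (C * l ^ (1 / β))) ≤ d * Q * (C * l) := by
    calc κ ^ γ * (d * (C * l ^ (1 / β))) = d * C * (κ ^ γ * l ^ (1 / β)) := by ring
      _ ≤ d * C * (Q * l) := by gcongr
      _ = _ := by ring
  have t6 : (κ * (√(d : ℝ) * v 1)) ^ γ ≤ d * Q * (C * l) := by
    refine (sγ 1 one_mem).trans (le_trans ?_ fin)
    gcongr
    exact (Finset.single_le_sum nn5 two_mem).trans h5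
  have t7 : ∑ i ∈ Finset.Icc 2 r, ((κ * (√(d : ℝ) * v i)) ^ γ + (κ * (√(d : ℝ) * v (i - 1))) ^ γ) ≤
      2 * (d * Q * (C * l)) := by
    calc _ ≤ ∑ i ∈ Finset.Icc 2 r, 2 * (κ ^ γ * d) * v (i - 1) ^ γ := by
          refine Finset.sum_le_sum fun i hi => ?_
          have a1 := sγ i (mem1 hi)
          have a2 := sγ _ (mem2 hi)
          have a3 : v i ^ γ ≤ v (i - 1) ^ γ :=
            Real.rpow_le_rpow (vp _ (mem1 hi)) (v_le hi) (by linarith)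
          have a4 : κ ^ γ * (d * v i ^ γ) ≤ κ ^ γ * (d * v (i - 1) ^ γ) := by gcongr
          linarith
      _ = 2 * (κ ^ γ * (d * ∑ i ∈ Finset.Icc 2 r, v (i - 1) ^ γ)) := by
          rw [← Finset.mul_sum]; ring
      _ ≤ 2 * (κ ^ γ * (d * (C * l ^ (1 / β)))) := by gcongr
      _ ≤ _ := by linarith
  unfold stepBias
  linarith

end Step

variable {d : ℕ} [NeZero d]

section Step

variable {γ β : ℝ}

omit [NeZero d] in
lemma StepOrder.v_pos {r : ℕ} {u v : ℕ → ℝ} (h : StepOrder r u v) {i : ℕ}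
    (hi : i ∈ Finset.Icc 1 r) : 0 < v i :=
  (h.v_nonneg (i + 1) (by rw [Finset.mem_Icc] at hi ⊢; omega)).trans_lt (h.v_lt i hi)

/-- If consecutive sizes are separated by a fixed proportion `c`, each band has width at least `c`
times its outer end. The volume of `(i, i)` or `(i, i - 1)` is then at least `c^d u_i v_i^(d-1)`. -/
lemma StepOrder.stepNorm_le {r : ℕ} {u v : ℕ → ℝ} (h : StepOrder r u v) {c : ℝ} (hc : 0 < c)
    (hc1 : c ≤ 1) (hu : ∀ i ∈ Finset.Icc 2 r, c * u i ≤ u i - u (i - 1))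
    (hv : ∀ j ∈ Finset.Icc 1 r, c * v j ≤ v j - v (j + 1)) :
    stepNorm d r u v ≤
      2 * ∑ i ∈ Finset.Icc 1 r, √((c ^ d * (u i * v i ^ (d - 1)))⁻¹) := by
  have key : ∀ i ∈ Finset.Icc 1 r, ∀ j ∈ Finset.Icc 1 r, j ≤ i →
      √(stepVol d u v i j)⁻¹ ≤ √((c ^ d * (u i * v i ^ (d - 1)))⁻¹) := by
    intro i hi j hj hji
    have pu := h.u_pos i hi
    have pv := h.v_pos hi
    refine Real.sqrt_le_sqrt (inv_anti₀ (by positivity) ?_)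
    have a1 : c * u i ≤ u i - if i = 1 then 0 else u (i - 1) := by
      split_ifs with h1
      · nlinarith
      · refine hu i ?_
        rw [Finset.mem_Icc] at hi ⊢
        omega
    have a2 : c * v i ≤ v j - v (j + 1) := by
      refine le_trans ?_ (hv j hj)
      have := h.v_anti (i := j) (j := i) (Finset.mem_Icc.1 hj).1 hji
        (by rw [Finset.mem_Icc] at hi; omega)
      gcongr
    calc c ^ d * (u i * v i ^ (d - 1)) = c * u i * (c * v i) ^ (d - 1) := by
          rw [mul_pow]
          have : c ^ d = c * c ^ (d - 1) := by
            rw [← pow_succ', Nat.sub_add_cancel NeZero.one_le]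
          rw [this]
          ring
      _ ≤ stepVol d u v i j := by
          unfold stepVol
          gcongr
          exact le_trans (by positivity) a1
  have split : Finset.Icc 1 r = insert 1 (Finset.Icc 2 r) := by
    ext i
    have := h.two_le
    simp only [Finset.mem_Icc, Finset.mem_insert]
    omega
  have sum2 : ∑ i ∈ Finset.Icc 2 r, (√(stepVol d u v i i)⁻¹ + √(stepVol d u v i (i - 1))⁻¹) ≤
      ∑ i ∈ Finset.Icc 2 r, 2 * √((c ^ d * (u i * v i ^ (d - 1)))⁻¹) := by
    refine Finset.sum_le_sum fun i hi => ?_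
    rw [Finset.mem_Icc] at hi
    have m1 : i ∈ Finset.Icc 1 r := by rw [Finset.mem_Icc]; omega
    have m2 : i - 1 ∈ Finset.Icc 1 r := by rw [Finset.mem_Icc]; omega
    have b1 := key i m1 i m1 le_rfl
    have b2 := key i m1 _ m2 (by omega)
    linarith
  have b0 := key 1 h.one_mem 1 h.one_mem le_rfl
  rw [split, Finset.sum_insert (by simp), mul_add, Finset.mul_sum]
  unfold stepNorm
  have := Real.sqrt_nonneg ((c ^ d * (u 1 * v 1 ^ (d - 1)))⁻¹)
  linarith

/-- The radius is `√d λ^(1/(γβ))`. Then the transversal slope `14 L R^(β-1)`, raised to the power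
`γ`, has order `λ^((β-1)/β)`. A bound `λ^(1/β)` on the sum of `v^γ` is therefore exactly what keeps
the remainder of order `λ`. -/
lemma isWeightFamily_step {L₁ L₂ : ℝ} (hγ : 1 < γ) (hγ2 : γ ≤ 2) (hβ : 1 < β) (hβ2 : β ≤ 2)
    (hL₁ : 0 ≤ L₁) (hL₂ : 0 ≤ L₂) {r : ℝ → ℕ} {u v : ℝ → ℕ → ℝ} {e c C C' : ℝ} {N : ℝ → ℝ}
    (he : 0 ≤ e) (hc : 0 < c) (hC : 0 < C) (hC' : 0 < C')
    (H : ∀ᶠ l in 𝓝[>] (0 : ℝ), StepOrder (r l) (u l) (v l) ∧ 2 * (r l : ℝ) ≤ N l ∧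
      u l (r l) ≤ l ^ (1 / (γ * β)) ∧ v l 1 ≤ l ^ (1 / (γ * β)) ∧
      u l 1 ^ γ ≤ C * l ∧ ∑ i ∈ Finset.Icc 2 (r l), u l i ^ β ≤ C * l ∧ v l (r l) ^ β ≤ C * l ∧
      ∑ i ∈ Finset.Icc 2 (r l), u l i ^ (γ - 1) * v l (i - 1) ^ β ≤ C * l ∧
      ∑ i ∈ Finset.Icc 2 (r l), v l (i - 1) ^ γ ≤ C * l ^ (1 / β) ∧
      c * l ^ (-e / 2) ≤ normTwo (stepWeight (r l) (u l) (v l) : Space d → ℝ) ∧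
      stepNorm d (r l) (u l) (v l) ≤ C' * l ^ (-e / 2)) :
    IsWeightFamily (compositeClass d γ β L₁ L₂)
      (fun l => stepWeight (r l) (u l) (v l)) e N := by
  obtain ⟨L, hL, hl1, hl2⟩ := exists_common_radius L₁ L₂
  have hd := one_le_sqrt_dim d
  have hβ0 : 0 < β := by linarith
  have hγ0 : 0 < γ := by linarith
  set Q := (14 * L * √d ^ (β - 1)) ^ γ with hQ
  have hQ0 : 0 ≤ Q := by positivity
  refine ⟨fun l => √d * l ^ (1 / (γ * β)), tendsto_sqrt_mul_rpow d (by positivity), c, C',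
    12 * L ^ 3 * ((3 + 4 * d + 3 * d * Q) * C), hc, hC', by positivity, ?_⟩
  filter_upwards [H, eventually_Ioo] with l ⟨so, hN, hu, hv, k1, k2, k3, k4, k5, k6, k7⟩ ⟨hl, hlt⟩
  have um : ∀ i ∈ Finset.Icc 1 (r l), u l i ≤ l ^ (1 / (γ * β)) := fun i hi =>
    (so.u_mono (Finset.mem_Icc.1 hi).1 (Finset.mem_Icc.1 hi).2 le_rfl).trans hu
  have vm : ∀ i ∈ Finset.Icc 1 (r l), v l i ≤ l ^ (1 / (γ * β)) := fun i hi =>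
    (so.v_anti le_rfl (Finset.mem_Icc.1 hi).1 (by rw [Finset.mem_Icc] at hi; omega)).trans hv
  constructor
  · have := so.weightBounds um vm k6 k7
    exact ⟨this.measurable, this.bounded, this.support, this.integrable, this.integral_eq_one,
      this.normOne_le.trans hN, this.le_normTwo, this.normTwo_le⟩
  · have er : (√d * l ^ (1 / (γ * β))) ^ (β - 1) = √d ^ (β - 1) * l ^ ((β - 1) / (γ * β)) := by
      rw [Real.mul_rpow (by positivity) (by positivity), ← Real.rpow_mul hl.le, one_div_mul_eq_div]
    refine (so.smallBias (R := √d * l ^ (1 / (γ * β))) hγ hγ2 hβ hβ2 hL₁ hL₂ hL hl1 hl2 ?_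
      (by positivity) ?_ ?_).mono ?_
    · rw [er]
      refine le_trans ?_ (le_mul_of_one_le_left (by positivity)
        (Real.one_le_rpow hd (by linarith)))
      refine Real.rpow_le_rpow_of_exponent_ge hl hlt.le ?_
      rw [div_le_iff₀ (by positivity)]
      nlinarith [mul_nonneg he (mul_pos hγ0 hβ0).le]
    · exact fun i hi => (um i hi).trans (le_mul_of_one_le_left (by positivity) hd)
    · exact fun i hi => mul_le_mul_of_nonneg_left (vm i hi) (by positivity)
    · rw [mul_assoc (12 * L ^ 3)]
      refine mul_le_mul_of_nonneg_left ?_ (by positivity)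
      refine so.stepBias_le hγ hγ2 hβ hβ2 (by positivity) (le_of_eq ?_) hC.le k1 k2 k3 k4 k5
      rw [er, ← mul_assoc, Real.mul_rpow (by positivity) (by positivity), ← hQ, ← Real.rpow_mul hl.le,
        mul_assoc, ← Real.rpow_add hl]
      have : (β - 1) / (γ * β) * γ + 1 / β = 1 := by field_simp; ring
      rw [this, Real.rpow_one]

/-! ### Step weights with a fixed number of steps -/

lemma eventually_rpow_le {s t c : ℝ} (hst : t < s) (hc : 0 < c) :
    ∀ᶠ l in 𝓝[>] (0 : ℝ), l ^ s ≤ c * l ^ t := by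
  have h := (tendsto_rpow_nhdsGT (sub_pos.2 hst)).eventually (gt_mem_nhds hc)
  filter_upwards [h, eventually_Ioo] with l h1 ⟨hl, _⟩
  have : l ^ s = l ^ (s - t) * l ^ t := by
    rw [← Real.rpow_add hl]; ring_nf
  rw [this]
  exact mul_le_mul_of_nonneg_right (le_of_lt h1) (by positivity)

/-- Step weights whose sizes are fixed powers `λ ^ a_i` of `λ`. -/
lemma isWeightFamily_power {L₁ L₂ : ℝ} (hγ : 1 < γ) (hγ2 : γ ≤ 2) (hβ2 : β ≤ 2)
    (hL₁ : 0 ≤ L₁) (hL₂ : 0 ≤ L₂) (hd : 2 ≤ d) {r : ℕ} {a : ℕ → ℝ} (hr : 2 ≤ r)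
    (hγβ : γ < β) (ha1 : a 1 = 1 / γ) (har : a r = 1 / β)
    (hanti : ∀ i ∈ Finset.Icc 2 r, a i < a (i - 1))
    (hrec : ∀ i ∈ Finset.Icc 2 r, a (i - 1) ≤ 1 / β + rho d γ β * a i)
    {u v : ℝ → ℕ → ℝ} (hu : ∀ l, 0 < l → ∀ i ∈ Finset.Icc 1 r, u l i = l ^ a i)
    (hv : ∀ l, 0 < l → ∀ i ∈ Finset.Icc 2 r, v l (i - 1) = l ^ (1 / β - a i * (γ - 1) / β))
    (hvr : ∀ l, v l r = l ^ (1 / β) / 2) (hv0 : ∀ l, v l (r + 1) = 0) :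
    IsWeightFamily (compositeClass d γ β L₁ L₂) (fun l => stepWeight r (u l) (v l)) (d / β)
      fun _ => 2 * r := by
  have hγ0 : 0 < γ := by linarith
  have hβ : 1 < β := by linarith
  have hβ0 : 0 < β := by linarith
  have hd0 : (0 : ℝ) < d := by exact_mod_cast (by omega : 0 < d)
  have one_mem : 1 ∈ Finset.Icc 1 r := Finset.mem_Icc.2 ⟨le_rfl, by omega⟩
  have last_mem : r ∈ Finset.Icc 1 r := Finset.mem_Icc.2 ⟨by omega, le_rfl⟩
  have last_mem2 : r ∈ Finset.Icc 2 r := Finset.mem_Icc.2 ⟨hr, le_rfl⟩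
  have mem1 : ∀ {i}, i ∈ Finset.Icc 2 r → i ∈ Finset.Icc 1 r := fun hi => by
    rw [Finset.mem_Icc] at hi ⊢; omega
  have mem2 : ∀ {i}, i ∈ Finset.Icc 2 r → i - 1 ∈ Finset.Icc 1 r := fun hi => by
    rw [Finset.mem_Icc] at hi ⊢; omega
  have mono : ∀ {i j}, 1 ≤ i → i ≤ j → j ≤ r → a j ≤ a i := by
    intro i j hi hij
    induction j, hij using Nat.le_induction with
    | base => exact fun _ => le_rfl
    | succ k hk ih =>
      intro hk'
      have := hanti (k + 1) (Finset.mem_Icc.2 ⟨by omega, hk'⟩)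
      simp only [Nat.add_sub_cancel] at this
      exact this.le.trans (ih (by omega))
  have le_a : ∀ i ∈ Finset.Icc 1 r, 1 / β ≤ a i := fun i hi => by
    rw [← har]; exact mono (Finset.mem_Icc.1 hi).1 (Finset.mem_Icc.1 hi).2 le_rfl
  have a_le : ∀ i ∈ Finset.Icc 1 r, a i ≤ 1 / γ := fun i hi => by
    rw [← ha1]; exact mono le_rfl (Finset.mem_Icc.1 hi).1 (Finset.mem_Icc.1 hi).2
  have hhalf : (0 : ℝ) < 1 / 2 := by norm_num
  have E1 : ∀ᶠ l in 𝓝[>] (0 : ℝ), ∀ i ∈ Finset.Icc 2 r, l ^ a (i - 1) ≤ 1 / 2 * l ^ a i :=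
    (Finset.eventually_all _).2 fun i hi => eventually_rpow_le (hanti i hi) hhalf
  have wlt : ∀ i ∈ Finset.Icc 2 r, i - 1 ∈ Finset.Icc 2 r →
      1 / β - a (i - 1) * (γ - 1) / β < 1 / β - a i * (γ - 1) / β := fun i hi _ => by
    have h1 := hanti i hi
    have h2 : a i * (γ - 1) < a (i - 1) * (γ - 1) := by
      have : 0 < γ - 1 := by linarith
      gcongr
    have h3 := div_lt_div_of_pos_right h2 hβ0
    linarith
  have E2 : ∀ᶠ l in 𝓝[>] (0 : ℝ), ∀ i ∈ Finset.Icc 2 r, i - 1 ∈ Finset.Icc 2 r →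
      l ^ (1 / β - a i * (γ - 1) / β) ≤ 1 / 2 * l ^ (1 / β - a (i - 1) * (γ - 1) / β) := by
    refine (Finset.eventually_all _).2 fun i hi => ?_
    by_cases h : i - 1 ∈ Finset.Icc 2 r
    · filter_upwards [eventually_rpow_le (wlt i hi h) hhalf] with l hl _ using hl
    · exact Eventually.of_forall fun l h' => absurd h' h
  refine isWeightFamily_step (e := d / β) (c := √2⁻¹) (C := r + 1)
    (C' := 2 * r * √((1 / 2) ^ d * (1 / 2) ^ d)⁻¹) (r := fun _ => r)
    hγ hγ2 hβ hβ2 hL₁ hL₂ (by positivity) (by positivity) (by positivity)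
    (by have : 0 < r := by omega
        positivity) ?_
  filter_upwards [E1, E2, eventually_Ioo] with l e1 e2 ⟨hl, hl1⟩
  have hu := hu l hl
  have hv := hv l hl
  have hvr := hvr l
  have hv0 := hv0 l
  have du : ∀ i ∈ Finset.Icc 2 r, 1 / 2 * u l i ≤ u l i - u l (i - 1) := fun i hi => by
    rw [hu i (mem1 hi), hu _ (mem2 hi)]
    have := e1 i hi
    linarith
  have vlow : ∀ i ∈ Finset.Icc 2 r, l ^ (1 / β) ≤ v l (i - 1) := fun i hi => by
    rw [hv i hi]
    refine Real.rpow_le_rpow_of_exponent_ge hl hl1.le ?_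
    have : 0 ≤ a i * (γ - 1) / β := by
      have := le_a i (mem1 hi)
      have : 0 ≤ a i := le_trans (by positivity) this
      have : 0 ≤ γ - 1 := by linarith
      positivity
    linarith
  have lpos : 0 < l ^ (1 / β) := by positivity
  have dv : ∀ j ∈ Finset.Icc 1 r, 1 / 2 * v l j ≤ v l j - v l (j + 1) := fun j hj => by
    rw [Finset.mem_Icc] at hj
    rcases lt_or_eq_of_le hj.2 with h | h
    · have m : j + 1 ∈ Finset.Icc 2 r := Finset.mem_Icc.2 ⟨by omega, by omega⟩
      have v1 := vlow _ m
      simp only [Nat.add_sub_cancel] at v1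
      rcases lt_or_eq_of_le (show j + 1 ≤ r by omega) with h' | h'
      · have m' : j + 2 ∈ Finset.Icc 2 r := Finset.mem_Icc.2 ⟨by omega, by omega⟩
        have w1 := hv _ m
        have w2 := hv _ m'
        have := e2 (j + 2) m' (by rwa [show j + 2 - 1 = j + 1 by omega])
        rw [show j + 2 - 1 = j + 1 by omega] at this w2
        rw [show j + 1 - 1 = j by omega] at w1
        rw [← w1, ← w2] at this
        linarith
      · rw [h', hvr]
        linarith
    · rw [h, hv0, hvr]
      linarith
  have so : StepOrder r (u l) (v l) := by
    have vnn : ∀ i ∈ Finset.Icc 1 r, 0 < v l i := fun i hi => by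
      rw [Finset.mem_Icc] at hi
      rcases lt_or_eq_of_le hi.2 with h | h
      · have := vlow (i + 1) (Finset.mem_Icc.2 ⟨by omega, by omega⟩)
        simp only [Nat.add_sub_cancel] at this
        linarith
      · rw [h, hvr]
        linarith
    refine ⟨hr, fun i hi => ?_, fun i hi => ?_, fun i hi => ?_, fun i hi => ?_, hv0⟩
    · rw [hu i hi]; positivity
    · have h1 := du i hi
      have h2 : 0 < u l i := by rw [hu i (mem1 hi)]; positivity
      linarith
    · rw [Finset.mem_Icc] at hi
      rcases lt_or_eq_of_le hi.2 with h | h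
      · exact (vnn i (Finset.mem_Icc.2 ⟨hi.1, by omega⟩)).le
      · rw [h, hv0]
    · have h1 := dv i hi
      have h2 := vnn i hi
      linarith
  have rβ : (l ^ (1 / β)) ^ β = l := by
    rw [← Real.rpow_mul hl.le, one_div_mul_cancel hβ0.ne', Real.rpow_one]
  have small : ∀ i ∈ Finset.Icc 1 r, u l i ≤ l ^ (1 / β) := fun i hi => by
    rw [hu i hi]
    exact Real.rpow_le_rpow_of_exponent_ge hl hl1.le (le_a i hi)
  have e1γ : 1 / (γ * β) ≤ 1 / β := one_div_le_one_div_of_le hβ0 (by nlinarith)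
  -- The exponent decreases in `a i`, and at its largest value `1/γ` it equals `1/(γβ)`.
  have vup : ∀ i ∈ Finset.Icc 2 r, v l (i - 1) ≤ l ^ (1 / (γ * β)) := fun i hi => by
    rw [hv i hi]
    refine Real.rpow_le_rpow_of_exponent_ge hl hl1.le ?_
    have h1 : a i * (γ - 1) ≤ 1 / γ * (γ - 1) :=
      mul_le_mul_of_nonneg_right (a_le i (mem1 hi)) (by linarith)
    have h2 := div_le_div_of_nonneg_right h1 hβ0.le
    have h3 : 1 / β - 1 / γ * (γ - 1) / β = 1 / (γ * β) := by field_simp; ring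
    linarith
  have sum_le : ∀ {f : ℕ → ℝ} {B : ℝ}, 0 ≤ B → (∀ i ∈ Finset.Icc 2 r, f i ≤ B) →
      ∑ i ∈ Finset.Icc 2 r, f i ≤ (r + 1) * B := by
    intro f B hB hf
    refine (Finset.sum_le_card_nsmul _ _ _ hf).trans ?_
    rw [nsmul_eq_mul]
    refine mul_le_mul_of_nonneg_right ?_ hB
    rw [Nat.card_Icc]
    have : r + 1 - 2 ≤ r + 1 := by omega
    exact_mod_cast this
  have r0 : (0 : ℝ) ≤ r := Nat.cast_nonneg r
  -- For `i < r` the volume has exponent `a_i + (d-1)/β - ρ a_{i+1}`. The recursion `hrec` says that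
  -- this is at most `d/β`, the exponent of the last block.
  have vol : ∀ i ∈ Finset.Icc 1 r, (1 / 2) ^ d * l ^ (d / β) ≤ u l i * v l i ^ (d - 1) := by
    intro i hi
    have hpow : ((1 : ℝ) / 2) ^ d ≤ (1 / 2) ^ (d - 1) :=
      pow_le_pow_of_le_one (by norm_num) (by norm_num) (by omega)
    rw [Finset.mem_Icc] at hi
    rcases lt_or_eq_of_le hi.2 with h | h
    · have m : i + 1 ∈ Finset.Icc 2 r := Finset.mem_Icc.2 ⟨by omega, by omega⟩
      have w := hv _ m
      have q := hrec _ m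
      rw [show i + 1 - 1 = i by omega] at w q
      rw [hu i (Finset.mem_Icc.2 hi), w, rpow_mul_rpow_pow d hl]
      refine le_trans (mul_le_of_le_one_left (by positivity)
        (pow_le_one₀ (by norm_num) (by norm_num))) ?_
      refine Real.rpow_le_rpow_of_exponent_ge hl hl1.le ?_
      have : (d : ℝ) / β = 1 / β + ((d : ℝ) - 1) / β := by ring
      have h2 : ((d : ℝ) - 1) * (1 / β - a (i + 1) * (γ - 1) / β) =
          ((d : ℝ) - 1) / β - rho d γ β * a (i + 1) := by unfold rho; ring
      rw [this, h2]
      linarith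
    · have e : (d : ℝ) / β = 1 / β + ((d : ℝ) - 1) * (1 / β) := by ring
      have hp : (l ^ (1 / β) / 2) ^ (d - 1) = (l ^ (1 / β)) ^ (d - 1) * (1 / 2) ^ (d - 1) := by
        rw [div_eq_mul_one_div, mul_pow]
      rw [h, hu r last_mem, hvr, har, hp, e, ← rpow_mul_rpow_pow d hl]
      calc _ ≤ (1 / 2) ^ (d - 1) * (l ^ (1 / β) * (l ^ (1 / β)) ^ (d - 1)) :=
            mul_le_mul_of_nonneg_right hpow (by positivity)
        _ = _ := by ring
  refine ⟨so, le_rfl, ?_, ?_, ?_, ?_, ?_, ?_, ?_, ?_, ?_⟩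
  · exact (small r last_mem).trans (Real.rpow_le_rpow_of_exponent_ge hl hl1.le e1γ)
  · exact vup 2 (Finset.mem_Icc.2 ⟨le_rfl, hr⟩)
  · rw [hu 1 one_mem, ha1, ← Real.rpow_mul hl.le, one_div_mul_cancel hγ0.ne', Real.rpow_one]
    nlinarith
  · refine sum_le hl.le fun i hi => ?_
    exact (Real.rpow_le_rpow (so.u_pos i (mem1 hi)).le (small i (mem1 hi)) hβ0.le).trans rβ.le
  · rw [hvr]
    calc (l ^ (1 / β) / 2) ^ β ≤ (l ^ (1 / β)) ^ β := by gcongr; linarith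
      _ = l := rβ
      _ ≤ (r + 1) * l := by nlinarith
  · refine sum_le hl.le fun i hi => ?_
    rw [hu i (mem1 hi), hv i hi, ← Real.rpow_mul hl.le, ← Real.rpow_mul hl.le, ← Real.rpow_add hl]
    -- The exponent of `v (i - 1)` is chosen to make the mixed term `u_i^(γ-1) v_{i-1}^β` exactly
    -- `λ`.
    have : a i * (γ - 1) + (1 / β - a i * (γ - 1) / β) * β = 1 := by field_simp; ring
    rw [this, Real.rpow_one]
  · refine sum_le lpos.le fun i hi => ?_
    refine (Real.rpow_le_rpow (so.v_pos (mem2 hi)).le (vup i hi) hγ0.le).trans (le_of_eq ?_)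
    rw [← Real.rpow_mul hl.le]
    congr 1
    field_simp
  · refine le_trans (le_of_eq ?_) (so.le_normTwo_last hd)
    have e : (d : ℝ) / β = 1 / β + ((d : ℝ) - 1) * (1 / β) := by ring
    have : (2 : ℝ) ^ d * (u l r * v l r ^ (d - 1)) = 2 * l ^ ((d : ℝ) / β) := by
      rw [hu r last_mem, hvr, har, div_pow, e, ← rpow_mul_rpow_pow d hl]
      have : (2 : ℝ) ^ d = 2 * 2 ^ (d - 1) := by
        rw [← pow_succ', Nat.sub_add_cancel NeZero.one_le]
      rw [this]
      field_simp
    rw [this, sqrt_inv_rpow hl (by norm_num)]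
  · refine (so.stepNorm_le hhalf (by norm_num) du dv).trans ?_
    have : ∀ i ∈ Finset.Icc 1 r, √(((1 / 2) ^ d * (u l i * v l i ^ (d - 1)))⁻¹) ≤
        √((1 / 2) ^ d * (1 / 2) ^ d)⁻¹ * l ^ (-(d / β) / 2) := fun i hi => by
      rw [← sqrt_inv_rpow hl (by positivity), mul_assoc]
      refine Real.sqrt_le_sqrt (inv_anti₀ (by positivity) ?_)
      exact mul_le_mul_of_nonneg_left (vol i hi) (by positivity)
    refine (mul_le_mul_of_nonneg_left (Finset.sum_le_card_nsmul _ _ _ this) (by norm_num)).trans ?_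
    rw [Nat.card_Icc, nsmul_eq_mul, Nat.add_sub_cancel]
    exact le_of_eq (by ring)

end Step

/-! ### The exponents of the two-step and power weights -/

variable {d : ℕ} [NeZero d] {γ β L₁ L₂ : ℝ}

omit [NeZero d] in
lemma alphaSeq_zero : alphaSeq d γ β 0 = 1 / β := by simp [alphaSeq]

omit [NeZero d] in
lemma alphaSeq_succ (k : ℕ) : alphaSeq d γ β (k + 1) = 1 / β + rho d γ β * alphaSeq d γ β k := by
  unfold alphaSeq
  rw [Finset.sum_range_succ', mul_left_comm, Finset.mul_sum]
  simp only [pow_succ', pow_zero]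
  ring

omit [NeZero d] in
lemma rho_pos (hd : 2 ≤ d) (hγ : 1 < γ) (hβ : 0 < β) : 0 < rho d γ β := by
  unfold rho
  have : (2 : ℝ) ≤ d := by exact_mod_cast hd
  have h1 : 0 < (d : ℝ) - 1 := by linarith
  have h2 : 0 < γ - 1 := by linarith
  positivity

omit [NeZero d] in
lemma alphaSeq_lt_succ (hρ : 0 < rho d γ β) (hβ : 0 < β) (k : ℕ) :
    alphaSeq d γ β k < alphaSeq d γ β (k + 1) := by
  unfold alphaSeq
  rw [Finset.sum_range_succ _ (k + 1)]
  have : 0 < rho d γ β ^ (k + 1) := by positivity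
  have : 0 < β⁻¹ := by positivity
  nlinarith

omit [NeZero d] in
/-- The sequence `α_k` reaches `1 / γ` in the zone of the rate `d / β`. -/
lemma exists_le_alphaSeq (hγ : 1 < γ) (hβ : 0 < β) (hρ : 0 < rho d γ β)
    (h : β < (d : ℝ) * (γ - 1) + 1) : ∃ k, 1 / γ ≤ alphaSeq d γ β k := by
  by_contra hn
  push Not at hn
  have hpos : ∀ k, 0 ≤ alphaSeq d γ β k := fun k => by unfold alphaSeq; positivity
  -- The increment of the recursion at `x` is `1/β - (1 - ρ) x`. It is at least `1/β` if `ρ ≥ 1`;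
  -- otherwise, for `x ≤ 1/γ`, it is at least its value at `1/γ`, which is positive precisely
  -- because `β < d(γ-1) + 1`. So a sequence staying below `1/γ` would grow linearly.
  set η := min (1 / β) (1 / β - (1 - rho d γ β) * (1 / γ)) with hη
  have hη0 : 0 < η := by
    refine lt_min (by positivity) ?_
    have e : 1 / β - (1 - rho d γ β) * (1 / γ) = ((d : ℝ) * (γ - 1) + 1 - β) / (γ * β) := by
      unfold rho
      field_simp
      ring
    rw [e]
    exact div_pos (by linarith) (by positivity)
  have step : ∀ k, alphaSeq d γ β k + η ≤ alphaSeq d γ β (k + 1) := by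
    intro k
    rw [alphaSeq_succ]
    have h1 := hpos k
    have h2 := (hn k).le
    rcases le_or_gt 1 (rho d γ β) with h3 | h3
    · have := min_le_left (1 / β) (1 / β - (1 - rho d γ β) * (1 / γ))
      nlinarith
    · have := min_le_right (1 / β) (1 / β - (1 - rho d γ β) * (1 / γ))
      nlinarith
  have lin : ∀ k : ℕ, k * η ≤ alphaSeq d γ β k := by
    intro k
    induction k with
    | zero => simpa using hpos 0
    | succ k ih =>
      have := step k
      push_cast
      linarith
  obtain ⟨k, hk⟩ := exists_nat_gt (1 / γ / η)
  rw [div_lt_iff₀ hη0] at hk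
  linarith [lin k, hn k]

/-- With exponents `1/γ, 1/β` the single recursion inequality reads `1/γ ≤ 1/β + ρ/β`, which is
`hρ`. The exponent of `v 1` is `1/β - (γ-1)/β²`. -/
lemma isWeightFamily_twoStep (hγ : 1 < γ) (hγβ : γ < β) (hβ2 : β ≤ 2) (hL₁ : 0 ≤ L₁)
    (hL₂ : 0 ≤ L₂) (hd : 2 ≤ d) (hρ : (β - γ) / γ ≤ rho d γ β) :
    IsWeightFamily (compositeClass d γ β L₁ L₂) (fun l => twoStepWeight γ β l) (d / β)
      fun _ => 2 * (2 : ℕ) := by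
  have hβ0 : 0 < β := by linarith
  have hγ0 : 0 < γ := by linarith
  have two : ∀ {i}, i ∈ Finset.Icc 2 2 → i = 2 := fun hi => by simpa using hi
  refine isWeightFamily_power (r := 2) (a := fun i => if i = 1 then 1 / γ else 1 / β) hγ
    (by linarith) hβ2 hL₁ hL₂ hd le_rfl hγβ (by simp) (by simp) (fun i hi => ?_) (fun i hi => ?_)
    (fun l hl i hi => ?_) (fun l hl i hi => ?_) (fun l => by simp) (fun l => by simp)
  · rw [two hi]
    simpa using inv_strictAnti₀ hγ0 hγβ
  · rw [two hi]
    simp only [Nat.add_one_sub_one, if_true, OfNat.ofNat_ne_one, if_false]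
    rw [div_le_iff₀ hγ0] at hρ
    rw [← sub_nonneg]
    have : 1 / β + rho d γ β * (1 / β) - 1 / γ = (rho d γ β * γ - (β - γ)) / (γ * β) := by
      field_simp
      ring
    rw [this]
    exact div_nonneg (by linarith) (by positivity)
  · split_ifs <;> rfl
  · rw [two hi]
    simp only [Nat.add_one_sub_one, if_true, OfNat.ofNat_ne_one, if_false]
    congr 1
    field_simp
    ring

/-- `α_{k+1} = 1/β + ρ α_k` is the extremal case of the volume recursion. It is run backwards from
`1/β` and stopped at the first value reaching `1/γ`; replacing that value by `1/γ` keeps the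
inequality. -/
lemma isWeightFamily_powerWeight (hγ : 1 < γ) (hγβ : γ < β) (hβ2 : β ≤ 2) (hL₁ : 0 ≤ L₁)
    (hL₂ : 0 ≤ L₂) (hd : 2 ≤ d) (hex : ∃ k, 1 / γ ≤ alphaSeq d γ β k) :
    ∃ r : ℕ, IsWeightFamily (compositeClass d γ β L₁ L₂) (fun l => powerWeight γ β l) (d / β)
      fun _ => 2 * r := by
  have hβ0 : 0 < β := by linarith
  have hγ0 : 0 < γ := by linarith
  have hρ0 := rho_pos hd hγ hβ0
  by_cases hρ : (β - γ) / γ ≤ rho d γ β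
  · refine ⟨2, (isWeightFamily_twoStep hγ hγβ hβ2 hL₁ hL₂ hd hρ).congr ?_⟩
    exact Eventually.of_forall fun l => if_pos hρ
  have hlt : 1 / β < 1 / γ := one_div_lt_one_div_of_lt hγ0 hγβ
  set r := powerSteps d γ β with hr
  have hne : {r : ℕ | 2 ≤ r ∧ 1 / γ ≤ alphaSeq d γ β (r - 1)}.Nonempty := by
    obtain ⟨k, hk⟩ := hex
    refine ⟨k + 1, ?_, by simpa using hk⟩
    rcases Nat.eq_zero_or_pos k with rfl | h
    · rw [alphaSeq_zero] at hk
      linarith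
    · omega
  have hmem : 2 ≤ r ∧ 1 / γ ≤ alphaSeq d γ β (r - 1) := Nat.sInf_mem hne
  -- By minimality of `r`, except when `r = 2`, where the constraint `2 ≤ r` hides the predecessor
  -- and `α_0 = 1/β < 1/γ` is used directly.
  have hmin : alphaSeq d γ β (r - 2) < 1 / γ := by
    rcases eq_or_lt_of_le hmem.1 with h | h
    · rw [← h, Nat.sub_self, alphaSeq_zero]
      exact hlt
    · have h1 : r - 1 < sInf {r : ℕ | 2 ≤ r ∧ 1 / γ ≤ alphaSeq d γ β (r - 1)} := by
        change r - 1 < r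
        omega
      have := Nat.notMem_of_lt_sInf h1
      simp only [Set.mem_ofPred_eq, not_and, not_le] at this
      have := this (by omega)
      rwa [show r - 1 - 1 = r - 2 by omega] at this
  refine ⟨r, (isWeightFamily_power (r := r)
    (a := fun i => if i = 1 then 1 / γ else alphaSeq d γ β (r - i)) (u := powerU d γ β)
    (v := powerV d γ β) hγ (by linarith) hβ2
    hL₁ hL₂ hd hmem.1 hγβ (by simp) ?_ (fun i hi => ?_) (fun i hi => ?_)
    (fun l hl i hi => ?_) (fun l hl i hi => ?_) (fun l => ?_) (fun l => ?_)).congr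
      (Eventually.of_forall fun l => if_neg hρ)⟩
  · have : r ≠ 1 := by omega
    simp only [this, if_false, Nat.sub_self, alphaSeq_zero]
  · rw [Finset.mem_Icc] at hi
    rcases eq_or_lt_of_le hi.1 with h | h
    · rw [← h]
      simpa using hmin
    · have h1 : i ≠ 1 := by omega
      have h2 : i - 1 ≠ 1 := by omega
      simp only [h1, h2, if_false]
      rw [show r - (i - 1) = r - i + 1 by omega]
      exact alphaSeq_lt_succ hρ0 hβ0 _
  · rw [Finset.mem_Icc] at hi
    rcases eq_or_lt_of_le hi.1 with h | h
    · rw [← h]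
      simp only [Nat.add_one_sub_one, if_true, OfNat.ofNat_ne_one, if_false]
      rw [← alphaSeq_succ, show r - 2 + 1 = r - 1 by omega]
      exact hmem.2
    · have h1 : i ≠ 1 := by omega
      have h2 : i - 1 ≠ 1 := by omega
      simp only [h1, h2, if_false]
      rw [show r - (i - 1) = r - i + 1 by omega, alphaSeq_succ]
  · unfold powerU
    split_ifs <;> rfl
  · rw [Finset.mem_Icc] at hi
    have h1 : i - 1 < powerSteps d γ β := by omega
    have h2 : i ≠ 1 := by omega
    unfold powerV
    rw [if_pos h1, show i - 1 + 1 = i by omega, powerU]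
    simp only [h2, if_false]
    rw [← Real.rpow_mul hl.le, ← Real.rpow_add hl]
    congr 1
    ring
  · unfold powerV
    rw [if_neg (by omega), if_pos rfl]
  · unfold powerV
    rw [if_neg (by omega), if_neg (by omega)]

variable {d : ℕ} [NeZero d] {γ β L₁ L₂ : ℝ}

/-! ### Step weights with a growing number of steps -/

section Golden

lemma golden_sq : ((√5 + 1) / 2) ^ 2 = (√5 + 1) / 2 + (1 : ℝ) := by
  have : √(5 : ℝ) ^ 2 = 5 := Real.sq_sqrt (by norm_num)
  nlinarith

lemma one_lt_golden : (1 : ℝ) < (√5 + 1) / 2 := by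
  have : (1 : ℝ) < √5 := by
    rw [Real.lt_sqrt (by norm_num)]
    norm_num
  linarith

lemma golden_lt_two : (√5 + 1) / 2 < (2 : ℝ) := by
  have : √5 < (3 : ℝ) := by
    rw [Real.sqrt_lt' (by norm_num)]
    norm_num
  linarith

lemma exp_half_log_golden : Real.exp (Real.log ((√5 + 1) / 2) / 2) = √((√5 + 1) / 2) := by
  rw [Real.exp_half, Real.exp_log (by linarith [one_lt_golden])]

end Golden

section Sums

/-- Bound `exp (-x)` by `1/x` and telescope the reciprocals of a geometric sequence. The bound does
not depend on `r`, so a growing number of steps costs nothing in bias or `L₂`-norm. -/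
lemma sum_exp_neg_le {E : ℕ → ℝ} {q η s : ℝ} (hη : 0 < η) (hq : 1 + η ≤ q) (hs : 0 < s)
    (h1 : E 1 = 1) (hE : ∀ i, E (i + 1) = q * E i) (r : ℕ) :
    ∑ i ∈ Finset.Icc 2 r, Real.exp (-(s * E i)) ≤ 1 / (s * η) := by
  have pos : ∀ i, 0 < E (i + 1) := by
    intro i
    induction i with
    | zero => rw [h1]; norm_num
    | succ k ih =>
      rw [hE]
      have : 0 < q := by linarith
      positivity
  have tele : ∀ m : ℕ, ∑ i ∈ Finset.Icc 2 (m + 1), 1 / E i ≤ 1 / η * (1 - 1 / E (m + 1)) := by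
    intro m
    induction m with
    | zero => simp [h1]
    | succ k ih =>
      rw [Finset.sum_Icc_succ_top (by omega)]
      have p := pos k
      have p' := pos (k + 1)
      have e := hE (k + 1)
      have hq0 : 0 < q := by linarith
      have : 1 / E (k + 1 + 1) ≤ 1 / η * (1 / E (k + 1) - 1 / E (k + 1 + 1)) := by
        rw [e]
        have : 1 / E (k + 1) - 1 / (q * E (k + 1)) = (q - 1) * (1 / (q * E (k + 1))) := by
          field_simp
        rw [this, ← mul_assoc]
        refine le_mul_of_one_le_left (by positivity) ?_
        rw [one_div_mul_eq_div, le_div_iff₀ hη]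
        linarith
      linarith
  rcases Nat.eq_zero_or_pos r with rfl | hr
  · simp only [Nat.ofNat_pos, Finset.Icc_eq_empty_of_lt, Finset.sum_empty]
    positivity
  obtain ⟨m, rfl⟩ : ∃ m, r = m + 1 := ⟨r - 1, by omega⟩
  calc ∑ i ∈ Finset.Icc 2 (m + 1), Real.exp (-(s * E i))
      ≤ ∑ i ∈ Finset.Icc 2 (m + 1), 1 / s * (1 / E i) := by
        refine Finset.sum_le_sum fun i hi => ?_
        rw [Finset.mem_Icc] at hi
        have p : 0 < E i := by
          have := pos (i - 1)
          rwa [show i - 1 + 1 = i by omega] at this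
        rw [Real.exp_neg, one_div_mul_one_div, one_div]
        refine inv_anti₀ (by positivity) ?_
        linarith [Real.add_one_le_exp (s * E i)]
    _ = 1 / s * ∑ i ∈ Finset.Icc 2 (m + 1), 1 / E i := by rw [Finset.mul_sum]
    _ ≤ 1 / s * (1 / η) := by
        refine mul_le_mul_of_nonneg_left ((tele m).trans ?_) (by positivity)
        refine mul_le_of_le_one_right (by positivity) ?_
        have := pos m
        have : 0 ≤ 1 / E (m + 1) := by positivity
        linarith
    _ = 1 / (s * η) := one_div_mul_one_div s η

/-- Each size is at most `1 - c` times the next, so the powers, with `β ≥ 1`, sum geometrically to a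
multiple of the last one. -/
lemma sum_rpow_le_of_geometric {u : ℕ → ℝ} {c : ℝ} (hc : 0 < c) (hc1 : c ≤ 1) (hβ : 1 ≤ β) {r : ℕ}
    (hr : 1 ≤ r) (hu0 : ∀ i ∈ Finset.Icc 1 r, 0 ≤ u i)
    (hu : ∀ i ∈ Finset.Icc 2 r, c * u i ≤ u i - u (i - 1)) :
    ∑ i ∈ Finset.Icc 2 r, u i ^ β ≤ c⁻¹ * u r ^ β := by
  have key : ∀ m, m + 1 ≤ r → ∑ i ∈ Finset.Icc 2 (m + 1), u i ^ β ≤ c⁻¹ * u (m + 1) ^ β := by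
    intro m
    induction m with
    | zero =>
      intro h
      have := hu0 1 (Finset.mem_Icc.2 ⟨le_rfl, hr⟩)
      simp only [zero_add, Nat.one_lt_ofNat, Finset.Icc_eq_empty_of_lt, Finset.sum_empty]
      positivity
    | succ k ih =>
      intro h
      have ih := ih (by omega)
      rw [Finset.sum_Icc_succ_top (by omega)]
      have p1 := hu0 (k + 1) (Finset.mem_Icc.2 ⟨by omega, by omega⟩)
      have p2 := hu0 (k + 1 + 1) (Finset.mem_Icc.2 ⟨by omega, by omega⟩)
      have s := hu (k + 1 + 1) (Finset.mem_Icc.2 ⟨by omega, by omega⟩)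
      rw [Nat.add_sub_cancel] at s
      have s2 : u (k + 1) ≤ (1 - c) * u (k + 1 + 1) := by linarith
      have s3 : u (k + 1) ^ β ≤ (1 - c) * u (k + 1 + 1) ^ β := by
        refine (Real.rpow_le_rpow p1 s2 (by linarith)).trans ?_
        rw [Real.mul_rpow (by linarith) p2]
        refine mul_le_mul_of_nonneg_right ?_ (by positivity)
        rcases eq_or_lt_of_le hc1 with h | h
        · rw [h, sub_self, Real.zero_rpow (by linarith)]
        · exact (Real.rpow_le_rpow_of_exponent_ge (by linarith) (by linarith) hβ).trans
            (Real.rpow_one _).le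
      have s4 := mul_le_mul_of_nonneg_left s3 (inv_nonneg.2 hc.le)
      have e : c⁻¹ * ((1 - c) * u (k + 1 + 1) ^ β) =
          c⁻¹ * u (k + 1 + 1) ^ β - u (k + 1 + 1) ^ β := by
        field_simp
      linarith
  have := key (r - 1) (by omega)
  rwa [show r - 1 + 1 = r by omega] at this

end Sums

/-- The exponent and the number of steps of the weight for small `λ`. -/
lemma eventually_expSteps (hγ : 1 < γ) (hγβ : γ < β) :
    ∀ᶠ l in 𝓝[>] (0 : ℝ), 0 < logLog γ β l ∧ 3 ≤ expSteps γ β l ∧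
      Real.log ((√5 + 1) / 2) / 2 / 2 ≤ expAlpha γ β l ∧
      expAlpha γ β l ≤ Real.log ((√5 + 1) / 2) / 2 ∧
      Real.exp (expAlpha γ β l * ((expSteps γ β l : ℝ) - 1)) =
        (γ - 1) * (β - γ) / (γ * β ^ 2) * Real.log (1 / l) ∧
      Real.log ((√5 + 1) / 2) / 2 * ((expSteps γ β l : ℝ) - 2) ≤ Real.log (Real.log (1 / l)) ∧
      1 ≤ Real.log (Real.log (1 / l)) := by
  set A := Real.log ((√5 + 1) / 2) / 2 with hA
  have hA0 : 0 < A := half_pos (Real.log_pos one_lt_golden)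
  set c := (γ - 1) * (β - γ) / (γ * β ^ 2) with hc
  have g1 : 0 < γ - 1 := by linarith
  have g2 : 0 < β - γ := by linarith
  have g3 : 0 < β := by linarith
  have hc0 : 0 < c := by positivity
  have hc1 : c ≤ 1 := by
    rw [hc, div_le_one (by positivity)]
    nlinarith [mul_pos g1 g2, mul_pos g1 g3]
  have t1 : Tendsto (fun l : ℝ => Real.log (1 / l)) (𝓝[>] 0) atTop := by
    have h : Tendsto (fun l : ℝ => 1 / l) (𝓝[>] 0) atTop := by
      simpa only [one_div] using tendsto_inv_nhdsGT_zero (𝕜 := ℝ)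
    exact Real.tendsto_log_atTop.comp h
  have t2 : Tendsto (fun l : ℝ => logLog γ β l) (𝓝[>] 0) atTop :=
    Real.tendsto_log_atTop.comp (t1.const_mul_atTop hc0)
  have t3 : Tendsto (fun l : ℝ => Real.log (Real.log (1 / l))) (𝓝[>] 0) atTop :=
    Real.tendsto_log_atTop.comp t1
  filter_upwards [t2.eventually_ge_atTop (2 * A), t1.eventually_gt_atTop 0,
    t3.eventually_ge_atTop 1] with l hV hlog hll
  set V := logLog γ β l with hVdef
  have hV0 : 0 < V := by linarith
  have hVle : V ≤ Real.log (Real.log (1 / l)) := by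
    refine Real.log_le_log (by positivity) ?_
    exact mul_le_of_le_one_left hlog.le hc1
  have hne : {s : ℕ | 1 < s ∧ V / ((s : ℝ) - 1) < A}.Nonempty := by
    obtain ⟨n, hn⟩ := exists_nat_gt (V / A)
    refine ⟨n + 2, by omega, ?_⟩
    have hn0 : (0 : ℝ) ≤ n := Nat.cast_nonneg n
    rw [div_lt_iff₀ hA0] at hn
    push_cast
    rw [div_lt_iff₀ (by linarith)]
    nlinarith
  set r := expSteps γ β l with hr
  have hmem : 1 < r ∧ V / ((r : ℝ) - 1) < A := Nat.sInf_mem hne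
  -- `V ≥ 2 A` excludes `r = 2`, so that minimality can be applied to `r - 1 > 1`.
  have hr3 : 3 ≤ r := by
    by_contra h
    have : r = 2 := by omega
    have h2 := hmem.2
    rw [this] at h2
    norm_num at h2
    linarith
  -- Minimality gives `V ≥ A (r - 2)`. With `r ≥ 3` this yields both `α = V/(r-1) ≥ A/2` and the
  -- bound on `r` by `V ≤ ln ln (1/λ)`.
  have hmin : A ≤ V / ((r : ℝ) - 2) := by
    have h1 : r - 1 < sInf {s : ℕ | 1 < s ∧ V / ((s : ℝ) - 1) < A} := by
      change r - 1 < r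
      omega
    have := Nat.notMem_of_lt_sInf h1
    simp only [Set.mem_ofPred_eq, not_and, not_lt] at this
    have := this (by omega)
    rw [Nat.cast_sub (by omega), Nat.cast_one] at this
    rwa [sub_sub, one_add_one_eq_two] at this
  have hr3' : (3 : ℝ) ≤ r := by exact_mod_cast hr3
  rw [le_div_iff₀ (by linarith)] at hmin
  have hα : expAlpha γ β l = V / ((r : ℝ) - 1) := rfl
  refine ⟨hV0, hr3, ?_, ?_, ?_, hmin.trans hVle, hll⟩
  · rw [hα, le_div_iff₀ (by linarith)]
    nlinarith
  · rw [hα]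
    exact hmem.2.le
  · rw [hα, div_mul_cancel₀ _ (by linarith : (r : ℝ) - 1 ≠ 0)]
    exact Real.exp_log (by positivity)

omit [NeZero d] in
-- Let `φ` be the golden ratio, `φ² = φ + 1`. If `ρ ≥ 1/φ`, then `(1 + ρ) ρ ≥ 1`, whereas `(β - γ)/γ
-- < 1` because `β ≤ 2 < 2γ`. Hence `ρ φ < 1`, which rearranges to the claim.
lemma golden_mul_rho_lt (hρ0 : 0 ≤ rho d γ β) (hγ : 1 < γ) (hγβ : γ < β) (hβ2 : β ≤ 2)
    (hρ : (1 + rho d γ β) * rho d γ β < (β - γ) / γ) :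
    ((d : ℝ) - 1) * ((√5 + 1) / 2) < β / (γ - 1) := by
  have h1 : (β - γ) / γ < 1 := by
    rw [div_lt_one (by linarith)]
    linarith
  have g := one_lt_golden
  have g2 := golden_sq
  set φ : ℝ := (√5 + 1) / 2
  have h2 : rho d γ β * φ < 1 := by
    by_contra h
    push Not at h
    nlinarith [mul_nonneg hρ0 hρ0]
  rw [lt_div_iff₀ (by linarith)]
  have h3 : rho d γ β * φ * β = ((d : ℝ) - 1) * φ * (γ - 1) := by
    have : β ≠ 0 := by linarith
    unfold rho
    field_simp
  have h4 : 0 < β := by linarith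
  nlinarith

/-- Sizes `u_i = λ^(1/γ) exp (b E_i)` and `v_i = λ^(1/(γβ)) exp (-ν E_{i+1})` for a geometric
sequence `E_i` of ratio `q ≥ 1 + η`. -/
structure GeometricSteps (γ β l b ν q η : ℝ) (r : ℕ) (u v E : ℕ → ℝ) : Prop where
  l_pos : 0 < l
  l_lt_one : l < 1
  η_pos : 0 < η
  η_le : η ≤ 1
  one_le_b : 1 ≤ b
  one_lt_ν : 1 < ν
  three_le : 3 ≤ r
  one_add_le : 1 + η ≤ q
  E_one : E 1 = 1
  E_succ : ∀ i, E (i + 1) = q * E i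
  E_ge : ∀ i, 1 ≤ i → 1 ≤ E i
  u_eq : ∀ i, u i = l ^ (1 / γ) * Real.exp (b * E i)
  v_eq : ∀ i, i < r → v i = l ^ (1 / (γ * β)) * Real.exp (-(ν * E (i + 1)))
  v_last : v r = l ^ (1 / β) / 2
  v_zero : v (r + 1) = 0
  u_last : u r = l ^ (1 / β)
  le_v : l ^ (1 / β) ≤ v (r - 1)

namespace GeometricSteps

variable {l b ν q η : ℝ} {r : ℕ} {u v E : ℕ → ℝ}

lemma ratio_pos (hη : 0 < η) : 0 < η / (1 + η) := by positivity

lemma ratio_le_half (hη : 0 < η) (h1 : η ≤ 1) : η / (1 + η) ≤ 1 / 2 := by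
  rw [div_le_iff₀ (by linarith)]
  linarith

/-- An increment of at least `η` in the exponent separates consecutive sizes by the fixed proportion
`η / (1 + η)`, as needed for the block volumes. -/
lemma exp_neg_le {s x : ℝ} (hη : 0 < η) (hs : 1 ≤ s) (hx : η ≤ x) :
    Real.exp (-(s * x)) ≤ 1 - η / (1 + η) := by
  have e : 1 - η / (1 + η) = (1 + η)⁻¹ := by field_simp; ring
  rw [e, Real.exp_neg]
  refine inv_anti₀ (by linarith) ?_
  have h1 : η ≤ s * x := hx.trans (le_mul_of_one_le_left (hη.le.trans hx) hs)
  linarith [Real.add_one_le_exp (s * x)]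

lemma E_step (h : GeometricSteps γ β l b ν q η r u v E) {i : ℕ} (hi : 1 ≤ i) :
    η ≤ E (i + 1) - E i := by
  rw [h.E_succ, ← sub_one_mul]
  have h1 := h.one_add_le
  exact (le_mul_of_one_le_right h.η_pos.le (h.E_ge i hi)).trans
    (mul_le_mul_of_nonneg_right (by linarith) (by linarith [h.E_ge i hi]))

lemma u_pos (h : GeometricSteps γ β l b ν q η r u v E) (i : ℕ) : 0 < u i := by
  have := h.l_pos
  rw [h.u_eq]
  positivity

lemma v_pos (h : GeometricSteps γ β l b ν q η r u v E) {i : ℕ} (hi : i ≤ r) : 0 < v i := by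
  have := h.l_pos
  rcases lt_or_eq_of_le hi with h1 | h1
  · rw [h.v_eq i h1]; positivity
  · rw [h1, h.v_last]; positivity

lemma sub_u (h : GeometricSteps γ β l b ν q η r u v E) :
    ∀ i ∈ Finset.Icc 2 r, η / (1 + η) * u i ≤ u i - u (i - 1) := by
  intro i hi
  rw [Finset.mem_Icc] at hi
  have h1 := h.E_step (i := i - 1) (by omega)
  rw [show i - 1 + 1 = i by omega] at h1
  have h2 : u (i - 1) = u i * Real.exp (-(b * (E i - E (i - 1)))) := by
    rw [h.u_eq, h.u_eq, mul_assoc, ← Real.exp_add]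
    congr 2
    ring
  have h3 := mul_le_mul_of_nonneg_left (exp_neg_le h.η_pos h.one_le_b h1) (h.u_pos i).le
  rw [h2]
  linarith

lemma sub_v (h : GeometricSteps γ β l b ν q η r u v E) :
    ∀ j ∈ Finset.Icc 1 r, η / (1 + η) * v j ≤ v j - v (j + 1) := by
  intro j hj
  rw [Finset.mem_Icc] at hj
  have hp := h.v_pos hj.2
  have hc := ratio_le_half h.η_pos h.η_le
  have h0 : η / (1 + η) * v j ≤ 1 / 2 * v j := mul_le_mul_of_nonneg_right hc hp.le
  rcases lt_or_eq_of_le hj.2 with h1 | h1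
  · rcases lt_or_eq_of_le (show j + 1 ≤ r by omega) with h' | h'
    · have h3 : v (j + 1) = v j * Real.exp (-(ν * (E (j + 1 + 1) - E (j + 1)))) := by
        rw [h.v_eq _ h', h.v_eq _ h1, mul_assoc, ← Real.exp_add]
        congr 2
        ring
      have h4 := mul_le_mul_of_nonneg_left
        (exp_neg_le h.η_pos h.one_lt_ν.le (h.E_step (i := j + 1) (by omega))) hp.le
      rw [h3]
      linarith
    · have h2 := h.le_v
      rw [show r - 1 = j by omega] at h2
      rw [h', h.v_last]
      linarith
  · rw [h1] at h0 hp ⊢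
    rw [h.v_zero]
    linarith

lemma stepOrder (h : GeometricSteps γ β l b ν q η r u v E) : StepOrder r u v := by
  have hc := ratio_pos h.η_pos
  refine ⟨by linarith [h.three_le], fun i _ => h.u_pos i, fun i hi => ?_, fun i hi => ?_,
    fun i hi => ?_, h.v_zero⟩
  · have h1 := h.sub_u i hi
    have h2 := mul_pos hc (h.u_pos i)
    linarith
  · rw [Finset.mem_Icc] at hi
    rcases lt_or_eq_of_le hi.2 with h1 | h1
    · exact (h.v_pos (by omega)).le
    · rw [h1, h.v_zero]
  · have h1 := h.sub_v i hi
    have h2 := mul_pos hc (h.v_pos (Finset.mem_Icc.1 hi).2)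
    linarith

lemma v_pred (h : GeometricSteps γ β l b ν q η r u v E) {i : ℕ} (hi : i ∈ Finset.Icc 2 r) :
    v (i - 1) = l ^ (1 / (γ * β)) * Real.exp (-(ν * E i)) := by
  rw [Finset.mem_Icc] at hi
  rw [h.v_eq _ (by omega), show i - 1 + 1 = i by omega]

/-- With `b = β/(γ-1)` the mixed term is `λ exp (-β (ν - 1) E_i)`: any `ν > 1` makes the sum
converge. -/
lemma sum_mixed_le (h : GeometricSteps γ β l b ν q η r u v E) (hγ : 1 < γ) (hβ : 0 < β)
    (hb : b = β / (γ - 1)) :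
    ∑ i ∈ Finset.Icc 2 r, u i ^ (γ - 1) * v (i - 1) ^ β ≤ 1 / (β * (ν - 1) * η) * l := by
  have hl := h.l_pos
  have hγ0 : 0 < γ := by linarith
  have g1 : γ - 1 ≠ 0 := by linarith
  have hν : 0 < ν - 1 := sub_pos.2 h.one_lt_ν
  have h1 : ∀ i ∈ Finset.Icc 2 r, u i ^ (γ - 1) * v (i - 1) ^ β =
      l * Real.exp (-(β * (ν - 1) * E i)) := fun i hi => by
    rw [h.v_pred hi, h.u_eq, Real.mul_rpow (by positivity) (Real.exp_pos _).le,
      Real.mul_rpow (by positivity) (Real.exp_pos _).le, ← Real.rpow_mul hl.le,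
      ← Real.rpow_mul hl.le, ← Real.exp_mul, ← Real.exp_mul, mul_mul_mul_comm,
      ← Real.rpow_add hl, ← Real.exp_add]
    have e1 : 1 / γ * (γ - 1) + 1 / (γ * β) * β = 1 := by field_simp; ring
    have e2 : b * E i * (γ - 1) + -(ν * E i) * β = -(β * (ν - 1) * E i) := by
      rw [hb]
      field_simp
      ring
    rw [e1, e2, Real.rpow_one]
  rw [Finset.sum_congr rfl h1, ← Finset.mul_sum, mul_comm]
  exact mul_le_mul_of_nonneg_right
    (sum_exp_neg_le h.η_pos h.one_add_le (by positivity) h.E_one h.E_succ r) hl.le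

lemma sum_v_le (h : GeometricSteps γ β l b ν q η r u v E) (hγ : 0 < γ) (hβ : 0 < β) :
    ∑ i ∈ Finset.Icc 2 r, v (i - 1) ^ γ ≤ 1 / (γ * ν * η) * l ^ (1 / β) := by
  have hl := h.l_pos
  have hν : 0 < ν := by linarith [h.one_lt_ν]
  have h1 : ∀ i ∈ Finset.Icc 2 r, v (i - 1) ^ γ =
      l ^ (1 / β) * Real.exp (-(γ * ν * E i)) := fun i hi => by
    rw [h.v_pred hi, Real.mul_rpow (by positivity) (Real.exp_pos _).le, ← Real.rpow_mul hl.le,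
      ← Real.exp_mul]
    have e1 : 1 / (γ * β) * γ = 1 / β := by field_simp
    have e2 : -(ν * E i) * γ = -(γ * ν * E i) := by ring
    rw [e1, e2]
  rw [Finset.sum_congr rfl h1, ← Finset.mul_sum, mul_comm]
  exact mul_le_mul_of_nonneg_right
    (sum_exp_neg_le h.η_pos h.one_add_le (by positivity) h.E_one h.E_succ r) (by positivity)

/-- As soon as `b > (d-1) ν q`, the volumes for `i < r` increase with `i`, so the smallest of these
blocks is the first. -/
lemma vol_eq (h : GeometricSteps γ β l b ν q η r u v E) {i : ℕ} (hi : i < r) :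
    u i * v i ^ (d - 1) = l ^ (1 / γ + ((d : ℝ) - 1) / (γ * β)) *
      Real.exp ((b - ((d : ℝ) - 1) * (ν * q)) * E i) := by
  have hl := h.l_pos
  have h1 : Real.exp (-(ν * E (i + 1))) ^ (d - 1) =
      Real.exp (-(((d : ℝ) - 1) * (ν * q)) * E i) := by
    rw [← Real.exp_nat_mul, cast_pred, h.E_succ]
    congr 1
    ring
  have h2 := rpow_mul_rpow_pow d hl (1 / γ) (1 / (γ * β))
  have h3 : Real.exp ((b - ((d : ℝ) - 1) * (ν * q)) * E i) =
      Real.exp (b * E i) * Real.exp (-(((d : ℝ) - 1) * (ν * q)) * E i) := by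
    rw [← Real.exp_add]
    congr 1
    ring
  rw [h.u_eq, h.v_eq _ hi, mul_pow, h1, h3,
    show ((d : ℝ) - 1) / (γ * β) = ((d : ℝ) - 1) * (1 / (γ * β)) by ring, ← h2]
  ring

lemma le_normTwo (h : GeometricSteps γ β l b ν q η r u v E) :
    √(2 ^ d * Real.exp b)⁻¹ * l ^ (-(1 / γ + ((d : ℝ) - 1) / (γ * β)) / 2) ≤
      normTwo (stepWeight r u v : Space d → ℝ) := by
  have hl := h.l_pos
  have hd1 : (1 : ℝ) ≤ d := by exact_mod_cast NeZero.one_le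
  have hν := h.one_lt_ν
  have hq : 0 < q := by linarith [h.one_add_le, h.η_pos]
  refine le_trans ?_ h.stepOrder.le_normTwo_first
  rw [← sqrt_inv_rpow hl (by positivity), h.vol_eq (by linarith [h.three_le]), h.E_one, mul_one]
  refine Real.sqrt_le_sqrt (inv_anti₀ (by positivity) ?_)
  have h1 : Real.exp (b - ((d : ℝ) - 1) * (ν * q)) ≤ Real.exp b := by
    refine Real.exp_le_exp.2 ?_
    have : 0 ≤ ((d : ℝ) - 1) * (ν * q) := mul_nonneg (by linarith) (by positivity)
    linarith
  rw [mul_assoc, mul_comm (Real.exp b)]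
  gcongr

/-- The inner blocks contribute `exp (-δ E_i / 2)` relative to the order of the first one, which is
summable. The last block is a cube of side of order `λ^(1/β)`, treated separately. -/
lemma stepNorm_le (h : GeometricSteps γ β l b ν q η r u v E) (hγ : 0 < γ) (hβ : 0 < β)
    (hβd : (d : ℝ) * (γ - 1) + 1 ≤ β) {δ : ℝ} (hδ0 : 0 < δ)
    (hδ : δ ≤ b - ((d : ℝ) - 1) * (ν * q)) :
    stepNorm d r u v ≤ 2 * (√((η / (1 + η)) ^ d * (1 / 2) ^ d)⁻¹ * (2 + 1 / (δ / 2 * η))) *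
      l ^ (-(1 / γ + ((d : ℝ) - 1) / (γ * β)) / 2) := by
  have hl := h.l_pos
  have hc := ratio_pos h.η_pos
  have hc1 := ratio_le_half h.η_pos h.η_le
  have hr3 := h.three_le
  refine (h.stepOrder.stepNorm_le hc (by linarith) h.sub_u h.sub_v).trans ?_
  rw [mul_assoc]
  refine mul_le_mul_of_nonneg_left ?_ (by norm_num)
  generalize η / (1 + η) = c at hc hc1
  set e := 1 / γ + ((d : ℝ) - 1) / (γ * β) with he
  set G := √(c ^ d * (1 / 2) ^ d)⁻¹ with hG
  have hG0 : 0 < G := by positivity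
  have inner : ∀ i ∈ Finset.Icc 1 (r - 1), √((c ^ d * (u i * v i ^ (d - 1)))⁻¹) ≤
      G * l ^ (-e / 2) * Real.exp (-(δ / 2 * E i)) := fun i hi => by
    rw [Finset.mem_Icc] at hi
    have h1 : Real.exp (-(δ / 2 * E i)) = √(Real.exp (-(δ * E i))) := by
      rw [← Real.exp_half]
      congr 1
      ring
    rw [hG, ← sqrt_inv_rpow hl (by positivity), h1, ← Real.sqrt_mul (by positivity),
      Real.exp_neg, ← mul_inv, h.vol_eq (by omega)]
    refine Real.sqrt_le_sqrt (inv_anti₀ (by positivity) ?_)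
    have h2 : Real.exp (δ * E i) ≤ Real.exp ((b - ((d : ℝ) - 1) * (ν * q)) * E i) :=
      Real.exp_le_exp.2 (mul_le_mul_of_nonneg_right hδ (zero_le_one.trans (h.E_ge i hi.1)))
    have h3 : ((1 : ℝ) / 2) ^ d ≤ 1 := pow_le_one₀ (by norm_num) (by norm_num)
    calc c ^ d * (1 / 2) ^ d * l ^ e * Real.exp (δ * E i)
        ≤ c ^ d * 1 * l ^ e * Real.exp ((b - ((d : ℝ) - 1) * (ν * q)) * E i) := by gcongr
      _ = _ := by rw [mul_one, mul_assoc]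
  have last : √((c ^ d * (u r * v r ^ (d - 1)))⁻¹) ≤ G * l ^ (-e / 2) := by
    rw [hG, ← sqrt_inv_rpow hl (by positivity), h.u_last, h.v_last]
    refine Real.sqrt_le_sqrt (inv_anti₀ (by positivity) ?_)
    have hp : (l ^ (1 / β) / 2) ^ (d - 1) = (l ^ (1 / β)) ^ (d - 1) * (1 / 2) ^ (d - 1) := by
      rw [div_eq_mul_one_div, mul_pow]
    have hpow : ((1 : ℝ) / 2) ^ d ≤ (1 / 2) ^ (d - 1) :=
      pow_le_pow_of_le_one (by norm_num) (by norm_num) (by omega)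
    -- The volume order `λ^(d/β)` of the last block is no smaller than `λ^e`; this is the condition
    -- `d(γ-1) + 1 ≤ β`.
    have hle : l ^ e ≤ l ^ (1 / β + ((d : ℝ) - 1) * (1 / β)) := by
      refine Real.rpow_le_rpow_of_exponent_ge hl h.l_lt_one.le ?_
      have : e - (1 / β + ((d : ℝ) - 1) * (1 / β)) = (β - (d * (γ - 1) + 1)) / (γ * β) := by
        rw [he]
        field_simp
        ring
      have h2 : 0 ≤ (β - (d * (γ - 1) + 1)) / (γ * β) := div_nonneg (by linarith) (by positivity)
      linarith
    rw [hp]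
    calc c ^ d * (1 / 2) ^ d * l ^ e
        ≤ c ^ d * (1 / 2) ^ (d - 1) * l ^ (1 / β + ((d : ℝ) - 1) * (1 / β)) := by gcongr
      _ = _ := by rw [← rpow_mul_rpow_pow d hl]; ring
  have split : Finset.Icc 1 r = insert r (insert 1 (Finset.Icc 2 (r - 1))) := by
    ext i
    simp only [Finset.mem_Icc, Finset.mem_insert]
    omega
  have n1 : r ∉ insert 1 (Finset.Icc 2 (r - 1)) := by
    simp only [Finset.mem_Icc, Finset.mem_insert]
    omega
  have n2 : 1 ∉ Finset.Icc 2 (r - 1) := by simp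
  rw [split, Finset.sum_insert n1, Finset.sum_insert n2]
  have s1 := inner 1 (Finset.mem_Icc.2 ⟨le_rfl, by omega⟩)
  have s2 : Real.exp (-(δ / 2 * E 1)) ≤ 1 := by
    rw [h.E_one, Real.exp_le_one_iff]
    linarith
  have s3 := Finset.sum_le_sum fun i (hi : i ∈ Finset.Icc 2 (r - 1)) =>
    inner i (by rw [Finset.mem_Icc] at hi ⊢; omega)
  rw [← Finset.mul_sum] at s3
  have s4 := sum_exp_neg_le h.η_pos h.one_add_le (half_pos hδ0) h.E_one h.E_succ (r - 1)
  have Gl : 0 ≤ G * l ^ (-e / 2) := by positivity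
  have s5 := mul_le_mul_of_nonneg_left s2 Gl
  have s6 := mul_le_mul_of_nonneg_left s4 Gl
  calc _ ≤ G * l ^ (-e / 2) + (G * l ^ (-e / 2) * 1 + G * l ^ (-e / 2) * (1 / (δ / 2 * η))) :=
        add_le_add last (add_le_add (s1.trans s5) (s3.trans s6))
    _ = _ := by ring

end GeometricSteps

/-- With `E_i = exp (α (i - 1))`, the exponential `exp (α i)` in `v i` is `E_{i+1}`. The definition
of `α` makes `E_r` a multiple of `ln (1/λ)`, so the last sizes are again powers of `λ`. -/
lemma geometricSteps_exp {l η : ℝ} (hγ : 1 < γ) (hγβ : γ < β) (hβ2 : β ≤ 2)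
    (hl : 0 < l) (hl1 : l < 1) (hη : 0 < η) (hη1 : η ≤ 1) (hr : 3 ≤ expSteps γ β l)
    (hα : η ≤ expAlpha γ β l)
    (hE : Real.exp (expAlpha γ β l * ((expSteps γ β l : ℝ) - 1)) =
        (γ - 1) * (β - γ) / (γ * β ^ 2) * Real.log (1 / l)) :
    GeometricSteps γ β l (β / (γ - 1)) √((√5 + 1) / 2) (Real.exp (expAlpha γ β l)) η
      (expSteps γ β l) (expU γ β l) (expV γ β l)
      (fun i => Real.exp (expAlpha γ β l * ((i : ℝ) - 1))) := by
  have gφ := one_lt_golden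
  have gφ2 := golden_lt_two
  have hν2 := Real.mul_self_sqrt (show (0 : ℝ) ≤ (√5 + 1) / 2 by linarith)
  have hν1 : 1 < √((√5 + 1) / 2) := by
    rw [Real.lt_sqrt (by norm_num)]
    simpa using gφ
  have hν3 : √((√5 + 1) / 2) ≤ 2 := by nlinarith
  have g1 : 0 < γ - 1 := by linarith
  have hβ0 : 0 < β := by linarith
  have hγ0 : 0 < γ := by linarith
  have expE : ∀ s : ℝ, Real.exp (s * ((γ - 1) * (β - γ) / (γ * β ^ 2) * Real.log (1 / l))) =
      l ^ (-(s * ((γ - 1) * (β - γ) / (γ * β ^ 2)))) := fun s => by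
    rw [Real.rpow_def_of_pos hl, one_div l, Real.log_inv]
    congr 1
    ring
  refine
    { l_pos := hl
      l_lt_one := hl1
      η_pos := hη
      η_le := hη1
      one_le_b := ?_
      one_lt_ν := hν1
      three_le := hr
      one_add_le := by linarith [Real.add_one_le_exp (expAlpha γ β l)]
      E_one := by simp
      E_succ := fun i => ?_
      E_ge := fun i hi => ?_
      u_eq := fun i => rfl
      v_eq := fun i hi => ?_
      v_last := ?_
      v_zero := ?_
      u_last := ?_
      le_v := ?_ }
  · rw [le_div_iff₀ g1]
    linarith
  · rw [← Real.exp_add]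
    congr 1
    push_cast
    ring
  · rw [Real.one_le_exp_iff]
    have : (1 : ℝ) ≤ i := by exact_mod_cast hi
    exact mul_nonneg (by linarith) (by linarith)
  · unfold expV
    rw [if_pos hi]
    push_cast
    rw [add_sub_cancel_right, neg_mul]
  · unfold expV
    rw [if_neg (lt_irrefl _), if_pos rfl]
  · unfold expV
    rw [if_neg (by omega), if_neg (by omega)]
  -- The constant in `V` is tuned to this end point: `β/(γ-1)` times it is `1/γ - 1/β`, hence `u_r =
  -- λ^(1/β)`.
  · unfold expU
    rw [hE, expE, ← Real.rpow_add hl]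
    congr 1
    field_simp
    ring
  · unfold expV
    rw [if_pos (by omega), Nat.cast_sub (by omega), Nat.cast_one, hE, expE, ← Real.rpow_add hl]
    refine Real.rpow_le_rpow_of_exponent_ge hl hl1.le ?_
    generalize √((√5 + 1) / 2) = ν at hν1 hν3
    -- From `ν ≤ 2`, `γ > 1` and `β ≤ 2`: `2 (β - 1) ≤ β`.
    have h1 : ν * (β - γ) ≤ β := by nlinarith
    have h2 : 1 / β - (1 / (γ * β) + -(-ν * ((γ - 1) * (β - γ) / (γ * β ^ 2)))) =
        (γ - 1) * (β - ν * (β - γ)) / (γ * β ^ 2) := by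
      field_simp
      ring
    have h3 : 0 ≤ (γ - 1) * (β - ν * (β - γ)) / (γ * β ^ 2) :=
      div_nonneg (mul_nonneg g1.le (by linarith)) (by positivity)
    linarith

/-- The ratio `q = exp α` is at most `ν` and `ν²` is the golden ratio, so `hδ` gives `b > (d-1) ν q`
with a gap independent of `λ`. The number of steps, hence the `L₁`-norm, is `O(ln ln (1/λ))`. -/
lemma isWeightFamily_expSteps (hγ : 1 < γ) (hγβ : γ < β) (hβ2 : β ≤ 2) (hL₁ : 0 ≤ L₁)
    (hL₂ : 0 ≤ L₂) (hβd : (d : ℝ) * (γ - 1) + 1 ≤ β)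
    (hδ : ((d : ℝ) - 1) * ((√5 + 1) / 2) < β / (γ - 1)) :
    ∃ C : ℝ, 0 ≤ C ∧ IsWeightFamily (compositeClass d γ β L₁ L₂)
      (fun l => stepWeight (expSteps γ β l) (expU γ β l) (expV γ β l))
      (1 / γ + ((d : ℝ) - 1) / (γ * β)) fun l => C * Real.log (Real.log (1 / l)) := by
  have hγ0 : 0 < γ := by linarith
  have hβ0 : 0 < β := by linarith
  have hd1 : (1 : ℝ) ≤ d := by exact_mod_cast NeZero.one_le
  have ev := eventually_expSteps hγ hγβ
  have hexp := exp_half_log_golden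
  have gφ := one_lt_golden
  obtain ⟨A, hA⟩ : ∃ A : ℝ, A = Real.log ((√5 + 1) / 2) / 2 := ⟨_, rfl⟩
  have hA0 : 0 < A := hA ▸ half_pos (Real.log_pos gφ)
  have hA1 : A ≤ 1 := by
    have := Real.log_le_sub_one_of_pos (zero_lt_one.trans gφ)
    linarith [golden_lt_two]
  simp only [← hA] at ev hexp
  have hG : ∀ᶠ l in 𝓝[>] (0 : ℝ),
      GeometricSteps γ β l (β / (γ - 1)) √((√5 + 1) / 2) (Real.exp (expAlpha γ β l)) (A / 2)
        (expSteps γ β l) (expU γ β l) (expV γ β l)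
        (fun i => Real.exp (expAlpha γ β l * ((i : ℝ) - 1))) ∧
      Real.exp (expAlpha γ β l) ≤ √((√5 + 1) / 2) ∧
      A * ((expSteps γ β l : ℝ) - 2) ≤ Real.log (Real.log (1 / l)) ∧
      1 ≤ Real.log (Real.log (1 / l)) := by
    filter_upwards [ev, eventually_Ioo] with l ⟨_, h3, h4, h5, h6, h7, h8⟩ ⟨hl, hl1⟩
    refine ⟨geometricSteps_exp hγ hγβ hβ2 hl hl1 (half_pos hA0) (by linarith) h3 h4 h6, ?_, h7, h8⟩
    rw [← hexp]
    exact Real.exp_le_exp.2 h5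
  have hν2 := Real.mul_self_sqrt (zero_le_one.trans gφ.le)
  have hν1 : 1 < √((√5 + 1) / 2) := by
    rw [Real.lt_sqrt (by norm_num)]
    simpa using gφ
  clear ev hexp hA
  generalize √((√5 + 1) / 2) = ν at hG hν2 hν1
  rw [← hν2] at hδ
  clear hν2 gφ
  have he0 : 0 ≤ 1 / γ + ((d : ℝ) - 1) / (γ * β) := by
    have : 0 ≤ (d : ℝ) - 1 := by linarith
    positivity
  have hν1' : 0 < ν - 1 := by linarith
  have hη0 : 0 < A / 2 := half_pos hA0
  have hc0 : 0 < A / 2 / (1 + A / 2) := GeometricSteps.ratio_pos hη0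
  have c1 : 0 < Real.exp (β / (γ - 1) * γ) := Real.exp_pos _
  have c2 : 0 < (A / 2 / (1 + A / 2))⁻¹ := inv_pos.2 hc0
  have c3 : 0 < 1 / (β * (ν - 1) * (A / 2)) := by positivity
  have c4 : 0 < 1 / (γ * ν * (A / 2)) := by positivity
  have hδ0 := sub_pos.2 hδ
  refine ⟨2 * (1 / A + 2), by positivity, isWeightFamily_step
    (c := √(2 ^ d * Real.exp (β / (γ - 1)))⁻¹)
    (C := Real.exp (β / (γ - 1) * γ) + (A / 2 / (1 + A / 2))⁻¹ + 1 +
      1 / (β * (ν - 1) * (A / 2)) + 1 / (γ * ν * (A / 2)))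
    (C' := 2 * (√((A / 2 / (1 + A / 2)) ^ d * (1 / 2) ^ d)⁻¹ *
      (2 + 1 / ((β / (γ - 1) - ((d : ℝ) - 1) * (ν * ν)) / 2 * (A / 2)))))
    hγ (by linarith) (by linarith) hβ2 hL₁ hL₂ he0
    (by positivity) (by positivity) (by positivity) ?_⟩
  filter_upwards [hG] with l ⟨hg, hq, hrA, hll⟩
  have so := hg.stepOrder
  have hl := hg.l_pos
  have hr3 := hg.three_le
  have rβ : (l ^ (1 / β)) ^ β = l := by
    rw [← Real.rpow_mul hl.le, one_div_mul_cancel hβ0.ne', Real.rpow_one]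
  refine ⟨so, ?_, ?_, ?_, ?_, ?_, ?_, ?_, ?_, hg.le_normTwo, ?_⟩
  · have h1 : (expSteps γ β l : ℝ) ≤ 1 / A * Real.log (Real.log (1 / l)) + 2 := by
      rw [← sub_le_iff_le_add, one_div_mul_eq_div, le_div_iff₀ hA0, mul_comm]
      exact hrA
    linarith
  · rw [hg.u_last]
    exact Real.rpow_le_rpow_of_exponent_ge hl hg.l_lt_one.le
      (one_div_le_one_div_of_le hβ0 (le_mul_of_one_le_left hβ0.le hγ.le))
  · rw [hg.v_eq 1 (by omega)]
    refine mul_le_of_le_one_right (by positivity) (Real.exp_le_one_iff.2 ?_)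
    have := hg.E_ge (1 + 1) (by omega)
    exact neg_nonpos.2 (mul_nonneg (by linarith) (by linarith))
  · rw [hg.u_eq, hg.E_one, mul_one, Real.mul_rpow (by positivity) (Real.exp_pos _).le,
      ← Real.rpow_mul hl.le, one_div_mul_cancel hγ0.ne', Real.rpow_one, ← Real.exp_mul, mul_comm]
    exact mul_le_mul_of_nonneg_right (by linarith) hl.le
  · refine (sum_rpow_le_of_geometric hc0
      (by linarith [GeometricSteps.ratio_le_half hη0 (by linarith)]) (by linarith) (by omega)
      (fun i _ => (hg.u_pos i).le) hg.sub_u).trans ?_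
    rw [hg.u_last, rβ]
    exact mul_le_mul_of_nonneg_right (by linarith) hl.le
  · rw [hg.v_last]
    calc (l ^ (1 / β) / 2) ^ β ≤ (l ^ (1 / β)) ^ β := by
          have : 0 < l ^ (1 / β) := by positivity
          exact Real.rpow_le_rpow (by positivity) (by linarith) hβ0.le
      _ = l := rβ
      _ ≤ _ := le_mul_of_one_le_left hl.le (by linarith)
  · exact (hg.sum_mixed_le hγ hβ0 rfl).trans (mul_le_mul_of_nonneg_right (by linarith) hl.le)
  · exact (hg.sum_v_le hγ0 hβ0).trans (mul_le_mul_of_nonneg_right (by linarith) (by positivity))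
  · refine hg.stepNorm_le hγ0 hβ0 hβd hδ0 ?_
    have : ((d : ℝ) - 1) * (ν * Real.exp (expAlpha γ β l)) ≤ ((d : ℝ) - 1) * (ν * ν) :=
      mul_le_mul_of_nonneg_left (mul_le_mul_of_nonneg_left hq (by linarith)) (by linarith)
    linarith

variable {d : ℕ} [NeZero d] {γ β L₁ L₂ : ℝ}

/-! ### The weights of the procedure and the rate -/

/-- It is enough that the exponent `e` does not exceed that of the rate: a smaller exponent only
makes the balanced size smaller. -/
lemma isWeightFamily_baseWeight_roughness (hγ : 1 < γ) (hγβ : γ < β) (hβ2 : β ≤ 2) (hL₁ : 0 ≤ L₁)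
    (hL₂ : 0 ≤ L₂) (hβd : (d : ℝ) * (γ - 1) + 1 ≤ β) :
    ∃ e, 0 ≤ e ∧ e ≤ 1 / γ + ((d : ℝ) - 1) / (γ * β) ∧ ∃ C, 0 ≤ C ∧
      (IsWeightFamily (compositeClass d γ β L₁ L₂) (fun l => baseWeight γ β l) e (fun _ => C) ∨
        IsWeightFamily (compositeClass d γ β L₁ L₂) (fun l => baseWeight γ β l) e
          fun l => C * Real.log (Real.log (1 / l))) := by
  have hγ0 : 0 < γ := by linarith
  have hβ0 : 0 < β := by linarith
  have hd1 : (1 : ℝ) ≤ d := by exact_mod_cast NeZero.one_le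
  have base : ∀ l, (baseWeight γ β l : Space d → ℝ) = expWeight γ β l := fun l => by
    unfold baseWeight
    rw [if_neg (by rintro ⟨h, _⟩; linarith), if_neg (by linarith), if_neg (by linarith),
      if_neg (by linarith)]
  have hρ0 : 0 ≤ rho d γ β := by
    unfold rho
    exact div_nonneg (mul_nonneg (by linarith) (by linarith)) hβ0.le
  by_cases hρ : (β - γ) / γ ≤ (1 + rho d γ β) * rho d γ β
  · have hd : 2 ≤ d := by
      by_contra h
      have h1 : d = 1 := by have := NeZero.one_le (n := d); omega
      have h2 : rho d γ β = 0 := by rw [rho, h1]; simp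
      rw [h2, mul_zero, div_le_iff₀ hγ0] at hρ
      linarith
    have hex : ∃ k, 1 / γ ≤ alphaSeq d γ β k := by
      -- The condition `(β - γ)/γ ≤ (1 + ρ) ρ` is exactly `1/γ ≤ α_2`.
      refine ⟨2, ?_⟩
      rw [alphaSeq_succ, alphaSeq_succ, alphaSeq_zero]
      rw [div_le_iff₀ hγ0] at hρ
      have : 1 / β + rho d γ β * (1 / β + rho d γ β * (1 / β)) - 1 / γ =
          ((1 + rho d γ β) * rho d γ β * γ - (β - γ)) / (γ * β) := by
        field_simp
        ring
      have h2 : 0 ≤ ((1 + rho d γ β) * rho d γ β * γ - (β - γ)) / (γ * β) :=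
        div_nonneg (by linarith) (by positivity)
      linarith
    obtain ⟨r, hr⟩ := isWeightFamily_powerWeight hγ hγβ hβ2 hL₁ hL₂ hd hex
    refine ⟨d / β, by positivity, ?_, 2 * r, by positivity, Or.inl (hr.congr ?_)⟩
    · have : 1 / γ + ((d : ℝ) - 1) / (γ * β) - d / β = (β - (d * (γ - 1) + 1)) / (γ * β) := by
        field_simp
        ring
      have h2 : 0 ≤ (β - (d * (γ - 1) + 1)) / (γ * β) := div_nonneg (by linarith) (by positivity)
      linarith
    · refine Eventually.of_forall fun l => ?_
      rw [base, expWeight, if_pos hρ]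
  · obtain ⟨C, hC, h⟩ := isWeightFamily_expSteps (d := d) hγ hγβ hβ2 hL₁ hL₂ hβd
      (golden_mul_rho_lt hρ0 hγ hγβ hβ2 (not_le.1 hρ))
    refine ⟨_, ?_, le_rfl, C, hC, Or.inr (h.congr ?_)⟩
    · have : 0 ≤ (d : ℝ) - 1 := by linarith
      positivity
    · filter_upwards [eventually_expSteps hγ hγβ] with l hl
      rw [base, expWeight, if_neg hρ, if_neg (not_le.2 hl.1)]

lemma two_div_le {e e' : ℝ} (he : 0 ≤ e) (h : e ≤ e') : 2 / (2 + e') ≤ 2 / (2 + e) :=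
  div_le_div_of_nonneg_left (by norm_num) (by linarith) (by linarith)

/-- All three rates have the form `κ^(2/(2+e))`. The bound on this exponent makes the grid error, of
order `ε^(2 · min 1 γ · min 1 β)`, no larger than the rate. -/
lemma rate_eq_rpow (hγ : 0 < γ) (hβ : 0 < β) :
    ∃ e : ℝ, 0 ≤ e ∧ (∀ ε, rate d γ β ε = (ε * √(Real.log (1 / ε))) ^ (2 / (2 + e))) ∧
      2 / (2 + e) ≤ 2 * (min 1 γ * min 1 β) ∧
      (1 < β ∧ (d : ℝ) * (γ - 1) + 1 ≤ β ∧ e = 1 / γ + ((d : ℝ) - 1) / (γ * β) ∨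
        1 < γ ∧ β < (d : ℝ) * (γ - 1) + 1 ∧ e = d / β ∨
        γ ≤ 1 ∧ β ≤ 1 ∧ e = d / (γ * β)) := by
  have hd1 : (1 : ℝ) ≤ d := by exact_mod_cast NeZero.one_le
  have le_of : ∀ {e m : ℝ}, 0 < m → 1 / m ≤ e → 2 / (2 + e) ≤ 2 * m := fun {e m} hm h => by
    have h1 : 1 ≤ e * m := (div_le_iff₀ hm).1 h
    have : 0 < e := lt_of_lt_of_le (by positivity) h
    rw [div_le_iff₀ (by linarith)]
    nlinarith
  by_cases h1 : 1 < β ∧ (d : ℝ) * (γ - 1) + 1 ≤ β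
  · have h0 : 0 ≤ ((d : ℝ) - 1) / (γ * β) := div_nonneg (by linarith) (by positivity)
    have he : 0 ≤ 1 / γ + ((d : ℝ) - 1) / (γ * β) := by positivity
    refine ⟨_, he, fun ε => ?_, ?_, Or.inl ⟨h1.1, h1.2, rfl⟩⟩
    · rw [rate, if_pos h1]
      congr 1
      field_simp
      ring
    · rw [min_eq_left h1.1.le, mul_one]
      rcases le_total 1 γ with h | h
      · rw [min_eq_left h, mul_one]
        exact div_le_self (by norm_num) (by linarith)
      · rw [min_eq_right h]
        exact le_of hγ (by linarith)
  by_cases h2 : 1 < γ ∧ β < (d : ℝ) * (γ - 1) + 1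
  · refine ⟨d / β, by positivity, fun ε => ?_, ?_, Or.inr (Or.inl ⟨h2.1, h2.2, rfl⟩)⟩
    · rw [rate, if_neg h1, if_pos h2]
    · rw [min_eq_left h2.1.le, one_mul]
      have : 0 ≤ (d : ℝ) / β := by positivity
      rcases le_total 1 β with h | h
      · rw [min_eq_left h, mul_one]
        exact div_le_self (by norm_num) (by linarith)
      · rw [min_eq_right h]
        exact le_of hβ (div_le_div_of_nonneg_right hd1 hβ.le)
  · have hγ1 : γ ≤ 1 := by
      by_contra h
      push Not at h
      have h3 : (d : ℝ) * (γ - 1) + 1 ≤ β := by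
        by_contra h4
        exact h2 ⟨h, not_le.1 h4⟩
      exact h1 ⟨by nlinarith, h3⟩
    have hβ1 : β ≤ 1 := by
      by_contra h
      push Not at h
      exact h1 ⟨h, by nlinarith⟩
    refine ⟨d / (γ * β), by positivity, fun ε => ?_, ?_, Or.inr (Or.inr ⟨hγ1, hβ1, rfl⟩)⟩
    · rw [rate, if_neg h1, if_neg h2]
    · rw [min_eq_right hγ1, min_eq_right hβ1]
      exact le_of (by positivity) (div_le_div_of_nonneg_right hd1 (by positivity))

/-- The weights of the procedure have the order of bias and of variance that the rate needs. The
`L₁`-norms are bounded, except that in the zone `𝒫₂` they may grow as `ln ln (1 / λ)`. -/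
lemma exists_isWeightFamily_baseWeight (hγ : 0 < γ) (hγ2 : γ ≤ 2) (hβ : 0 < β) (hβ2 : β ≤ 2)
    (hL₁ : 0 ≤ L₁) (hL₂ : 0 ≤ L₂) :
    ∃ e s : ℝ, ∃ N : ℝ → ℝ, 0 ≤ e ∧ 0 < s ∧ s ≤ 1 ∧ s ≤ 2 / (2 + e) ∧
      s ≤ 2 * (min 1 γ * min 1 β) ∧ (∀ ε, rate d γ β ε = (ε * √(Real.log (1 / ε))) ^ s) ∧
      IsWeightFamily (compositeClass d γ β L₁ L₂) (fun l => baseWeight γ β l) e N ∧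
      ∃ C, 0 ≤ C ∧ ((∀ l, N l = C) ∨
        ((γ, β) ∈ zoneTwo d ∧ ∀ l, N l = C * Real.log (Real.log (1 / l)))) := by
  have hd1 : (1 : ℝ) ≤ d := by exact_mod_cast NeZero.one_le
  obtain ⟨e', he', hrate, hmin, hcase⟩ := rate_eq_rpow (d := d) hγ hβ
  have hs0 : 0 < 2 / (2 + e') := by positivity
  have hs1 : 2 / (2 + e') ≤ 1 := by
    rw [div_le_one (by linarith)]
    linarith
  rcases le_or_gt γ 1 with hγ1 | hγ1
  · rcases le_or_gt β 1 with hβ1 | hβ1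
    · have e_eq : d / (γ * β) = e' := by
        rcases hcase with h | h | h
        · linarith [h.1]
        · linarith [h.1]
        · exact h.2.2.symm
      refine ⟨e', _, fun _ => 1, he', hs0, hs1, le_rfl, hmin, hrate, ?_, 1, zero_le_one,
        Or.inl fun _ => rfl⟩
      rw [← e_eq]
      refine (isWeightFamily_slow hγ hγ1 hβ hβ1 hL₁ hL₂).congr (Eventually.of_forall fun l => ?_)
      rw [baseWeight, if_pos ⟨hγ1, hβ1⟩]
    · have e_eq : 1 / γ + ((d : ℝ) - 1) / (γ * β) = e' := by
        rcases hcase with h | h | h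
        · exact h.2.2.symm
        · linarith [h.1]
        · linarith [h.2.1]
      refine ⟨e', _, fun _ => 1, he', hs0, hs1, le_rfl, hmin, hrate, ?_, 1, zero_le_one,
        Or.inl fun _ => rfl⟩
      rw [← e_eq]
      refine (isWeightFamily_singleIndex hγ hγ1 hβ1 hβ2 hL₁ hL₂).congr
        (Eventually.of_forall fun l => ?_)
      rw [baseWeight, if_neg (by rintro ⟨_, h⟩; linarith), if_pos hγ1]
  rcases le_or_gt β γ with hβγ | hβγ
  · have e_eq : (d : ℝ) / β = e' := by
      rcases hcase with h | h | h
      -- Here `β ≤ γ` meets `d(γ-1) + 1 ≤ β`, which forces `d = 1` and `β = γ`; the two formulas for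
      -- the exponent then agree.
      · have h1 : ((d : ℝ) - 1) * (γ - 1) ≤ 0 := by linarith [h.2.1]
        have h2 : (d : ℝ) = 1 := by nlinarith
        have h3 : β = γ := by
          have := h.2.1
          rw [h2] at this
          linarith
        rw [h.2.2, h2, h3]
        simp
      · exact h.2.2.symm
      · linarith [h.1]
    refine ⟨e', _, fun _ => 1, he', hs0, hs1, le_rfl, hmin, hrate, ?_, 1, zero_le_one,
      Or.inl fun _ => rfl⟩
    rw [← e_eq]
    refine (isWeightFamily_inactive hγ1 hγ2 hβ hβγ hL₁ hL₂).congr (Eventually.of_forall fun l => ?_)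
    rw [baseWeight, if_neg (by rintro ⟨h, _⟩; linarith), if_neg (by linarith), if_pos hβγ]
  rcases lt_or_ge β ((d : ℝ) * (γ - 1) + 1) with hβd | hβd
  · have e_eq : (d : ℝ) / β = e' := by
      rcases hcase with h | h | h
      · linarith [h.2.1]
      · exact h.2.2.symm
      · linarith [h.1]
    have hd : 2 ≤ d := by
      by_contra h
      have h1 : d = 1 := by have := NeZero.one_le (n := d); omega
      rw [h1] at hβd
      push_cast at hβd
      linarith
    obtain ⟨r, hr⟩ := isWeightFamily_powerWeight hγ1 hβγ hβ2 hL₁ hL₂ hd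
      (exists_le_alphaSeq hγ1 hβ (rho_pos hd hγ1 hβ) hβd)
    refine ⟨e', _, fun _ => 2 * r, he', hs0, hs1, le_rfl, hmin, hrate, ?_, 2 * r, by positivity,
      Or.inl fun _ => rfl⟩
    rw [← e_eq]
    refine hr.congr (Eventually.of_forall fun l => ?_)
    rw [baseWeight, if_neg (by rintro ⟨h, _⟩; linarith), if_neg (by linarith),
      if_neg (by linarith), if_pos hβd]
  · have e_eq : 1 / γ + ((d : ℝ) - 1) / (γ * β) = e' := by
      rcases hcase with h | h | h
      · exact h.2.2.symm
      · linarith [h.2.1]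
      · linarith [h.1]
    obtain ⟨e, he0, hee, C, hC, h⟩ :=
      isWeightFamily_baseWeight_roughness hγ1 hβγ hβ2 hL₁ hL₂ hβd
    rw [e_eq] at hee
    rcases h with h | h
    · exact ⟨e, _, _, he0, hs0, hs1, two_div_le he0 hee, hmin, hrate, h, C, hC,
        Or.inl fun _ => rfl⟩
    · exact ⟨e, _, _, he0, hs0, hs1, two_div_le he0 hee, hmin, hrate, h, C, hC,
        Or.inr ⟨⟨hγ1, hβγ.le, hβ2, hβd⟩, fun _ => rfl⟩⟩

/-! ### Balanced sizes -/

lemma tendsto_log_one_div : Tendsto (fun ε : ℝ => Real.log (1 / ε)) (𝓝[>] 0) atTop := by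
  have h : Tendsto (fun l : ℝ => 1 / l) (𝓝[>] 0) atTop := by
    simpa only [one_div] using tendsto_inv_nhdsGT_zero (𝕜 := ℝ)
  exact Real.tendsto_log_atTop.comp h

lemma tendsto_noise : Tendsto (fun ε : ℝ => ε * √(Real.log (1 / ε))) (𝓝[>] 0) (𝓝 0) := by
  have h1 : Tendsto (fun ε : ℝ => ε ^ (1 / 2 : ℝ)) (𝓝[>] 0) (𝓝 0) :=
    tendsto_rpow_nhdsGT (by norm_num)
  refine squeeze_zero' ?_ ?_ h1
  · filter_upwards [eventually_Ioo] with ε hε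
    have := hε.1
    positivity
  · filter_upwards [eventually_Ioo] with ε ⟨hε, _⟩
    have h2 : √(Real.log (1 / ε)) ≤ √(1 / ε) :=
      Real.sqrt_le_sqrt (Real.log_le_self (by positivity))
    calc ε * √(Real.log (1 / ε)) ≤ ε * √(1 / ε) := by gcongr
      _ = ε ^ (1 / 2 : ℝ) := by
        rw [← Real.sqrt_eq_rpow, Real.sqrt_div zero_le_one, Real.sqrt_one, mul_one_div,
          Real.div_sqrt]

/-- Solve the balance equation with the norm replaced by its lower bound `c λ^(-e/2)`. The first
inequality follows at once, and the ratio `C / c` of the two norm bounds determines `C₂`. Continuity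
of the norm in `λ` is not needed. -/
lemma IsWeightFamily.exists_isBalanced {𝒢 : Set (Space d → ℝ)} {e C₁ : ℝ} {N : ℝ → ℝ}
    (h : IsWeightFamily 𝒢 (fun l => baseWeight γ β l) e N) (he : 0 ≤ e) (hC₁ : 0 < C₁) :
    ∃ C₂ : ℝ, ∃ lam : ℝ → ℝ, IsBalanced d γ β C₁ C₂ lam := by
  obtain ⟨R, -, c, C, B, hc, hC, -, H⟩ := h
  set lam : ℝ → ℝ := fun ε => (c / C₁ * (ε * √(Real.log (1 / ε)))) ^ (2 / (2 + e)) with hlam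
  have t0 : Tendsto lam (𝓝[>] 0) (𝓝 0) := by
    have h1 : Tendsto (fun ε : ℝ => c / C₁ * (ε * √(Real.log (1 / ε)))) (𝓝[>] 0) (𝓝 0) := by
      simpa using tendsto_noise.const_mul (c / C₁)
    have h2 : (0 : ℝ) < 2 / (2 + e) := by positivity
    have h3 := (Real.continuousAt_rpow_const 0 (2 / (2 + e)) (Or.inr h2.le)).tendsto
    rw [Real.zero_rpow h2.ne'] at h3
    exact h3.comp h1
  have pos : ∀ᶠ ε in 𝓝[>] (0 : ℝ), 0 < ε ∧ 0 < ε * √(Real.log (1 / ε)) ∧ 0 < lam ε := by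
    filter_upwards [eventually_Ioo, tendsto_log_one_div.eventually_gt_atTop 0] with ε ⟨hε, _⟩ hl
    refine ⟨hε, by positivity, ?_⟩
    positivity
  have t1 : Tendsto lam (𝓝[>] 0) (𝓝[>] 0) :=
    tendsto_nhdsWithin_iff.2 ⟨t0, pos.mono fun ε h => h.2.2⟩
  refine ⟨C * C₁ / c, lam, t0, ?_⟩
  filter_upwards [pos, t1.eventually H] with ε ⟨hε, hκ, hl⟩ ⟨hw, _⟩
  have key : c * (ε * √(Real.log (1 / ε))) = C₁ * lam ε ^ (1 + e / 2) := by
    have : lam ε ^ (1 + e / 2) = c / C₁ * (ε * √(Real.log (1 / ε))) := by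
      rw [hlam, ← Real.rpow_mul (by positivity)]
      have : 2 / (2 + e) * (1 + e / 2) = 1 := by field_simp
      rw [this, Real.rpow_one]
    rw [this]
    field_simp
  have key2 : lam ε ^ (1 + e / 2) * lam ε ^ (-e / 2) = lam ε := by
    rw [← Real.rpow_add hl]
    have : 1 + e / 2 + -e / 2 = 1 := by ring
    rw [this, Real.rpow_one]
  refine ⟨hl, ?_, ?_⟩
  · calc C₁ * lam ε = C₁ * (lam ε ^ (1 + e / 2) * lam ε ^ (-e / 2)) := by rw [key2]
      _ = ε * √(Real.log (1 / ε)) * (c * lam ε ^ (-e / 2)) := by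
        rw [← mul_assoc, ← key]; ring
      _ ≤ _ := by gcongr; exact hw.le_normTwo
  · calc _ ≤ ε * √(Real.log (1 / ε)) * (C * lam ε ^ (-e / 2)) := by gcongr; exact hw.normTwo_le
      _ = C / c * (c * (ε * √(Real.log (1 / ε))) * lam ε ^ (-e / 2)) := by field_simp
      _ = C / c * (C₁ * (lam ε ^ (1 + e / 2) * lam ε ^ (-e / 2))) := by rw [key, mul_assoc C₁]
      _ = C * C₁ / c * lam ε := by rw [key2]; ring

lemma IsBalanced.tendsto_nhdsGT {C₁ C₂ : ℝ} {lam : ℝ → ℝ} (h : IsBalanced d γ β C₁ C₂ lam) :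
    Tendsto lam (𝓝[>] 0) (𝓝[>] 0) :=
  tendsto_nhdsWithin_iff.2 ⟨h.1, h.2.mono fun _ h => h.1⟩

/-- Balanced sizes have the order `κ_ε ^ (2 / (2 + e))`. -/
lemma IsBalanced.eventually_size {C₁ C₂ c C e : ℝ} {lam : ℝ → ℝ} (h : IsBalanced d γ β C₁ C₂ lam)
    (hC₁ : 0 < C₁) (he : 0 ≤ e) (hc : 0 < c) (hC : 0 < C)
    (H : ∀ᶠ l in 𝓝[>] (0 : ℝ), c * l ^ (-e / 2) ≤ normTwo (baseWeight γ β l : Space d → ℝ) ∧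
      normTwo (baseWeight γ β l : Space d → ℝ) ≤ C * l ^ (-e / 2)) :
    ∀ᶠ ε in 𝓝[>] (0 : ℝ), ε ≤ lam ε ^ (1 + e / 2) ∧ ε ≤ lam ε ∧
      lam ε ≤ (C / C₁) ^ (2 / (2 + e)) * (ε * √(Real.log (1 / ε))) ^ (2 / (2 + e)) := by
  have tl := h.tendsto_nhdsGT
  filter_upwards [h.2, tl.eventually H, tl.eventually eventually_Ioo, eventually_Ioo,
    tendsto_log_one_div.eventually_gt_atTop 0,
    tendsto_log_one_div.eventually_ge_atTop ((C₂ / c) ^ 2)] with ε ⟨hl, h1, h2⟩ ⟨h3, h4⟩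
    ⟨_, hl1⟩ ⟨hε, _⟩ hlog hlog2
  set κ := ε * √(Real.log (1 / ε)) with hκ
  have hκ0 : 0 < κ := by positivity
  have key2 : lam ε ^ (-e / 2) * lam ε ^ (e / 2) = 1 := by
    rw [← Real.rpow_add hl, neg_div, neg_add_cancel, Real.rpow_zero]
  have key3 : lam ε * lam ε ^ (e / 2) = lam ε ^ (1 + e / 2) := by
    rw [Real.rpow_add hl, Real.rpow_one]
  have le0 : 0 < lam ε ^ (e / 2) := by positivity
  have a1 : κ * c ≤ C₂ * lam ε ^ (1 + e / 2) := by
    have h5 : κ * (c * lam ε ^ (-e / 2)) ≤ C₂ * lam ε :=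
      (mul_le_mul_of_nonneg_left h3 hκ0.le).trans h2
    calc κ * c = κ * (c * lam ε ^ (-e / 2)) * lam ε ^ (e / 2) := by
          rw [mul_assoc κ, mul_assoc c, key2, mul_one]
      _ ≤ C₂ * lam ε * lam ε ^ (e / 2) := by gcongr
      _ = _ := by rw [mul_assoc, key3]
  have a2 : C₁ * lam ε ^ (1 + e / 2) ≤ κ * C := by
    have h5 : C₁ * lam ε ≤ κ * (C * lam ε ^ (-e / 2)) :=
      h1.trans (mul_le_mul_of_nonneg_left h4 hκ0.le)
    calc C₁ * lam ε ^ (1 + e / 2) = C₁ * lam ε * lam ε ^ (e / 2) := by rw [mul_assoc, key3]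
      _ ≤ κ * (C * lam ε ^ (-e / 2)) * lam ε ^ (e / 2) := by gcongr
      _ = κ * C := by rw [mul_assoc κ, mul_assoc C, key2, mul_one]
  have lp : 0 < lam ε ^ (1 + e / 2) := by positivity
  have hC₂ : 0 < C₂ := by
    by_contra hn
    push Not at hn
    have := mul_pos hκ0 hc
    nlinarith
  -- The factor `√(ln (1/ε))` in `κ` eventually beats the constants. This is what makes an `ε`-net
  -- of orientations as precise as the bias bound demands.
  have b1 : ε ≤ lam ε ^ (1 + e / 2) := by
    have h5 : C₂ / c ≤ √(Real.log (1 / ε)) := Real.le_sqrt_of_sq_le hlog2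
    rw [div_le_iff₀ hc] at h5
    have h6 : ε * C₂ ≤ κ * c := by
      rw [hκ, mul_assoc]
      gcongr
    have h7 := h6.trans a1
    rw [mul_comm ε] at h7
    exact le_of_mul_le_mul_left h7 hC₂
  refine ⟨b1, b1.trans ?_, ?_⟩
  · exact (Real.rpow_le_rpow_of_exponent_ge hl hl1.le (by linarith : (1 : ℝ) ≤ 1 + e / 2)).trans
      (Real.rpow_one _).le
  · have h5 : lam ε ^ (1 + e / 2) ≤ C / C₁ * κ := by
      rw [div_mul_eq_mul_div, le_div_iff₀ hC₁]
      linarith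
    have h6 := Real.rpow_le_rpow lp.le h5 (by positivity : 0 ≤ 2 / (2 + e))
    rw [← Real.rpow_mul hl.le, Real.mul_rpow (by positivity) hκ0.le] at h6
    have : (1 + e / 2) * (2 / (2 + e)) = 1 := by field_simp
    rwa [this, Real.rpow_one] at h6

/-! ### The limit of the normalized risk -/

omit [NeZero d] in
lemma eventually_box_margin {a b : Fin d → ℝ} (hab : ∀ k, a k < -1 ∧ 1 < b k) {ρ : ℝ → ℝ}
    (hρ : Tendsto ρ (𝓝[>] 0) (𝓝 0)) :
    ∀ᶠ ε in 𝓝[>] (0 : ℝ), ∀ k, a k < -(1 + ε ^ 2 + (ρ ε + ρ ε)) ∧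
      1 + ε ^ 2 + (ρ ε + ρ ε) < b k := by
  have hsq : Tendsto (fun ε : ℝ => ε ^ 2) (𝓝[>] 0) (𝓝 0) := by
    simpa using ((continuous_pow 2).tendsto (0 : ℝ)).mono_left nhdsWithin_le_nhds
  have t : Tendsto (fun ε => 1 + ε ^ 2 + (ρ ε + ρ ε)) (𝓝[>] 0) (𝓝 1) := by
    simpa using (hsq.const_add 1).add (hρ.add hρ)
  refine eventually_all.2 fun k => ?_
  filter_upwards [t.eventually (gt_mem_nhds (show 1 < -a k by linarith [(hab k).1])),
    t.eventually (gt_mem_nhds (hab k).2)] with ε h1 h2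
  exact ⟨by linarith, h2⟩

lemma limsup_maxRisk_lt_top {c₀ C B e s C₁ C₂ p Cψ : ℝ} {N R : ℝ → ℝ} {lam : ℝ → ℝ}
    (hγ : 0 < γ) (hγ2 : γ ≤ 2) (hβ : 0 < β) (hβ2 : β ≤ 2) (hL₁ : 0 ≤ L₁) (hL₂ : 0 ≤ L₂)
    (he : 0 ≤ e) (hs0 : 0 < s) (hs1 : s ≤ 1) (hse : s ≤ 2 / (2 + e))
    (hsμ : s ≤ 2 * (min 1 γ * min 1 β)) (hR : Tendsto R (𝓝[>] 0) (𝓝 0))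
    (hc₀ : 0 < c₀) (hC : 0 < C)
    (H : ∀ᶠ l in 𝓝[>] (0 : ℝ),
      WeightBounds (baseWeight γ β l : Space d → ℝ) (R l) (N l) (c₀ * l ^ (-e / 2))
        (C * l ^ (-e / 2)) ∧
      SmallBias (compositeClass d γ β L₁ L₂) (baseWeight γ β l) (R l) (l ^ (1 + e / 2)) (B * l))
    (hC₁ : 0 < C₁) (hBC : B ≤ 4 * C₁) (hp : 0 < p) (hlam : IsBalanced d γ β C₁ C₂ lam)
    {a b : Fin d → ℝ} (hab : ∀ k, a k < -1 ∧ 1 < b k) {Ω : Type*} [MeasurableSpace Ω]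
    {P : Measure Ω} [IsProbabilityMeasure P] {W : L2 (openBox a b) → Ω → ℝ}
    (hW : IsWhiteNoise P (openBox a b) W) {M : Space d → (Space d ≃ₗᵢ[ℝ] Space d)}
    (hM : IsFrame M) {S : ℝ → Finset (Space d)} (hS : IsSphereNet S)
    {sel : ℝ → Space d → Observation (openBox a b) → Space d}
    (hsel : ∀ ε, IsSelection p ε M (S ε) (baseWeight γ β (lam ε)) (sel ε)) {ψ : ℝ → ℝ}
    (hψ : ∀ᶠ ε in 𝓝[>] (0 : ℝ), (ε * √(Real.log (1 / ε))) ^ s ≤ ψ ε)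
    (hN : ∀ᶠ ε in 𝓝[>] (0 : ℝ), N (lam ε) * (ε * √(Real.log (1 / ε))) ^ s ≤ Cψ * ψ ε) :
    limsup (fun ε => maxRisk P W (compositeClass d γ β L₁ L₂) p ε (ψ ε)
      (globalEstimator p ε M (S ε) (baseWeight γ β (lam ε)) (sel ε))) (𝓝[>] (0 : ℝ)) < ⊤ := by
  obtain ⟨L, hL, hl1, hl2⟩ := exists_common_radius L₁ L₂
  obtain ⟨c, hc⟩ := hS
  have tl := hlam.tendsto_nhdsGT
  have hμ : 0 < min 1 γ * min 1 β := by positivity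
  set μ := min 1 γ * min 1 β with hμdef
  set τ := 12 + 5 * √(4 * p + 8 * d) with hτ
  set A := (C / C₁) ^ (2 / (2 + e)) with hA
  have hτ0 : 0 < τ := by positivity
  have hA0 : 0 ≤ A := by positivity
  have tll : Tendsto (fun ε : ℝ => Real.log (Real.log (1 / ε))) (𝓝[>] 0) atTop :=
    Real.tendsto_log_atTop.comp tendsto_log_one_div
  have size := hlam.eventually_size hC₁ he hc₀ hC
    (H.mono fun l h => ⟨h.1.le_normTwo, h.1.normTwo_le⟩)
  set CC := τ * (C₂ * (A * Cψ)) + 4 * L ^ 2 * √d ^ μ with hCC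
  have main : ∀ᶠ ε in 𝓝[>] (0 : ℝ), maxRisk P W (compositeClass d γ β L₁ L₂) p ε (ψ ε)
      (globalEstimator p ε M (S ε) (baseWeight γ β (lam ε)) (sel ε)) ≤
      ENNReal.ofReal CC ^ p + ENNReal.ofReal (2 ^ p * (4 * 5 ^ d * c ^ 2)) := by
    filter_upwards [hc, hlam.2, tl.eventually H, size, eventually_Ioo,
      eventually_box_margin hab (hR.comp tl), tendsto_log_one_div.eventually_ge_atTop 1,
      tll.eventually_ge_atTop L, hψ, hN, tendsto_noise.eventually (gt_mem_nhds zero_lt_one)]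
      with ε ⟨n1, n2, _, n4⟩ ⟨hl, b1, b2⟩ ⟨w1, w2⟩ ⟨z1, z2, z3⟩ ⟨hε, hε1⟩ hbox hlog hll hψε hNε hκ1
    have hsq1 : 1 ≤ √(Real.log (1 / ε)) := Real.one_le_sqrt.2 hlog
    set κ := ε * √(Real.log (1 / ε)) with hκ
    have hκε : ε ≤ κ := le_mul_of_one_le_right hε.le hsq1
    have hκ0 : 0 < κ := hε.trans_le hκε
    have hσ : 0 < normTwo (baseWeight γ β (lam ε) : Space d → ℝ) :=
      lt_of_lt_of_le (by positivity) w1.le_normTwo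
    have hn1 := w1.one_le_normOne
    have hN1 : 1 ≤ N (lam ε) := hn1.trans w1.normOne_le
    have hκs : κ ≤ κ ^ s := by
      conv_lhs => rw [← Real.rpow_one κ]
      exact Real.rpow_le_rpow_of_exponent_ge hκ0 hκ1.le hs1
    have hC₂ : 0 < C₂ := by
      have h1 : 0 < C₂ * lam ε := lt_of_lt_of_le (by positivity) b2
      exact (pos_iff_pos_of_mul_pos h1).2 hl
    refine maxRisk_le hW hM hp hε hε1.le n4 n1 n2 (hsel ε) w1 hσ w2 z1 ?_
      (fun g hg => compositeClass_continuous hγ hγ2 hβ hβ2 hL₁ hL₂ hg)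
      (fun g hg => (compositeClass_modulus hγ hγ2 hβ2 hL₁ hL₂ hL hl1 hl2 hg).1)
      (fun g hg => (compositeClass_modulus hγ hγ2 hβ2 hL₁ hL₂ hL hl1 hl2 hg).2)
      (by positivity) hμ.le hll ?_ (by linarith) hbox (hκε.trans (hκs.trans hψε)) ?_
    · rw [← hκ, mul_comm (normTwo _)]
      have := mul_le_mul_of_nonneg_right hBC hl.le
      linarith
    · exact (Real.log_le_self (by linarith)).trans (Real.log_le_self (by positivity))
    · change τ * (normOne (baseWeight γ β (lam ε) : Space d → ℝ) *
        normTwo (baseWeight γ β (lam ε) : Space d → ℝ) * κ) + 4 * L ^ 2 * (√d * ε ^ 2) ^ μ ≤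
          CC * ψ ε
      rw [hCC, add_mul (τ * (C₂ * (A * Cψ)))]
      refine add_le_add ?_ ?_
      · have s1 : lam ε ≤ A * κ ^ s := z3.trans
          (mul_le_mul_of_nonneg_left (Real.rpow_le_rpow_of_exponent_ge hκ0 hκ1.le hse) hA0)
        rw [mul_assoc τ]
        refine mul_le_mul_of_nonneg_left ?_ hτ0.le
        calc normOne (baseWeight γ β (lam ε)) * normTwo (baseWeight γ β (lam ε)) * κ
            = normOne (baseWeight γ β (lam ε)) * (κ * normTwo (baseWeight γ β (lam ε))) := by ring
          _ ≤ N (lam ε) * (C₂ * (A * κ ^ s)) := by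
            refine mul_le_mul w1.normOne_le (b2.trans ?_) (by positivity) (by linarith)
            exact mul_le_mul_of_nonneg_left s1 hC₂.le
          _ = C₂ * A * (N (lam ε) * κ ^ s) := by ring
          _ ≤ C₂ * A * (Cψ * ψ ε) := by gcongr
          _ = C₂ * (A * Cψ) * ψ ε := by ring
      · rw [Real.mul_rpow (by positivity) (by positivity), mul_assoc (4 * L ^ 2)]
        refine mul_le_mul_of_nonneg_left (mul_le_mul_of_nonneg_left ?_ (by positivity))
          (by positivity)
        refine le_trans ?_ hψε
        -- The grid error has order `ε^(2μ)`, and `ε^(2μ) ≤ ε^s ≤ κ^s` since `s ≤ 2 μ`.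
        rw [← Real.rpow_two, ← Real.rpow_mul hε.le]
        exact (Real.rpow_le_rpow_of_exponent_ge hε hε1.le hsμ).trans
          (Real.rpow_le_rpow hε.le hκε hs0.le)
  refine (limsup_le_of_le (by isBoundedDefault) main).trans_lt ?_
  exact ENNReal.add_lt_top.2
    ⟨ENNReal.rpow_lt_top_of_nonneg hp.le ENNReal.ofReal_ne_top, ENNReal.ofReal_lt_top⟩

end Composite

end

theorem theorem2 (d : ℕ) [NeZero d] (γ β L₁ L₂ : ℝ)
    (hγ : 0 < γ ∧ γ ≤ 2) (hβ : 0 < β ∧ β ≤ 2) (hL₁ : 0 < L₁) (hL₂ : 0 < L₂) :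
    ∃ C₀ : ℝ, 0 < C₀ ∧ ∀ C₁ : ℝ, C₀ ≤ C₁ →
      (∃ C₂ : ℝ, ∃ lam : ℝ → ℝ, IsBalanced d γ β C₁ C₂ lam) ∧
      ∀ (p : ℝ), 0 < p →
      ∀ (C₂ : ℝ) (lam : ℝ → ℝ), IsBalanced d γ β C₁ C₂ lam →
      ∀ (a b : Fin d → ℝ), (∀ k, a k < -1 ∧ 1 < b k) →
      ∀ {Ω : Type*} [MeasurableSpace Ω] (P : Measure Ω) [IsProbabilityMeasure P]
        (W : L2 (openBox a b) → Ω → ℝ), IsWhiteNoise P (openBox a b) W →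
      ∀ (M : Space d → (Space d ≃ₗᵢ[ℝ] Space d)), IsFrame M →
      ∀ (S : ℝ → Finset (Space d)), IsSphereNet S →
      ∀ (sel : ℝ → Space d → Observation (openBox a b) → Space d),
        (∀ ε, IsSelection p ε M (S ε) (baseWeight γ β (lam ε)) (sel ε)) →
      ((γ, β) ∉ zoneTwo d →
        limsup (fun ε => maxRisk P W (compositeClass d γ β L₁ L₂) p ε
            (rate d γ β ε)
            (globalEstimator p ε M (S ε) (baseWeight γ β (lam ε)) (sel ε)))
          (𝓝[>] (0 : ℝ)) < ⊤) ∧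
      ((γ, β) ∈ zoneTwo d →
        limsup (fun ε => maxRisk P W (compositeClass d γ β L₁ L₂) p ε
            ((⌈Real.log (Real.log (1 / ε))⌉ : ℝ) * rate d γ β ε)
            (globalEstimator p ε M (S ε) (baseWeight γ β (lam ε)) (sel ε)))
          (𝓝[>] (0 : ℝ)) < ⊤) := by
  obtain ⟨hγ0, hγ2⟩ := hγ
  obtain ⟨hβ0, hβ2⟩ := hβ
  obtain ⟨e, s, N, he, hs0, hs1, hse, hsμ, hrate, hfam, C', hC', hN⟩ :=
    exists_isWeightFamily_baseWeight (d := d) hγ0 hγ2 hβ0 hβ2 hL₁.le hL₂.le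
  have hfam' := hfam
  obtain ⟨R, hR, c₀, C, B, hc₀, hC, hB, H⟩ := hfam'
  -- For `C₁ ≥ B/4` the bias `B λ` is at most `4 C₁ λ ≤ 4 κ ‖K‖₂`, the allowance in the
  -- acceptability test.
  refine ⟨B / 4, by positivity, fun C₁ hC₁ => ?_⟩
  have hC₁0 : 0 < C₁ := lt_of_lt_of_le (by positivity) hC₁
  refine ⟨hfam.exists_isBalanced he hC₁0, ?_⟩
  intro p hp C₂ lam hlam a b hab Ω _ P _ W hW M hM S hS sel hsel
  have tl := hlam.tendsto_nhdsGT
  have size := hlam.eventually_size hC₁0 he hc₀ hC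
    (H.mono fun l h => ⟨h.1.le_normTwo, h.1.normTwo_le⟩)
  have tll : Tendsto (fun ε : ℝ => Real.log (Real.log (1 / ε))) (𝓝[>] 0) atTop :=
    Real.tendsto_log_atTop.comp tendsto_log_one_div
  constructor
  · intro hz
    refine limsup_maxRisk_lt_top (Cψ := C') hγ0 hγ2 hβ0 hβ2 hL₁.le hL₂.le he hs0 hs1 hse hsμ hR hc₀
      hC H hC₁0 (by linarith) hp hlam hab hW hM hS hsel
      (Eventually.of_forall fun ε => (hrate ε).ge) (Eventually.of_forall fun ε => ?_)
    rcases hN with hN | ⟨hz', _⟩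
    · rw [hN, hrate]
    · exact absurd hz' hz
  · intro _
    have cast_ge : ∀ᶠ ε in 𝓝[>] (0 : ℝ), 1 ≤ (⌈Real.log (Real.log (1 / ε))⌉ : ℝ) := by
      filter_upwards [tll.eventually_ge_atTop 1] with ε h
      exact h.trans (Int.le_ceil _)
    refine limsup_maxRisk_lt_top (Cψ := C') hγ0 hγ2 hβ0 hβ2 hL₁.le hL₂.le he hs0 hs1 hse hsμ hR hc₀
      hC H hC₁0 (by linarith) hp hlam hab hW hM hS hsel ?_ ?_
    · filter_upwards [cast_ge, eventually_Ioo] with ε h1 ⟨hε, _⟩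
      rw [hrate]
      exact le_mul_of_one_le_left (by positivity) h1
    · filter_upwards [cast_ge, eventually_Ioo, size, tl.eventually eventually_Ioo] with ε h1 ⟨hε, _⟩
        ⟨_, h2, _⟩ ⟨h3, h4⟩
      rw [hrate, ← mul_assoc]
      refine mul_le_mul_of_nonneg_right ?_ (by positivity)
      rcases hN with hN | ⟨_, hN⟩
      · rw [hN]
        exact le_mul_of_one_le_right hC' h1
      · rw [hN]
        -- Since `ε ≤ λ`, the iterated logarithm of `1/λ` is bounded by that of `1/ε`, and then by
        -- its ceiling.
        refine mul_le_mul_of_nonneg_left (le_trans ?_ (Int.le_ceil _)) hC'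
        have h5 : 0 < Real.log (1 / lam ε) := Real.log_pos (by rwa [lt_div_iff₀ h3, one_mul])
        exact Real.log_le_log h5 (Real.log_le_log (by positivity)
          (one_div_le_one_div_of_le hε h2))
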